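/- **Theorem (Lieb–Thirring inequality in a box, potential version).** Let $d\ge 2$. There is a constant $\tilde L(d)>0$, depending only on $d$, such that the following holds for every number of spin states $q\in\mathbb N$, every $L>0$, every $\mu\ge 0$ and every real-valued $V\in L^{1+d/2}(C_L)$, where $C_L=[-L/2,L/2)^d$. Let $-\Delta_L$ be the Laplacian with periodic boundary conditions on $L^2(C_L,\mathbb C^q)$, let $-\Delta_L+V$ be defined through its quadratic form, and let $x_-=\max(-x,0)$. Denote by $$\rho_{0,L}=\frac{q}{L^d}\,\#\{p\in(2\pi\mathbb Z/L)^d : |p|^2\le\mu\}\qquad\text{and}\qquad \rho_0=\frac{q}{(2\pi)^d}\,\big|\{p\in\mathbb R^d:|p|^2<\mu\}\big|$$ the constant densities of the free Fermi gas $\mathbf 1(-\Delta_L\le\mu)$ in the box and of the free Fermi gas $\mathbf 1(-\Delta\le\mu)$ in the whole space, respectively, and set, for $\rho\in\mathbb R$, $$\mathcal E(\rho)=-\operatorname{tr}(-\Delta_L+V-\mu)_-+\operatorname{tr}(-\Delta_L-\mu)_--\rho\int_{C_L}V .$$ Then both traces are finite and $$\mathcal E(\rho_{0,L})\le 0 .$$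 If $\mu>1/L^2$, then, for $\rho=\rho_{0,L}$ and also for $\rho=\rho_0$, $$\mathcal E(\rho)\ \ge\ -q\,\tilde L(d)\int_{C_L}\Big((V-\mu)_-^{1+\frac d2}-\mu^{1+\frac d2}+\tfrac{2+d}{2}\mu^{\frac d2}V+\frac{\mu^{\frac{d-1}2}}{L}|V|\Big)dx .$$ If $\mu\le 1/L^2$, then, for $\rho=\rho_{0,L}$ and also for $\rho=\rho_0$, $$\mathcal E(\rho)\ \ge\ -q\,\tilde L(d)\int_{C_L}\Big(V_-^{1+\frac d2}+\frac{1}{L^d}|V|\Big)dx .$$ -/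

import Mathlib

open MeasureTheory
open scoped ENNReal

noncomputable section

namespace LTBox

/-- The box `C_L = [-L/2, L/2)^d`. -/
def box (d : ℕ) (L : ℝ) : Set (EuclideanSpace ℝ (Fin d)) :=
  {x | ∀ i, x i ∈ Set.Ico (-(L / 2)) (L / 2)}

/-- Lebesgue measure on the box. -/
abbrev boxMeasure (d : ℕ) (L : ℝ) : Measure (EuclideanSpace ℝ (Fin d)) :=
  volume.restrict (box d L)

/-- The Hilbert space `L²(C_L, ℂ^q)`. -/
abbrev BoxL2 (d q : ℕ) (L : ℝ) : Type :=
  Lp (EuclideanSpace ℂ (Fin q)) 2 (boxMeasure d L)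

/-- The complex conjugate of the plane wave `e_k(x) = L^{-d/2} exp(i (2π/L) k·x)`, `k ∈ ℤ^d`. -/
def planeWaveConj (d : ℕ) (L : ℝ) (k : Fin d → ℤ) (x : EuclideanSpace ℝ (Fin d)) : ℂ :=
  ((L ^ (-(d : ℝ) / 2) : ℝ) : ℂ) *
    Complex.exp (((-(2 * Real.pi / L * ∑ i, (k i : ℝ) * x i) : ℝ) : ℂ) * Complex.I)

/-- The Fourier coefficient `û(k) = ∫_{C_L} conj(e_k(x)) u(x) dx ∈ ℂ^q`. -/
def fourierCoeff {d q : ℕ} {L : ℝ} (u : BoxL2 d q L) (k : Fin d → ℤ) :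
    EuclideanSpace ℂ (Fin q) :=
  ∫ x, planeWaveConj d L k x • u x ∂(boxMeasure d L)

/-- The squared length `|p|²` of the momentum `p = (2π/L) k`, i.e. the eigenvalue of `-Δ_L`
on `e_k`. -/
def momentumSq (d : ℕ) (L : ℝ) (k : Fin d → ℤ) : ℝ :=
  (2 * Real.pi / L) ^ 2 * ∑ i, (k i : ℝ) ^ 2

lemma momentumSq_nonneg (d : ℕ) (L : ℝ) (k : Fin d → ℤ) : 0 ≤ momentumSq d L k := by
  unfold momentumSq; positivity

/-- Membership in the form domain of `-Δ_L + V`: the function `u` lies in the periodic Sobolev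
space `H¹` (that is `∑_p |p|² |û(p)|² < ∞`), and `∫ |V| |u|² < ∞`. -/
def InFormDomain {d q : ℕ} {L : ℝ} (V : EuclideanSpace ℝ (Fin d) → ℝ) (u : BoxL2 d q L) : Prop :=
  Summable (fun k => momentumSq d L k * ‖fourierCoeff u k‖ ^ 2) ∧
    Integrable (fun x => V x * ‖u x‖ ^ 2) (boxMeasure d L)

/-- The sesquilinear form of `-Δ_L + V`,
`a(v,u) = ∑_p |p|² ⟨v̂(p), û(p)⟩ + ∫ V ⟨v, u⟩ = ∫ ⟨∇v, ∇u⟩ + ∫ V ⟨v, u⟩`. -/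
def energyForm {d q : ℕ} {L : ℝ} (V : EuclideanSpace ℝ (Fin d) → ℝ) (v u : BoxL2 d q L) : ℂ :=
  (∑' k, (momentumSq d L k : ℂ) * inner ℂ (fourierCoeff v k) (fourierCoeff u k)) +
    ∫ x, (V x : ℂ) * inner ℂ (v x) (u x) ∂(boxMeasure d L)

section Linearity

variable {d q : ℕ} {L : ℝ} {V : EuclideanSpace ℝ (Fin d) → ℝ}

lemma box_finite (d : ℕ) (L : ℝ) : volume (box d L) < ⊤ := by
  have h : Bornology.IsBounded (box d L) := by
    refine (Metric.isBounded_closedBall (x := (0 : EuclideanSpace ℝ (Fin d)))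
      (r := √(d * (L / 2) ^ 2))).subset ?_
    intro x hx
    rw [mem_closedBall_zero_iff, EuclideanSpace.norm_eq]
    apply Real.sqrt_le_sqrt
    have : ∀ i ∈ (Finset.univ : Finset (Fin d)), ‖x i‖ ^ 2 ≤ (L / 2) ^ 2 := by
      intro i _
      have := hx i
      rw [Real.norm_eq_abs, sq_abs]
      exact sq_le_sq' this.1 this.2.le
    simpa using Finset.sum_le_card_nsmul _ _ _ this
  exact h.measure_lt_top

instance (d : ℕ) (L : ℝ) : IsFiniteMeasure (boxMeasure d L) :=
  ⟨by simpa using box_finite d L⟩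

lemma integrable_planeWave (u : BoxL2 d q L) (k : Fin d → ℤ) :
    Integrable (fun x => planeWaveConj d L k x • u x) (boxMeasure d L) := by
  have hu : Integrable (fun x => u x) (boxMeasure d L) :=
    (Lp.memLp u).integrable (by norm_num)
  refine hu.bdd_smul (φ := planeWaveConj d L k) |L ^ (-(d : ℝ) / 2)| ?_
    (Filter.Eventually.of_forall fun x => ?_)
  · apply Continuous.aestronglyMeasurable
    unfold planeWaveConj
    fun_prop
  · rw [planeWaveConj, norm_mul, Complex.norm_exp_ofReal_mul_I, mul_one, Complex.norm_real,
      Real.norm_eq_abs]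

lemma fourierCoeff_add (u v : BoxL2 d q L) (k : Fin d → ℤ) :
    fourierCoeff (u + v) k = fourierCoeff u k + fourierCoeff v k := by
  unfold fourierCoeff
  rw [← integral_add (integrable_planeWave u k) (integrable_planeWave v k)]
  refine integral_congr_ae ?_
  filter_upwards [Lp.coeFn_add u v] with x hx
  rw [hx, Pi.add_apply, smul_add]

lemma fourierCoeff_smul (c : ℂ) (u : BoxL2 d q L) (k : Fin d → ℤ) :
    fourierCoeff (c • u) k = c • fourierCoeff u k := by
  unfold fourierCoeff
  rw [← integral_smul]
  refine integral_congr_ae ?_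
  filter_upwards [Lp.coeFn_smul c u] with x hx
  rw [hx, Pi.smul_apply, smul_comm]

lemma fourierCoeff_zero (k : Fin d → ℤ) : fourierCoeff (0 : BoxL2 d q L) k = 0 := by
  simpa using fourierCoeff_smul (0 : ℂ) (0 : BoxL2 d q L) k

lemma norm_inner_le_sq {E : Type*} [NormedAddCommGroup E] [InnerProductSpace ℂ E] (a b : E) :
    ‖(inner ℂ a b : ℂ)‖ ≤ ‖a‖ ^ 2 + ‖b‖ ^ 2 := by
  have := norm_inner_le_norm (𝕜 := ℂ) a b
  nlinarith [sq_nonneg (‖a‖ - ‖b‖), sq_nonneg ‖a‖, sq_nonneg ‖b‖]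

lemma summable_kinetic {v u : BoxL2 d q L} (hv : InFormDomain V v) (hu : InFormDomain V u) :
    Summable (fun k => (momentumSq d L k : ℂ) *
      inner ℂ (fourierCoeff v k) (fourierCoeff u k)) := by
  refine Summable.of_norm_bounded (hv.1.add hu.1) fun k => ?_
  rw [norm_mul, Complex.norm_real, Real.norm_of_nonneg (momentumSq_nonneg d L k), ← mul_add]
  exact mul_le_mul_of_nonneg_left (norm_inner_le_sq _ _) (momentumSq_nonneg d L k)

lemma integrable_potential {v u : BoxL2 d q L} (hv : InFormDomain V v) (hu : InFormDomain V u) :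
    Integrable (fun x => (V x : ℂ) * inner ℂ (v x) (u x)) (boxMeasure d L) := by
  have hvm : AEStronglyMeasurable (fun x => v x) (boxMeasure d L) := Lp.aestronglyMeasurable v
  have hum : AEStronglyMeasurable (fun x => u x) (boxMeasure d L) := Lp.aestronglyMeasurable u
  refine (hv.2.norm.add hu.2.norm).mono' ?_ (Filter.Eventually.of_forall fun x => ?_)
  · have h1 : AEStronglyMeasurable
        (fun x => ((V x * ‖u x‖ ^ 2 : ℝ) : ℂ) *
          ((inner ℂ (v x) (u x) : ℂ) * (((‖u x‖ ^ 2)⁻¹ : ℝ) : ℂ))) (boxMeasure d L) := by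
      refine (Complex.continuous_ofReal.comp_aestronglyMeasurable hu.2.1).mul
        ((hvm.inner hum).mul (Complex.continuous_ofReal.comp_aestronglyMeasurable ?_))
      exact (hum.norm.aemeasurable.pow_const 2).inv.aestronglyMeasurable
    refine h1.congr (Filter.Eventually.of_forall fun x => ?_)
    by_cases h0 : u x = 0
    · simp [h0]
    · have h2 : ((‖u x‖ : ℝ) : ℂ) ≠ 0 := by simpa using h0
      simp only
      push_cast
      field_simp
  · rw [norm_mul, Complex.norm_real]
    simp only [Pi.add_apply, norm_mul, norm_pow, norm_norm]
    rw [← mul_add]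
    exact mul_le_mul_of_nonneg_left (norm_inner_le_sq _ _) (norm_nonneg _)

lemma InFormDomain.add {u v : BoxL2 d q L} (hu : InFormDomain V u) (hv : InFormDomain V v) :
    InFormDomain V (u + v) := by
  constructor
  · refine Summable.of_nonneg_of_le
      (fun k => mul_nonneg (momentumSq_nonneg d L k) (sq_nonneg _)) (fun k => ?_)
      ((hu.1.add hv.1).mul_left 2)
    have h1 := norm_add_le (fourierCoeff u k) (fourierCoeff v k)
    rw [fourierCoeff_add, ← mul_add, mul_left_comm]
    refine mul_le_mul_of_nonneg_left ?_ (momentumSq_nonneg d L k)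
    nlinarith [sq_nonneg (‖fourierCoeff u k‖ - ‖fourierCoeff v k‖),
      norm_nonneg (fourierCoeff u k + fourierCoeff v k)]
  · have h := (hu.2.add hv.2).add ((integrable_potential hu hv).re.const_mul 2)
    refine h.congr ?_
    filter_upwards [Lp.coeFn_add u v] with x hx
    rw [hx]
    simp only [Pi.add_apply]
    rw [norm_add_sq (𝕜 := ℂ)]
    simp only [RCLike.re_to_complex, Complex.re_ofReal_mul]
    ring

lemma InFormDomain.smul {u : BoxL2 d q L} (c : ℂ) (hu : InFormDomain V u) :
    InFormDomain V (c • u) := by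
  constructor
  · refine (hu.1.mul_left (‖c‖ ^ 2)).congr fun k => ?_
    rw [fourierCoeff_smul, norm_smul]
    ring
  · refine (hu.2.const_mul (‖c‖ ^ 2)).congr ?_
    filter_upwards [Lp.coeFn_smul c u] with x hx
    rw [hx, Pi.smul_apply, norm_smul]
    ring

lemma InFormDomain.zero : InFormDomain V (0 : BoxL2 d q L) := by
  constructor
  · simp [fourierCoeff_zero]
  · refine (integrable_zero _ _ _).congr ?_
    filter_upwards [Lp.coeFn_zero (EuclideanSpace ℂ (Fin q)) 2 (boxMeasure d L)] with x hx
    rw [hx]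
    simp

lemma energyForm_add {v u u' : BoxL2 d q L} (hv : InFormDomain V v) (hu : InFormDomain V u)
    (hu' : InFormDomain V u') :
    energyForm V v (u + u') = energyForm V v u + energyForm V v u' := by
  have h1 : ∫ x, (V x : ℂ) * inner ℂ (v x) ((u + u') x) ∂(boxMeasure d L) =
      (∫ x, (V x : ℂ) * inner ℂ (v x) (u x) ∂(boxMeasure d L)) +
        ∫ x, (V x : ℂ) * inner ℂ (v x) (u' x) ∂(boxMeasure d L) := by
    rw [← integral_add (integrable_potential hv hu) (integrable_potential hv hu')]
    refine integral_congr_ae ?_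
    filter_upwards [Lp.coeFn_add u u'] with x hx
    rw [hx, Pi.add_apply, inner_add_right, mul_add]
  unfold energyForm
  rw [h1]
  simp only [fourierCoeff_add, inner_add_right, mul_add]
  rw [(summable_kinetic hv hu).tsum_add (summable_kinetic hv hu')]
  ring

lemma energyForm_smul (c : ℂ) (v u : BoxL2 d q L) :
    energyForm V v (c • u) = c * energyForm V v u := by
  have h1 : ∫ x, (V x : ℂ) * inner ℂ (v x) ((c • u) x) ∂(boxMeasure d L) =
      c * ∫ x, (V x : ℂ) * inner ℂ (v x) (u x) ∂(boxMeasure d L) := by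
    rw [← integral_const_mul]
    refine integral_congr_ae ?_
    filter_upwards [Lp.coeFn_smul c u] with x hx
    rw [hx, Pi.smul_apply, inner_smul_right]
    ring
  unfold energyForm
  rw [h1, mul_add, ← tsum_mul_left]
  congr 1
  refine tsum_congr fun k => ?_
  rw [fourierCoeff_smul, inner_smul_right]
  ring

end Linearity

/-- The graph of the operator `H = -Δ_L + V` on `L²(C_L, ℂ^q)` associated with the quadratic form:
`(u, w)` belongs to it (that is, `u ∈ D(H)` and `H u = w`) if `u` is in the form domain and
`a(v,u) = ⟨v, w⟩` for every `v` in the form domain. -/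
def schrodingerGraph (d q : ℕ) (L : ℝ) (V : EuclideanSpace ℝ (Fin d) → ℝ) :
    Submodule ℂ (BoxL2 d q L × BoxL2 d q L) where
  carrier := {p | InFormDomain V p.1 ∧ ∀ v, InFormDomain V v → energyForm V v p.1 = inner ℂ v p.2}
  add_mem' := by
    rintro ⟨u, w⟩ ⟨u', w'⟩ ⟨hu, hw⟩ ⟨hu', hw'⟩
    refine ⟨hu.add hu', fun v hv => ?_⟩
    have h1 := hw v hv
    have h2 := hw' v hv
    simp only [Prod.mk_add_mk] at h1 h2 ⊢
    rw [energyForm_add hv hu hu', h1, h2, inner_add_right]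
  zero_mem' := by
    refine ⟨InFormDomain.zero, fun v _ => ?_⟩
    have h := energyForm_smul (V := V) (0 : ℂ) v 0
    simpa using h
  smul_mem' := by
    rintro c ⟨u, w⟩ ⟨hu, hw⟩
    refine ⟨hu.smul c, fun v hv => ?_⟩
    have h1 := hw v hv
    simp only [Prod.smul_mk] at h1 ⊢
    rw [energyForm_smul, h1, inner_smul_right]

/-- The eigenspace `ker (-Δ_L + V - E)`. -/
def eigenspace (d q : ℕ) (L : ℝ) (V : EuclideanSpace ℝ (Fin d) → ℝ) (E : ℝ) :
    Submodule ℂ (BoxL2 d q L) :=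
  (schrodingerGraph d q L V).comap (LinearMap.id.prod ((E : ℂ) • LinearMap.id))

/-- The trace `tr (-Δ_L + V - μ)_-` of the negative part. As `-Δ_L + V` has discrete spectrum, it is
the sum of `(E - μ)_-` over the eigenvalues `E` of `-Δ_L + V`, repeated with multiplicity; the value
`∞` is allowed at this point. -/
def traceNeg (d q : ℕ) (L : ℝ) (V : EuclideanSpace ℝ (Fin d) → ℝ) (μ : ℝ) : ℝ≥0∞ :=
  ∑' E : ℝ, ENNReal.ofReal (E - μ)⁻ *
    ((Module.rank ℂ (eigenspace d q L V E)).toENat : ℝ≥0∞)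

/-- The density of the infinite free Fermi gas at chemical potential `μ`,
`q (2π)^{-d} |{p ∈ ℝ^d : |p|² < μ}|`. -/
def freeDensity (d q : ℕ) (μ : ℝ) : ℝ :=
  q * (2 * Real.pi) ^ (-(d : ℝ)) *
    (volume {p : EuclideanSpace ℝ (Fin d) | ‖p‖ ^ 2 < μ}).toReal

/-- The (constant) density of the free Fermi gas `1(-Δ_L ≤ μ)` in the box,
`q L^{-d} #{p ∈ (2πℤ/L)^d : |p|² ≤ μ}`. -/
def boxDensity (d q : ℕ) (L μ : ℝ) : ℝ :=
  q * (Set.ncard {k : Fin d → ℤ | momentumSq d L k ≤ μ} : ℝ) / L ^ d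

/-- `-tr (-Δ_L + V - μ)_- + tr (-Δ_L - μ)_- - ρ ∫_{C_L} V`. -/
def relativeEnergy (d q : ℕ) (L : ℝ) (V : EuclideanSpace ℝ (Fin d) → ℝ) (μ ρ : ℝ) : ℝ :=
  -(traceNeg d q L V μ).toReal + (traceNeg d q L 0 μ).toReal - ρ * ∫ x in box d L, V x

/-- The right side of the bound for `μ > 1/L²` without its constant. -/
def largeMuBound (d : ℕ) (L : ℝ) (V : EuclideanSpace ℝ (Fin d) → ℝ) (μ : ℝ) : ℝ :=
  ∫ x in box d L, ((V x - μ)⁻ ^ (1 + (d : ℝ) / 2) - μ ^ (1 + (d : ℝ) / 2)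
    + (2 + (d : ℝ)) / 2 * μ ^ ((d : ℝ) / 2) * V x + μ ^ (((d : ℝ) - 1) / 2) / L * |V x|)

/-- The right side of the bound for `μ ≤ 1/L²` without its constant. -/
def smallMuBound (d : ℕ) (L : ℝ) (V : EuclideanSpace ℝ (Fin d) → ℝ) : ℝ :=
  ∫ x in box d L, ((V x)⁻ ^ (1 + (d : ℝ) / 2) + 1 / L ^ d * |V x|)

end LTBox

end

noncomputable section

namespace LTBox

/-! ### Plane waves on the box, transferred from the unit torus -/

section Torus

-- Write d = m + 2, p = 2πk/L with k in ℤ^d, and μ = (2π/L)²R², so that the Fermi ball becomes the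
-- lattice ball |k| ≤ R.
--
-- The bound E(ρ_{0,L}) ≤ 0 is the variational principle `sum_sub_energyForm_le` with the plane
-- waves of the Fermi ball as trial states: each has constant density L^{-d}, so V enters only
-- through its integral.
--
-- For the lower bounds, let Γ be the projection onto finitely many orthonormal eigenfunctions and
-- Γ' = 1 - Γ. Filling the Fermi ball is optimal for the kinetic part, so ∑(μ - E_j) equals the free
-- value minus the excitation energy (holes inside the ball and particles outside, each weighted by
-- ||p|² - μ|) minus ∫ V ρ_Γ. Everything reduces to showing that ∫ V (ρ_Γ - ρ_{0,L}) is at least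
-- minus the excitation energy minus an error: this is `exists_neg_excitationEnergy_le`. The momenta
-- are split into those deep inside the ball, those far outside, and a shell of fixed width around
-- the Fermi sphere, and three effects are treated separately.
--
-- The hole density inside and the particle density outside are handled by a layer-cake argument
-- (`lintegral_mul_modeDensity_le`): modes of excitation energy above a level of order |V(x)| are
-- paid for by the excitation energy, and modes below it are counted. Away from the shell the count
-- gives the error μ^{d/2-1}V² + |V|^{1+d/2}.
--
-- The coupling between inside and outside is the delicate part, since counting does not see it.
-- Expand V in Fourier coefficients and apply Young's inequality against the excitation energy. What
-- remains is ∫V² times the maximum over k of a discrete Lindhard function, the sum of 1/(|p+k|² -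
-- |p|²) over |p| < R < |p+k|, which is at most C R^{d-2} uniformly in k (`lindhard_sum_le`,
-- `exists_integral_cross_le`).
--
-- The shell contains at most C(1+R)^{d-1} modes and is estimated trivially. It is the source of the
-- |V| term, and the difference between ρ_0 and ρ_{0,L}, a lattice point discrepancy, has the same
-- order.
--
-- The error V² + |V|^{1+d/2} is too large where V is large and positive, because the target is only
-- linear in V there. Hence V is first lowered to some U ≤ V, at the price of the density times ∫(V
-- - U), and elementary inequalities convert the error into the stated densities.
--
-- The trace is a sum over eigenspaces, so bounding it from below requires a complete system of
-- eigenfunctions. The layer-cake argument gives a relative form bound for V. With T = (-Δ_L +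
-- M)^{-1/2}, the form becomes that of 1 + B with ‖B‖ ≤ 1/2, and T(1+B)^{-1}T is compact and can be
-- diagonalised.

local instance : MeasureSpace UnitAddCircle := ⟨AddCircle.haarAddCircle⟩

local instance : Measure.IsAddHaarMeasure (volume : Measure UnitAddCircle) :=
  inferInstanceAs (Measure.IsAddHaarMeasure AddCircle.haarAddCircle)

local instance : IsProbabilityMeasure (volume : Measure UnitAddCircle) :=
  inferInstanceAs (IsProbabilityMeasure AddCircle.haarAddCircle)

/-- The half-open interval representatives of a point of the torus, rescaled to the box. -/
def torusToBox (d : ℕ) (L : ℝ) (t : UnitAddTorus (Fin d)) : EuclideanSpace ℝ (Fin d) :=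
  L • WithLp.toLp 2 (UnitAddTorus.measurableEquivPiIoc (fun _ : Fin d => -(1 / 2 : ℝ)) t).1

lemma measurableSet_box (d : ℕ) (L : ℝ) : MeasurableSet (box d L) := by
  have : box d L = ⋂ i, (fun x : EuclideanSpace ℝ (Fin d) => x i) ⁻¹' Set.Ico (-(L / 2)) (L / 2) := by
    ext x; simp [box]
  rw [this]
  refine MeasurableSet.iInter fun i => measurableSet_Ico.preimage ?_
  fun_prop

/-- The torus carries a probability measure and the box has volume L^d, which explains the factor.
Every identity for Fourier series is carried to the box through this map. -/
lemma measurePreserving_torusToBox (d : ℕ) {L : ℝ} (hL : 0 < L) :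
    MeasurePreserving (torusToBox d L) volume
      (ENNReal.ofReal ((L ^ d)⁻¹) • boxMeasure d L) := by
  set a : Fin d → ℝ := fun _ => -(1 / 2 : ℝ)
  set S : Set (Fin d → ℝ) := {x | ∀ i, x i ∈ Set.Ioc (a i) (a i + 1)}
  have hS : MeasurableSet S := MeasurableSet.univ_pi' fun i => measurableSet_Ioc
  have h1 := UnitAddTorus.measurePreserving_equivPiIoc a
  have h2 : MeasurePreserving (Subtype.val : S → Fin d → ℝ) (Measure.comap Subtype.val volume)
      (volume.restrict S) := measurePreserving_subtype_coe hS
  set S' : Set (Fin d → ℝ) := {x | ∀ i, x i ∈ Set.Ico (a i) (a i + 1)}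
  -- The torus is represented by intervals open on the left, the box by intervals open on the right;
  -- they differ by a null set.
  have hSS : (volume.restrict S : Measure (Fin d → ℝ)) = volume.restrict S' := by
    have e1 : S = Set.pi Set.univ fun i => Set.Ioc (a i) (a i + 1) := by ext; simp [S]
    have e2 : S' = Set.pi Set.univ fun i => Set.Ico (a i) (a i + 1) := by ext; simp [S']
    rw [e1, e2, volume_pi, Measure.restrict_pi_pi, Measure.restrict_pi_pi]
    congr 1
    funext i
    exact Measure.restrict_congr_set Ico_ae_eq_Ioc.symm
  rw [hSS] at h2
  have hL' : L ≠ 0 := hL.ne'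
  have h3 : MeasurePreserving (fun x : Fin d → ℝ => L • WithLp.toLp 2 x) (volume.restrict S')
      (ENNReal.ofReal ((L ^ d)⁻¹) • boxMeasure d L) := by
    have hm : Measurable (fun x : Fin d → ℝ => (L • WithLp.toLp 2 x : EuclideanSpace ℝ (Fin d))) := by
      fun_prop
    refine ⟨hm, ?_⟩
    have hpre : S' = (fun x : Fin d → ℝ => (L • WithLp.toLp 2 x : EuclideanSpace ℝ (Fin d))) ⁻¹'
        box d L := by
      ext x
      simp only [S', a, box, Set.mem_ofPred_eq, Set.mem_preimage, Set.mem_Ico, PiLp.smul_apply,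
        smul_eq_mul]
      refine forall_congr' fun i => and_congr ⟨fun h => ?_, fun h => ?_⟩ ⟨fun h => ?_, fun h => ?_⟩
      · nlinarith
      · by_contra hc; nlinarith
      · nlinarith
      · by_contra hc; nlinarith
    rw [hpre, ← Measure.restrict_map hm (measurableSet_box d L)]
    have : Measure.map (fun x : Fin d → ℝ => (L • WithLp.toLp 2 x : EuclideanSpace ℝ (Fin d)))
        volume = ENNReal.ofReal ((L ^ d)⁻¹) • volume := by
      have hc : (fun x : Fin d → ℝ => (L • WithLp.toLp 2 x : EuclideanSpace ℝ (Fin d))) =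
          (fun y : EuclideanSpace ℝ (Fin d) => L • y) ∘ WithLp.toLp 2 := rfl
      rw [hc, ← Measure.map_map (by fun_prop) (by fun_prop),
        (PiLp.volume_preserving_toLp (Fin d)).map_eq, Measure.map_addHaar_smul _ hL']
      simp [abs_of_pos hL]
    rw [this, Measure.restrict_smul]
  exact h3.comp (h2.comp h1)

lemma planeWaveConj_torusToBox {d : ℕ} {L : ℝ} (hL : 0 < L) (k : Fin d → ℤ)
    (t : UnitAddTorus (Fin d)) :
    planeWaveConj d L k (torusToBox d L t) =
      ((L ^ (-(d : ℝ) / 2) : ℝ) : ℂ) * UnitAddTorus.mFourier (-k) t := by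
  unfold planeWaveConj torusToBox
  congr 1
  set y := UnitAddTorus.measurableEquivPiIoc (fun _ : Fin d => -(1 / 2 : ℝ)) t with hy
  have ht : t = fun i => ((y.1 i : ℝ) : UnitAddCircle) := by
    rw [← UnitAddTorus.coe_symm_measurableEquivPiIoc_apply, hy, MeasurableEquiv.symm_apply_apply]
  conv_rhs => rw [ht]
  simp only [UnitAddTorus.mFourier, ContinuousMap.coe_mk, fourier_coe_apply, ← Complex.exp_sum]
  congr 1
  rw [Finset.mul_sum, ← Finset.sum_neg_distrib, Complex.ofReal_sum, Finset.sum_mul]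
  refine Finset.sum_congr rfl fun i _ => ?_
  simp only [PiLp.smul_apply, smul_eq_mul, Pi.neg_apply]
  have : (L : ℂ) ≠ 0 := by exact_mod_cast hL.ne'
  push_cast
  field_simp

lemma rpow_neg_half_sq (d : ℕ) {L : ℝ} (hL : 0 < L) :
    (L ^ (-(d : ℝ) / 2)) ^ 2 = (L ^ d)⁻¹ := by
  rw [← Real.rpow_natCast (L ^ (-(d : ℝ) / 2)), ← Real.rpow_mul hL.le, ← Real.rpow_natCast,
    ← Real.rpow_neg hL.le]
  congr 1
  push_cast
  ring

lemma continuous_planeWaveConj (d : ℕ) (L : ℝ) (k : Fin d → ℤ) :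
    Continuous (planeWaveConj d L k) := by
  unfold planeWaveConj
  fun_prop

lemma norm_planeWaveConj_sq (d : ℕ) {L : ℝ} (hL : 0 < L) (k : Fin d → ℤ)
    (x : EuclideanSpace ℝ (Fin d)) : ‖planeWaveConj d L k x‖ ^ 2 = (L ^ d)⁻¹ := by
  rw [planeWaveConj, norm_mul, Complex.norm_exp_ofReal_mul_I, mul_one, Complex.norm_real,
    Real.norm_eq_abs, sq_abs, rpow_neg_half_sq d hL]

lemma integral_boxMeasure_eq {d : ℕ} {L : ℝ} (hL : 0 < L) {F : Type*} [NormedAddCommGroup F]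
    [NormedSpace ℝ F] {f : EuclideanSpace ℝ (Fin d) → F}
    (hf : AEStronglyMeasurable f (boxMeasure d L)) :
    ∫ x, f x ∂(boxMeasure d L) = (L ^ d) • ∫ t, f (torusToBox d L t) := by
  have h := measurePreserving_torusToBox d hL
  rw [← integral_map h.measurable.aemeasurable (by
    rw [h.map_eq]; exact hf.smul_measure _), h.map_eq, integral_smul_measure, smul_smul,
    ENNReal.toReal_ofReal (by positivity), mul_inv_cancel₀ (by positivity), one_smul]

lemma integral_conj_mul_planeWaveConj {d : ℕ} {L : ℝ} (hL : 0 < L) (k l : Fin d → ℤ) :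
    ∫ x, starRingEnd ℂ (planeWaveConj d L k x) * planeWaveConj d L l x ∂(boxMeasure d L) =
      if k = l then 1 else 0 := by
  rw [integral_boxMeasure_eq (f := fun x => starRingEnd ℂ (planeWaveConj d L k x) *
    planeWaveConj d L l x) hL (((Complex.continuous_conj.comp
    (continuous_planeWaveConj d L k)).mul (continuous_planeWaveConj d L l)).aestronglyMeasurable)]
  simp only [planeWaveConj_torusToBox hL, map_mul, Complex.conj_ofReal]
  have h := orthonormal_iff_ite.mp (UnitAddTorus.orthonormal_mFourier (d := Fin d)) (-k) (-l)
  rw [ContinuousMap.inner_toLp] at h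
  have h' : ∀ t : UnitAddTorus (Fin d),
      ((L ^ (-(d : ℝ) / 2) : ℝ) : ℂ) * starRingEnd ℂ (UnitAddTorus.mFourier (-k) t) *
        (((L ^ (-(d : ℝ) / 2) : ℝ) : ℂ) * UnitAddTorus.mFourier (-l) t) =
      (((L ^ d)⁻¹ : ℝ) : ℂ) * (UnitAddTorus.mFourier (-l) t *
        starRingEnd ℂ (UnitAddTorus.mFourier (-k) t)) := by
    intro t
    rw [← rpow_neg_half_sq d hL]
    push_cast
    ring
  simp only [h', integral_const_mul]
  have h2 : ∫ t : UnitAddTorus (Fin d), UnitAddTorus.mFourier (-l) t *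
        starRingEnd ℂ (UnitAddTorus.mFourier (-k) t) = if k = l then 1 else 0 := by
    simpa using h
  rw [h2]
  have : (L : ℂ) ^ d ≠ 0 := by exact_mod_cast (pow_pos hL d).ne'
  split_ifs
  · rw [Complex.real_smul]
    push_cast
    field_simp
  · simp

/-- Completeness of the plane waves, inherited from the Fourier basis of the torus. -/
lemma ae_eq_zero_of_integral_planeWaveConj {d : ℕ} {L : ℝ} (hL : 0 < L)
    {f : EuclideanSpace ℝ (Fin d) → ℂ} (hf : MemLp f 2 (boxMeasure d L))
    (h0 : ∀ k, ∫ x, planeWaveConj d L k x * f x ∂(boxMeasure d L) = 0) :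
    f =ᵐ[boxMeasure d L] 0 := by
  have hψ := measurePreserving_torusToBox d hL
  have hf' : MemLp f 2 (ENNReal.ofReal ((L ^ d)⁻¹) • boxMeasure d L) :=
    hf.smul_measure ENNReal.ofReal_ne_top
  have hg : MemLp (f ∘ torusToBox d L) 2 (volume : Measure (UnitAddTorus (Fin d))) :=
    hf'.comp_measurePreserving hψ
  set g := hg.toLp _
  have hz : g = 0 := by
    have hrep : ∀ k, UnitAddTorus.mFourierBasis.repr g k = 0 := by
      intro k
      rw [UnitAddTorus.mFourierBasis_repr, UnitAddTorus.mFourierCoeff]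
      have h1 := h0 k
      rw [integral_boxMeasure_eq (f := fun x => planeWaveConj d L k x * f x) hL
        ((continuous_planeWaveConj d L k).aestronglyMeasurable.mul hf.1)] at h1
      simp only [planeWaveConj_torusToBox hL, mul_assoc, integral_const_mul] at h1
      rw [smul_eq_zero_iff_right (pow_pos hL d).ne', mul_eq_zero] at h1
      have hc : ((L ^ (-(d : ℝ) / 2) : ℝ) : ℂ) ≠ 0 := by
        exact_mod_cast (Real.rpow_pos_of_pos hL _).ne'
      rw [← h1.resolve_left hc]
      refine integral_congr_ae ?_
      filter_upwards [hg.coeFn_toLp] with t ht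
      rw [ht]
      rfl
    apply UnitAddTorus.mFourierBasis.repr.injective
    ext k
    simpa using hrep k
  have h2 : f ∘ torusToBox d L =ᵐ[volume] 0 := by
    have := hg.coeFn_toLp
    have h3 : (hg.toLp _ : UnitAddTorus (Fin d) → ℂ) =ᵐ[volume] 0 := by
      change (g : UnitAddTorus (Fin d) → ℂ) =ᵐ[volume] 0
      rw [hz]; exact Lp.coeFn_zero _ _ _
    exact this.symm.trans h3
  -- Pulling an almost-everywhere statement back from the torus requires a measurable zero set, so f
  -- is exchanged for a strongly measurable representative.
  have h4 : f =ᵐ[Measure.map (torusToBox d L) volume] 0 := by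
    obtain ⟨f', hf'm, hff'⟩ := hf'.1
    rw [← hψ.map_eq] at hff'
    refine hff'.trans ?_
    have h5 : f' ∘ torusToBox d L =ᵐ[volume] 0 :=
      (ae_eq_comp hψ.measurable.aemeasurable hff').symm.trans h2
    have hms : MeasurableSet {x | f' x = (0 : EuclideanSpace ℝ (Fin d) → ℂ) x} := by
      simp only [Pi.zero_apply]
      exact hf'm.measurable (measurableSet_singleton 0)
    exact (ae_map_iff hψ.measurable.aemeasurable hms).mpr h5
  rw [hψ.map_eq] at h4
  have hne : ENNReal.ofReal ((L ^ d)⁻¹) ≠ 0 := by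
    simpa using pow_pos hL d
  exact (Measure.ae_ennreal_smul_measure_eq hne (boxMeasure d L)).symm ▸ h4

end Torus

/-! ### The Hilbert basis of plane waves with spin -/

section Basis

variable {d q : ℕ} {L : ℝ}

lemma memLp_planeWave (d : ℕ) (L : ℝ) (k : Fin d → ℤ) {F : Type*} [NormedAddCommGroup F]
    [NormedSpace ℂ F] (z : F) :
    MemLp (fun x => starRingEnd ℂ (planeWaveConj d L k x) • z) 2 (boxMeasure d L) := by
  refine MemLp.of_bound (Continuous.aestronglyMeasurable ?_)
    (|L ^ (-(d : ℝ) / 2)| * ‖z‖) (Filter.Eventually.of_forall fun x => ?_)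
  · exact (Complex.continuous_conj.comp (continuous_planeWaveConj d L k)).smul continuous_const
  · rw [norm_smul, RCLike.norm_conj, planeWaveConj, norm_mul, Complex.norm_exp_ofReal_mul_I,
      mul_one, Complex.norm_real, Real.norm_eq_abs]

/-- The plane wave `e_k` with spin `s`, as an element of `L²(C_L, ℂ^q)`. -/
def planeWave (d q : ℕ) (L : ℝ) (i : (Fin d → ℤ) × Fin q) : BoxL2 d q L :=
  (memLp_planeWave d L i.1 (EuclideanSpace.single i.2 (1 : ℂ))).toLp _

lemma inner_planeWave (i : (Fin d → ℤ) × Fin q) (u : BoxL2 d q L) :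
    inner ℂ (planeWave d q L i) u = fourierCoeff u i.1 i.2 := by
  rw [L2.inner_def]
  have h := (EuclideanSpace.proj i.2 : EuclideanSpace ℂ (Fin q) →L[ℂ] ℂ).integral_comp_comm
    (integrable_planeWave u i.1)
  change _ = (EuclideanSpace.proj i.2 : EuclideanSpace ℂ (Fin q) →L[ℂ] ℂ) _
  unfold fourierCoeff
  rw [← h]
  refine integral_congr_ae ?_
  filter_upwards [(memLp_planeWave d L i.1 (EuclideanSpace.single i.2 (1 : ℂ))).coeFn_toLp] with x hx
  rw [planeWave, hx]
  simp [inner_smul_left, EuclideanSpace.inner_single_left]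

lemma fourierCoeff_planeWave (hL : 0 < L) (i : (Fin d → ℤ) × Fin q) (k : Fin d → ℤ) :
    fourierCoeff (planeWave d q L i) k =
      if i.1 = k then EuclideanSpace.single i.2 (1 : ℂ) else 0 := by
  unfold fourierCoeff
  have h : ∫ x, planeWaveConj d L k x • (planeWave d q L i) x ∂(boxMeasure d L) =
      ∫ x, (starRingEnd ℂ (planeWaveConj d L i.1 x) * planeWaveConj d L k x) •
        (EuclideanSpace.single i.2 (1 : ℂ)) ∂(boxMeasure d L) := by
    refine integral_congr_ae ?_
    filter_upwards [(memLp_planeWave d L i.1 (EuclideanSpace.single i.2 (1 : ℂ))).coeFn_toLp]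
      with x hx
    rw [planeWave, hx, smul_smul, mul_comm]
  rw [h, integral_smul_const, integral_conj_mul_planeWaveConj hL]
  split_ifs <;> simp

lemma orthonormal_planeWave (hL : 0 < L) : Orthonormal ℂ (planeWave d q L) := by
  classical
  rw [orthonormal_iff_ite]
  rintro ⟨k, s⟩ ⟨l, r⟩
  rw [inner_planeWave, fourierCoeff_planeWave hL]
  by_cases h1 : l = k <;> by_cases h2 : s = r
  · simp [h1, h2]
  · simp [h1, h2]
  · simp [h1, h2, Ne.symm h1]
  · simp [h1, h2, Ne.symm h1]

lemma eq_zero_of_fourierCoeff_eq_zero (hL : 0 < L) {u : BoxL2 d q L}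
    (h : ∀ k, fourierCoeff u k = 0) : u = 0 := by
  have hs : ∀ s : Fin q, (fun x => u x s) =ᵐ[boxMeasure d L] 0 := by
    intro s
    refine ae_eq_zero_of_integral_planeWaveConj hL ?_ fun k => ?_
    · exact (EuclideanSpace.proj s : EuclideanSpace ℂ (Fin q) →L[ℂ] ℂ).comp_memLp' (Lp.memLp u)
    · have h1 := (EuclideanSpace.proj s : EuclideanSpace ℂ (Fin q) →L[ℂ] ℂ).integral_comp_comm
        (integrable_planeWave u k)
      change _ = (EuclideanSpace.proj s : EuclideanSpace ℂ (Fin q) →L[ℂ] ℂ) (fourierCoeff u k) at h1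
      rw [h k, map_zero] at h1
      simpa using h1
  rw [Lp.eq_zero_iff_ae_eq_zero]
  filter_upwards [ae_all_iff.mpr hs] with x hx
  ext s
  simpa using hx s

/-- The Hilbert basis of plane waves. -/
def planeWaveBasis (d q : ℕ) (hL : 0 < L) : HilbertBasis ((Fin d → ℤ) × Fin q) ℂ (BoxL2 d q L) :=
  HilbertBasis.mkOfOrthogonalEqBot (orthonormal_planeWave hL) (by
    rw [Submodule.eq_bot_iff]
    intro u hu
    refine eq_zero_of_fourierCoeff_eq_zero hL fun k => ?_
    ext s
    have := (Submodule.mem_orthogonal _ _).mp hu (planeWave d q L (k, s))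
      (Submodule.subset_span ⟨_, rfl⟩)
    rwa [inner_planeWave] at this)

@[simp] lemma coe_planeWaveBasis (hL : 0 < L) : ⇑(planeWaveBasis d q hL) = planeWave d q L :=
  HilbertBasis.coe_mkOfOrthogonalEqBot _ _

end Basis

/-! ### Counting lattice points in balls and shells -/

section Lattice

variable {d : ℕ}

/-- The point of `ℝ^d` with integer coordinates `k`. -/
def latticePoint (k : Fin d → ℤ) : EuclideanSpace ℝ (Fin d) :=
  WithLp.toLp 2 fun i => (k i : ℝ)

lemma latticePoint_add (k l : Fin d → ℤ) :
    latticePoint (k + l) = latticePoint k + latticePoint l := by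
  ext i; simp [latticePoint]

lemma norm_latticePoint_sq (k : Fin d → ℤ) : ‖latticePoint k‖ ^ 2 = ∑ i, (k i : ℝ) ^ 2 := by
  simp [EuclideanSpace.norm_sq_eq, latticePoint]

lemma finite_norm_latticePoint_le (r : ℝ) : {k : Fin d → ℤ | ‖latticePoint k‖ ≤ r}.Finite := by
  refine (Set.finite_Icc (fun _ : Fin d => -⌈r⌉) (fun _ => ⌈r⌉)).subset fun k hk => ?_
  have h : ∀ i, |(k i : ℝ)| ≤ r := fun i => by
    have := PiLp.norm_apply_le (latticePoint k) i
    rw [Real.norm_eq_abs] at this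
    exact this.trans hk
  have h' : ∀ i, |k i| ≤ ⌈r⌉ := fun i => by
    have := (h i).trans (Int.le_ceil r)
    exact_mod_cast this
  exact ⟨fun i => (abs_le.mp (h' i)).1, fun i => (abs_le.mp (h' i)).2⟩

/-- The half-open unit cube with lowest corner `k`. -/
def unitCube (k : Fin d → ℤ) : Set (EuclideanSpace ℝ (Fin d)) :=
  WithLp.ofLp ⁻¹' (Set.pi Set.univ fun i => Set.Ico (k i : ℝ) (k i + 1))

lemma measurableSet_unitCube (k : Fin d → ℤ) : MeasurableSet (unitCube k) :=
  (MeasurableSet.univ_pi fun _ => measurableSet_Ico).preimage (by fun_prop)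

lemma volume_unitCube (k : Fin d → ℤ) : volume (unitCube k) = 1 := by
  rw [unitCube, (PiLp.volume_preserving_ofLp (Fin d)).measure_preimage
    (MeasurableSet.univ_pi fun _ => measurableSet_Ico).nullMeasurableSet, Real.volume_pi_Ico]
  simp

lemma unitCube_floor {k : Fin d → ℤ} {y : EuclideanSpace ℝ (Fin d)} :
    y ∈ unitCube k ↔ k = fun i => ⌊y i⌋ := by
  simp only [unitCube, Set.mem_preimage, Set.mem_univ_pi, Set.mem_Ico, funext_iff]
  exact forall_congr' fun i => by rw [eq_comm, Int.floor_eq_iff]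

lemma disjoint_unitCube {k l : Fin d → ℤ} (h : k ≠ l) : Disjoint (unitCube k) (unitCube l) :=
  Set.disjoint_left.mpr fun _ hy hy' => h ((unitCube_floor.mp hy).trans (unitCube_floor.mp hy').symm)

lemma norm_sub_latticePoint_le {k : Fin d → ℤ} {y : EuclideanSpace ℝ (Fin d)}
    (hy : y ∈ unitCube k) : ‖y - latticePoint k‖ ≤ √d := by
  rw [EuclideanSpace.norm_eq]
  apply Real.sqrt_le_sqrt
  have : ∀ i ∈ (Finset.univ : Finset (Fin d)), ‖(y - latticePoint k) i‖ ^ 2 ≤ 1 := by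
    intro i _
    simp only [unitCube, Set.mem_preimage, Set.mem_univ_pi, Set.mem_Ico] at hy
    have := hy i
    rw [Real.norm_eq_abs, sq_abs]
    simp only [latticePoint, PiLp.sub_apply]
    nlinarith
  simpa using Finset.sum_le_card_nsmul _ _ _ this

/-- The cubes are disjoint and have volume one, so a lattice sum is the integral of a step function,
to be compared with g cube by cube. The shell counts and the Lindhard sum both rest on this. -/
lemma sum_le_lintegral_of_unitCube (A : Finset (Fin d → ℤ)) {h : (Fin d → ℤ) → ℝ≥0∞}
    {g : EuclideanSpace ℝ (Fin d) → ℝ≥0∞} {Ω : Set (EuclideanSpace ℝ (Fin d))}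
    (hA : ∀ k ∈ A, ∀ y ∈ unitCube k, y ∈ Ω ∧ h k ≤ g y) : ∑ k ∈ A, h k ≤ ∫⁻ y in Ω, g y := by
  calc ∑ k ∈ A, h k = ∑ k ∈ A, ∫⁻ _ in unitCube k, h k := by simp [volume_unitCube]
    _ ≤ ∑ k ∈ A, ∫⁻ y in unitCube k, g y :=
        Finset.sum_le_sum fun k hk => setLIntegral_mono' (measurableSet_unitCube k)
          fun y hy => (hA k hk y hy).2
    _ = ∫⁻ y in ⋃ k ∈ A, unitCube k, g y :=
        (lintegral_biUnion_finset (fun k _ l _ hkl => disjoint_unitCube hkl)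
          (fun k _ => measurableSet_unitCube k) g).symm
    _ ≤ ∫⁻ y in Ω, g y := by
        refine lintegral_mono_set fun y hy => ?_
        simp only [Set.mem_iUnion] at hy
        obtain ⟨k, hk, hy⟩ := hy
        exact (hA k hk y hy).1

/-- The volume of the unit ball in `ℝ^d`. -/
def ballVolume (d : ℕ) : ℝ := (volume (Metric.ball (0 : EuclideanSpace ℝ (Fin d)) 1)).toReal

lemma ballVolume_nonneg (d : ℕ) : 0 ≤ ballVolume d := ENNReal.toReal_nonneg

lemma volume_closedBall_eq (d : ℕ) {r : ℝ} (hr : 0 ≤ r) :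
    volume (Metric.closedBall (0 : EuclideanSpace ℝ (Fin d)) r) =
      ENNReal.ofReal (ballVolume d * r ^ d) := by
  rw [Measure.addHaar_closedBall _ _ hr, finrank_euclideanSpace_fin, mul_comm,
    ENNReal.ofReal_mul (ballVolume_nonneg d), ballVolume, ENNReal.ofReal_toReal measure_ball_lt_top.ne]

lemma volume_ball_eq {d : ℕ} (hd : d ≠ 0) {r : ℝ} (hr : 0 ≤ r) :
    volume (Metric.ball (0 : EuclideanSpace ℝ (Fin d)) r) =
      ENNReal.ofReal (ballVolume d * r ^ d) := by
  have : Nonempty (Fin d) := ⟨⟨0, Nat.pos_of_ne_zero hd⟩⟩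
  rw [Measure.addHaar_ball _ _ hr, finrank_euclideanSpace_fin, mul_comm,
    ENNReal.ofReal_mul (ballVolume_nonneg d), ballVolume, ENNReal.ofReal_toReal measure_ball_lt_top.ne]

lemma pow_sub_pow_le {x y : ℝ} (hy : 0 ≤ y) (hxy : y ≤ x) (n : ℕ) :
    x ^ (n + 1) - y ^ (n + 1) ≤ (n + 1) * (x - y) * x ^ n := by
  induction n with
  | zero => simp
  | succ n ih =>
    have hx : 0 ≤ x := hy.trans hxy
    have h1 : x ^ (n + 1 + 1) - y ^ (n + 1 + 1) =
        x * (x ^ (n + 1) - y ^ (n + 1)) + (x - y) * y ^ (n + 1) := by ring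
    have h2 : y ^ (n + 1) ≤ x ^ (n + 1) := pow_le_pow_left₀ hy hxy _
    have h3 := mul_le_mul_of_nonneg_left ih hx
    have h4 := mul_le_mul_of_nonneg_left h2 (sub_nonneg.mpr hxy)
    rw [h1]
    push_cast
    calc _ ≤ x * ((n + 1) * (x - y) * x ^ n) + (x - y) * x ^ (n + 1) := add_le_add h3 h4
      _ = _ := by ring

/-- The cubes attached to the points of A lie in the shell thickened by the cube diameter √d on both
sides, and the volume of that shell is width times outer surface. The inner radius r₁ may be
negative. -/
lemma card_shell_le {m : ℕ} {A : Finset (Fin (m + 1) → ℤ)} {r₁ r₂ : ℝ} (hr₂ : 0 ≤ r₂)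
    (hr : r₁ ≤ r₂) (hA : ∀ k ∈ A, r₁ ≤ ‖latticePoint k‖ ∧ ‖latticePoint k‖ ≤ r₂) :
    (A.card : ℝ) ≤ ballVolume (m + 1) * ((m + 1) * (r₂ - r₁ + 2 * √(m + 1 : ℕ)) *
      (r₂ + √(m + 1 : ℕ)) ^ m) := by
  set D := √((m + 1 : ℕ) : ℝ)
  have hD : 0 ≤ D := Real.sqrt_nonneg _
  set lo := max (r₁ - D) 0
  set hi := r₂ + D
  have hlo : 0 ≤ lo := le_max_right _ _
  have hlohi : lo ≤ hi := max_le (by simp only [hi]; linarith) (by positivity)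
  have key := sum_le_lintegral_of_unitCube (h := fun _ => 1) (g := fun _ => 1) A
    (Ω := Metric.closedBall 0 hi \ Metric.ball 0 lo) (fun k hk y hy => ⟨⟨?_, ?_⟩, le_rfl⟩)
  rotate_left
  · rw [mem_closedBall_zero_iff]
    have h1 := norm_sub_norm_le y (latticePoint k)
    have h2 := norm_sub_latticePoint_le hy
    have h3 := (hA k hk).2
    simp only [hi]; linarith
  · rw [mem_ball_zero_iff, not_lt]
    have h1 := norm_sub_norm_le (latticePoint k) y
    rw [norm_sub_rev] at h1
    have h2 := norm_sub_latticePoint_le hy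
    have h3 := (hA k hk).1
    exact max_le (by linarith) (norm_nonneg _)
  simp only [Finset.sum_const, nsmul_eq_mul, mul_one, lintegral_const, MeasurableSet.univ,
    Measure.restrict_apply, Set.univ_inter, one_mul] at key
  rw [measure_sdiff (Metric.ball_subset_closedBall.trans (Metric.closedBall_subset_closedBall hlohi))
    measurableSet_ball.nullMeasurableSet measure_ball_lt_top.ne, volume_closedBall_eq _
    (hlo.trans hlohi), volume_ball_eq (by simp) hlo, ← ENNReal.ofReal_sub _ (by
      have := ballVolume_nonneg (m + 1); positivity)] at key
  have h0 : 0 ≤ hi - lo := sub_nonneg.mpr hlohi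
  have h4 := pow_sub_pow_le hlo hlohi m
  have h5 : hi - lo ≤ r₂ - r₁ + 2 * D := by
    have := le_max_left (r₁ - D) 0
    simp only [hi, lo]; linarith
  have h6 : (A.card : ℝ) ≤ ballVolume (m + 1) * hi ^ (m + 1) - ballVolume (m + 1) * lo ^ (m + 1) := by
    have h7 : 0 ≤ ballVolume (m + 1) * hi ^ (m + 1) - ballVolume (m + 1) * lo ^ (m + 1) := by
      rw [← mul_sub]
      exact mul_nonneg (ballVolume_nonneg _) (sub_nonneg.mpr (pow_le_pow_left₀ hlo hlohi _))
    rw [← ENNReal.ofReal_natCast] at key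
    exact (ENNReal.ofReal_le_ofReal_iff h7).mp key
  rw [← mul_sub] at h6
  refine h6.trans (mul_le_mul_of_nonneg_left (h4.trans ?_) (ballVolume_nonneg _))
  have : 0 ≤ hi := hlo.trans hlohi
  gcongr

lemma le_card_ball {m : ℕ} {A : Finset (Fin (m + 1) → ℤ)} {r : ℝ} (hr : 0 ≤ r)
    (hA : ∀ k, ‖latticePoint k‖ ≤ r + √(m + 1 : ℕ) → k ∈ A) :
    ballVolume (m + 1) * r ^ (m + 1) ≤ A.card := by
  have hsub : Metric.closedBall (0 : EuclideanSpace ℝ (Fin (m + 1))) r ⊆ ⋃ k ∈ A, unitCube k := by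
    intro y hy
    rw [mem_closedBall_zero_iff] at hy
    have hy' : y ∈ unitCube (fun i => ⌊y i⌋) := unitCube_floor.mpr rfl
    simp only [Set.mem_iUnion]
    refine ⟨_, hA _ ?_, hy'⟩
    have h1 := norm_sub_norm_le (latticePoint fun i => ⌊y i⌋) y
    rw [norm_sub_rev] at h1
    have h2 := norm_sub_latticePoint_le hy'
    linarith
  have h := (measure_mono hsub).trans (measure_biUnion_finset_le (μ := volume) A unitCube)
  rw [volume_closedBall_eq _ hr] at h
  simp only [volume_unitCube, Finset.sum_const, nsmul_eq_mul, mul_one] at h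
  rw [← ENNReal.ofReal_natCast] at h
  exact (ENNReal.ofReal_le_ofReal_iff (Nat.cast_nonneg _)).mp h

/-- Gauss's argument: the union of the cubes at lattice points of a ball is trapped between the
balls of radius r ± √d. -/
lemma abs_card_ball_sub_le {m : ℕ} {A : Finset (Fin (m + 1) → ℤ)} {r : ℝ} (hr : 0 ≤ r)
    (hA : ∀ k, k ∈ A ↔ ‖latticePoint k‖ ≤ r) :
    |(A.card : ℝ) - ballVolume (m + 1) * r ^ (m + 1)| ≤
      ballVolume (m + 1) * ((m + 1) * √(m + 1 : ℕ) * (r + √(m + 1 : ℕ)) ^ m) := by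
  set D := √((m + 1 : ℕ) : ℝ)
  have hD : 0 ≤ D := Real.sqrt_nonneg _
  have hω := ballVolume_nonneg (m + 1)
  rw [abs_le]
  constructor
  · set lo := max (r - D) 0
    have hlo : 0 ≤ lo := le_max_right _ _
    have hlor : lo ≤ r := max_le (by linarith) hr
    have h4 := mul_le_mul_of_nonneg_left (pow_sub_pow_le hlo hlor m) hω
    have h5 : (m + 1) * (r - lo) * r ^ m ≤ (m + 1) * D * (r + D) ^ m := by
      have : r - lo ≤ D := by
        have := le_max_left (r - D) 0
        simp only [lo]; linarith
      have h0 : 0 ≤ r - lo := sub_nonneg.mpr hlor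
      gcongr
      linarith
    have h6 := mul_le_mul_of_nonneg_left h5 hω
    have h7 : ballVolume (m + 1) * lo ^ (m + 1) ≤ A.card := by
      rcases le_total (r - D) 0 with h | h
      · have : lo = 0 := max_eq_right h
        rw [this]
        simp
      · have hlo' : lo = r - D := max_eq_left h
        exact le_card_ball hlo fun k hk => (hA k).mpr (by rw [hlo'] at hk; linarith)
    linarith
  · have key := sum_le_lintegral_of_unitCube (h := fun _ => 1) (g := fun _ => 1) A
      (Ω := Metric.closedBall 0 (r + D)) (fun k hk y hy => ⟨?_, le_rfl⟩)
    · simp only [Finset.sum_const, nsmul_eq_mul, mul_one, lintegral_const, MeasurableSet.univ,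
        Measure.restrict_apply, Set.univ_inter, one_mul] at key
      rw [volume_closedBall_eq _ (by positivity), ← ENNReal.ofReal_natCast] at key
      have h1 := (ENNReal.ofReal_le_ofReal_iff (by positivity)).mp key
      have h4 := mul_le_mul_of_nonneg_left (pow_sub_pow_le hr (le_add_of_nonneg_right hD) m) hω
      rw [add_sub_cancel_left] at h4
      linarith
    · rw [mem_closedBall_zero_iff]
      have h1 := norm_sub_norm_le y (latticePoint k)
      have h2 := norm_sub_latticePoint_le hy
      have h3 := (hA k).mp hk
      linarith

/-- The shell R < |k| ≤ √(R² + ε) has width Δ with Δ(Δ + 2R) = ε, hence both ΔR ≤ ε and Δ² ≤ ε;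
these produce the two terms. Keeping a distance 2√d from the sphere removes any boundary
contribution that would survive as ε → 0. -/
lemma card_outer_le (m : ℕ) : ∃ C : ℝ, 0 < C ∧ ∀ (R ε : ℝ) (A : Finset (Fin (m + 2) → ℤ)),
    0 ≤ R → 0 ≤ ε → (∀ k ∈ A, R + 2 * √(m + 2 : ℕ) ≤ ‖latticePoint k‖ ∧
      ‖latticePoint k‖ ^ 2 - R ^ 2 ≤ ε) → (A.card : ℝ) ≤ C * (ε * R ^ m + √ε ^ (m + 2)) := by
  set D := √((m + 2 : ℕ) : ℝ)
  have hD : 0 ≤ D := Real.sqrt_nonneg _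
  have hω := ballVolume_nonneg (m + 2)
  -- The powers of 2 come from expanding (R + 2Δ)^(m+1). Adding 1 makes the constant positive
  -- without knowing that the ball volume is.
  refine ⟨(ballVolume (m + 2) + 1) * ((m + 2) * (2 * (2 ^ m * 2 ^ (m + 1)))), by positivity, ?_⟩
  intro R ε A hR hε hA
  rcases A.eq_empty_or_nonempty with rfl | ⟨k, hk⟩
  · simp only [Finset.card_empty, Nat.cast_zero]; positivity
  set ρ := √(R ^ 2 + ε)
  have hρ2 : ρ ^ 2 = R ^ 2 + ε := Real.sq_sqrt (by positivity)
  have hρ0 : 0 ≤ ρ := Real.sqrt_nonneg _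
  have hle : ∀ k ∈ A, ‖latticePoint k‖ ≤ ρ := fun k hk =>
    Real.le_sqrt_of_sq_le (by have := (hA k hk).2; linarith)
  have hDρ : R + 2 * D ≤ ρ := (hA k hk).1.trans (hle k hk)
  set Δ := ρ - R with hΔ
  have hΔD : 2 * D ≤ Δ := by linarith
  have hΔ0 : 0 ≤ Δ := by linarith
  have h1 := card_shell_le (A := A) (r₁ := R + 2 * D) (r₂ := ρ) hρ0 hDρ
    fun k hk => ⟨(hA k hk).1, hle k hk⟩
  change _ ≤ ballVolume (m + 2) * ((((m + 1 : ℕ) : ℝ) + 1) * (ρ - (R + 2 * D) + 2 * D) *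
      (ρ + D) ^ (m + 1)) at h1
  -- The margin 2D exactly compensates the thickening in `card_shell_le`.
  have e1 : ρ - (R + 2 * D) + 2 * D = Δ := by rw [hΔ]; ring
  rw [e1] at h1
  have hpow : (ρ + D) ^ (m + 1) ≤ 2 ^ m * (R ^ (m + 1) + (2 * Δ) ^ (m + 1)) := by
    have : ρ + D ≤ R + 2 * Δ := by linarith
    calc (ρ + D) ^ (m + 1) ≤ (R + 2 * Δ) ^ (m + 1) := by gcongr
      _ ≤ _ := by simpa using add_pow_le hR (by positivity : 0 ≤ 2 * Δ) (m + 1)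
  have hΔR : Δ * R ≤ ε := by nlinarith
  have hΔΔ : Δ ≤ √ε := Real.le_sqrt_of_sq_le (by nlinarith)
  have hR1 : Δ * R ^ (m + 1) ≤ ε * R ^ m := by
    rw [pow_succ']
    calc Δ * (R * R ^ m) = (Δ * R) * R ^ m := by ring
      _ ≤ _ := by gcongr
  have hR2 : Δ * (2 * Δ) ^ (m + 1) ≤ 2 ^ (m + 1) * √ε ^ (m + 2) := by
    calc Δ * (2 * Δ) ^ (m + 1) = 2 ^ (m + 1) * Δ ^ (m + 2) := by rw [mul_pow]; ring
      _ ≤ _ := by gcongr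
  have h2m : (1 : ℝ) ≤ 2 ^ (m + 1) := one_le_pow₀ (by norm_num)
  calc (A.card : ℝ) ≤ ballVolume (m + 2) * ((((m + 1 : ℕ) : ℝ) + 1) * Δ *
        (2 ^ m * (R ^ (m + 1) + (2 * Δ) ^ (m + 1)))) := h1.trans (by gcongr)
    _ = ballVolume (m + 2) * ((m + 2) * (2 ^ m *
        (Δ * R ^ (m + 1) + Δ * (2 * Δ) ^ (m + 1)))) := by push_cast; ring
    _ ≤ (ballVolume (m + 2) + 1) * ((m + 2) * (2 ^ m *
        (2 ^ (m + 1) * (ε * R ^ m) + 2 ^ (m + 1) * √ε ^ (m + 2)))) := by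
        have : ε * R ^ m ≤ 2 ^ (m + 1) * (ε * R ^ m) :=
          le_mul_of_one_le_left (by positivity) h2m
        have h3 := add_le_add (hR1.trans this) hR2
        gcongr
        linarith
    _ ≤ _ := by
        have : 0 ≤ (ballVolume (m + 2) + 1) * ((m + 2) * (2 ^ m *
        (2 ^ (m + 1) * (ε * R ^ m) + 2 ^ (m + 1) * √ε ^ (m + 2)))) := by positivity
        linarith

/-- From (R - |k|)R ≤ R² - |k|² ≤ ε the shell has width at most ε/R. All points lie in the ball, so
no ε^{d/2} term appears. -/
lemma card_inner_le (m : ℕ) : ∃ C : ℝ, 0 < C ∧ ∀ (R ε : ℝ) (A : Finset (Fin (m + 2) → ℤ)),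
    0 ≤ R → 0 ≤ ε → (∀ k ∈ A, ‖latticePoint k‖ ≤ R - 2 * √(m + 2 : ℕ) ∧
      R ^ 2 - ‖latticePoint k‖ ^ 2 ≤ ε) → (A.card : ℝ) ≤ C * (ε * R ^ m) := by
  set D := √((m + 2 : ℕ) : ℝ)
  have hD : 0 < D := Real.sqrt_pos.mpr (by positivity)
  have hω := ballVolume_nonneg (m + 2)
  refine ⟨(ballVolume (m + 2) + 1) * (m + 2), by positivity, ?_⟩
  intro R ε A hR hε hA
  rcases A.eq_empty_or_nonempty with rfl | ⟨k₀, hk₀⟩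
  · simp only [Finset.card_empty, Nat.cast_zero]; positivity
  have hRpos : 0 < R := by
    have := (hA k₀ hk₀).1
    have := norm_nonneg (latticePoint k₀)
    linarith
  have hlo : ∀ k ∈ A, R - ε / R ≤ ‖latticePoint k‖ := fun k hk => by
    have h2 := (hA k hk).2
    have h1 := (hA k hk).1
    have h0 := norm_nonneg (latticePoint k)
    have : (R - ‖latticePoint k‖) * R ≤ ε := by nlinarith
    have := (le_div_iff₀ hRpos).mpr this
    linarith
  -- The radius R - ε/R is negative for large ε, which is harmless here.
  have h1 := card_shell_le (A := A) (r₁ := R - ε / R) (r₂ := R - 2 * D)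
    ((norm_nonneg _).trans (hA k₀ hk₀).1) ((hlo k₀ hk₀).trans (hA k₀ hk₀).1)
    fun k hk => ⟨hlo k hk, (hA k hk).1⟩
  change _ ≤ ballVolume (m + 2) * ((((m + 1 : ℕ) : ℝ) + 1) *
      (R - 2 * D - (R - ε / R) + 2 * D) * (R - 2 * D + D) ^ (m + 1)) at h1
  have e1 : R - 2 * D - (R - ε / R) + 2 * D = ε / R := by ring
  rw [e1] at h1
  have hk0 := (norm_nonneg _).trans (hA k₀ hk₀).1
  calc (A.card : ℝ) ≤ _ := h1
    _ ≤ (ballVolume (m + 2) + 1) * ((((m + 1 : ℕ) : ℝ) + 1) * (ε / R) * R ^ (m + 1)) := by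
        gcongr
        · linarith
        · linarith
    _ = _ := by push_cast; field_simp; ring1

lemma card_ball_le (m : ℕ) : ∃ C : ℝ, 0 < C ∧ ∀ (r : ℝ) (A : Finset (Fin (m + 2) → ℤ)),
    0 ≤ r → (∀ k ∈ A, ‖latticePoint k‖ ≤ r) → (A.card : ℝ) ≤ C * (1 + r) ^ (m + 2) := by
  set D := √((m + 2 : ℕ) : ℝ)
  have hD : 0 ≤ D := Real.sqrt_nonneg _
  have hω := ballVolume_nonneg (m + 2)
  refine ⟨(ballVolume (m + 2) + 1) * ((m + 2) * (1 + 2 * D) ^ (m + 2)), by positivity, ?_⟩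
  intro r A hr hA
  have h1 := card_shell_le (A := A) (r₁ := 0) (r₂ := r) hr hr fun k hk => ⟨norm_nonneg _, hA k hk⟩
  change _ ≤ ballVolume (m + 2) * ((((m + 1 : ℕ) : ℝ) + 1) * (r - 0 + 2 * D) *
    (r + D) ^ (m + 1)) at h1
  calc (A.card : ℝ) ≤ _ := h1
    _ ≤ (ballVolume (m + 2) + 1) * ((((m + 1 : ℕ) : ℝ) + 1) * ((1 + 2 * D) * (1 + r)) *
        ((1 + 2 * D) * (1 + r)) ^ (m + 1)) := by
        gcongr
        · linarith
        · nlinarith [mul_nonneg hD hr]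
        · nlinarith [mul_nonneg hD hr]
    _ = _ := by rw [mul_pow]; push_cast; ring

/-- Modes this close to the Fermi sphere have too little excitation energy to be controlled by it,
so only their number, of the order of a surface, is used. -/
lemma card_thin_shell_le (m : ℕ) : ∃ C : ℝ, 0 < C ∧ ∀ (R : ℝ) (A : Finset (Fin (m + 2) → ℤ)),
    0 ≤ R → (∀ k ∈ A, R - 2 * √(m + 2 : ℕ) ≤ ‖latticePoint k‖ ∧
      ‖latticePoint k‖ ≤ R + 2 * √(m + 2 : ℕ)) → (A.card : ℝ) ≤ C * (1 + R) ^ (m + 1) := by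
  set D := √((m + 2 : ℕ) : ℝ)
  have hD : 0 ≤ D := Real.sqrt_nonneg _
  have hω := ballVolume_nonneg (m + 2)
  refine ⟨(ballVolume (m + 2) + 1) * ((m + 2) * (1 + 6 * D) * (1 + 3 * D) ^ (m + 1)),
    by positivity, ?_⟩
  intro R A hR hA
  have h1 := card_shell_le (A := A) (r₁ := R - 2 * D) (r₂ := R + 2 * D) (by positivity)
    (by linarith) hA
  change _ ≤ ballVolume (m + 2) * ((((m + 1 : ℕ) : ℝ) + 1) *
    (R + 2 * D - (R - 2 * D) + 2 * D) * (R + 2 * D + D) ^ (m + 1)) at h1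
  have e1 : R + 2 * D - (R - 2 * D) + 2 * D = 6 * D := by ring
  rw [e1] at h1
  calc (A.card : ℝ) ≤ _ := h1
    _ ≤ (ballVolume (m + 2) + 1) * ((((m + 1 : ℕ) : ℝ) + 1) * (1 + 6 * D) *
        ((1 + 3 * D) * (1 + R)) ^ (m + 1)) := by
        gcongr
        · linarith
        · linarith
        · nlinarith [mul_nonneg hD hR]
    _ = _ := by rw [mul_pow]; push_cast; ring

end Lattice

/-! ### The Lindhard integral and its lattice version -/

section Lindhard

/-- Coordinates adapted to ξ: |y + ξ|² - |y|² then depends only on the component of y along ξ. -/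
lemma exists_measurePreserving_axis (m : ℕ) {ξ : EuclideanSpace ℝ (Fin (m + 1))} (hξ : ξ ≠ 0) :
    ∃ Ψ : ℝ × EuclideanSpace ℝ (Fin m) → EuclideanSpace ℝ (Fin (m + 1)),
      MeasurePreserving Ψ (volume.prod volume) volume ∧
      (∀ p, ‖Ψ p‖ ^ 2 = p.1 ^ 2 + ‖p.2‖ ^ 2) ∧ ∀ p, inner ℝ (Ψ p) ξ = p.1 * ‖ξ‖ := by
  have hn : ‖ξ‖ ≠ 0 := norm_ne_zero_iff.mpr hξ
  obtain ⟨b, hb⟩ := Orthonormal.exists_orthonormalBasis_extension_of_card_eq (𝕜 := ℝ)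
    (ι := Fin (m + 1)) (E := EuclideanSpace ℝ (Fin (m + 1))) (by simp)
    (v := fun _ => ‖ξ‖⁻¹ • ξ) (s := {0}) (by
      rw [orthonormal_iff_ite]
      rintro ⟨i, rfl⟩ ⟨j, rfl⟩
      simp [norm_smul, hn])
  have hb0 : b 0 = ‖ξ‖⁻¹ • ξ := hb 0 rfl
  refine ⟨fun p => b.repr.symm (WithLp.toLp 2
    ((MeasurableEquiv.piFinSuccAbove (fun _ => ℝ) 0).symm (p.1, WithLp.ofLp p.2))), ?_, ?_, ?_⟩
  · refine b.repr.symm.measurePreserving.comp ((PiLp.volume_preserving_toLp (Fin (m + 1))).comp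
      (((volume_preserving_piFinSuccAbove (fun _ : Fin (m + 1) => ℝ) 0).symm).comp ?_))
    exact (MeasurePreserving.id volume).prod (PiLp.volume_preserving_ofLp (Fin m))
  · intro p
    rw [LinearIsometryEquiv.norm_map, EuclideanSpace.norm_sq_eq, Fin.sum_univ_succ,
      EuclideanSpace.norm_sq_eq]
    simp [MeasurableEquiv.piFinSuccAbove]
  · intro p
    have h1 : ξ = ‖ξ‖ • b 0 := by rw [hb0, smul_smul, mul_inv_cancel₀ hn, one_smul]
    set w := (WithLp.toLp 2
      ((MeasurableEquiv.piFinSuccAbove (fun _ => ℝ) 0).symm (p.1, WithLp.ofLp p.2)) :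
        EuclideanSpace ℝ (Fin (m + 1))) with hw
    have h2 : inner ℝ (b.repr.symm w) (b 0) = w 0 := by
      rw [real_inner_comm, ← b.repr_apply_apply, LinearIsometryEquiv.apply_symm_apply]
    conv_lhs => rw [h1]
    rw [inner_smul_right, h2, mul_comm, hw]
    simp [MeasurableEquiv.piFinSuccAbove]

/-- The estimate is linear in a - b at fixed a, which is what cancels the Lindhard denominator
below. For negative b the annulus is a ball, consistently with √b = 0. -/
lemma volume_annulus_le (n : ℕ) {a b : ℝ} (ha : 0 < a) (hab : b ≤ a) :
    volume {z : EuclideanSpace ℝ (Fin (n + 1)) | b ≤ ‖z‖ ^ 2 ∧ ‖z‖ ^ 2 < a} ≤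
      ENNReal.ofReal (ballVolume (n + 1) * ((n + 1) * ((a - b) / √a) * √a ^ n)) := by
  set x := √a
  set y := √b
  have hx : 0 < x := Real.sqrt_pos.mpr ha
  have hy : 0 ≤ y := Real.sqrt_nonneg _
  have hyx : y ≤ x := Real.sqrt_le_sqrt hab
  have hx2 : x ^ 2 = a := Real.sq_sqrt ha.le
  have hy2 : b ≤ y ^ 2 := by
    rcases le_total 0 b with h | h
    · exact (Real.sq_sqrt h).ge
    · exact h.trans (sq_nonneg _)
  have hsub : {z : EuclideanSpace ℝ (Fin (n + 1)) | b ≤ ‖z‖ ^ 2 ∧ ‖z‖ ^ 2 < a} ⊆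
      Metric.closedBall 0 x \ Metric.ball 0 y := by
    rintro z ⟨h1, h2⟩
    refine ⟨?_, ?_⟩
    · rw [mem_closedBall_zero_iff]
      exact Real.le_sqrt_of_sq_le h2.le
    · rw [mem_ball_zero_iff, not_lt]
      exact Real.sqrt_le_iff.mpr ⟨norm_nonneg _, h1⟩
  refine (measure_mono hsub).trans ?_
  rw [measure_sdiff (Metric.ball_subset_closedBall.trans (Metric.closedBall_subset_closedBall hyx))
    measurableSet_ball.nullMeasurableSet measure_ball_lt_top.ne, volume_closedBall_eq _ hx.le,
    volume_ball_eq (by simp) hy, ← ENNReal.ofReal_sub _ (by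
      have := ballVolume_nonneg (n + 1); positivity), ← mul_sub]
  refine ENNReal.ofReal_le_ofReal (mul_le_mul_of_nonneg_left ((pow_sub_pow_le hy hyx n).trans ?_)
    (ballVolume_nonneg _))
  have h3 : x - y ≤ (a - b) / x := by
    rw [le_div_iff₀ hx]
    nlinarith
  gcongr

/-- The integral is invariant under scaling. Factor R² - τ² = (R - τ)(R + τ): one factor is always
at least R, so only one endpoint singularity has to be integrated at a time. The constant is not
sharp. -/
lemma lintegral_inv_sqrt_le {R : ℝ} (hR : 0 < R) :
    ∫⁻ τ in Set.Ioo (-R) R, ENNReal.ofReal (1 / √(R ^ 2 - τ ^ 2)) ≤ ENNReal.ofReal 8 := by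
  have hi : ∀ a b : ℝ, IntervalIntegrable (fun x : ℝ => x ^ (-(1 / 2) : ℝ)) volume a b :=
    fun a b => intervalIntegral.intervalIntegrable_rpow' (by norm_num)
  have h1 : IntervalIntegrable (fun x : ℝ => (R - x) ^ (-(1 / 2) : ℝ)) volume (-R) R := by
    have := (hi (2 * R) 0).comp_sub_left R
    have e1 : R - 2 * R = -R := by ring
    rwa [e1, sub_zero] at this
  have h2 : IntervalIntegrable (fun x : ℝ => (R + x) ^ (-(1 / 2) : ℝ)) volume (-R) R := by
    have := (hi 0 (2 * R)).comp_add_left R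
    have e1 : 2 * R - R = R := by ring
    rwa [e1, zero_sub] at this
  have hval : ∫ x in (0 : ℝ)..(2 * R), x ^ (-(1 / 2) : ℝ) = 2 * (2 * R) ^ (1 / 2 : ℝ) := by
    rw [integral_rpow (Or.inl (by norm_num))]
    norm_num
    ring
  have hle : ∀ τ ∈ Set.Ioo (-R) R, 1 / √(R ^ 2 - τ ^ 2) ≤
      R ^ (-(1 / 2) : ℝ) * ((R - τ) ^ (-(1 / 2) : ℝ) + (R + τ) ^ (-(1 / 2) : ℝ)) := by
    rintro τ ⟨ha, hb⟩
    have p1 : 0 < R - τ := by linarith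
    have p2 : 0 < R + τ := by linarith
    have e : 1 / √(R ^ 2 - τ ^ 2) = (R - τ) ^ (-(1 / 2) : ℝ) * (R + τ) ^ (-(1 / 2) : ℝ) := by
      rw [← Real.mul_rpow p1.le p2.le, Real.rpow_neg (by positivity), ← Real.sqrt_eq_rpow, one_div]
      congr 2
      ring
    rw [e]
    have q1 : 0 ≤ (R - τ) ^ (-(1 / 2) : ℝ) := Real.rpow_nonneg p1.le _
    have q2 : 0 ≤ (R + τ) ^ (-(1 / 2) : ℝ) := Real.rpow_nonneg p2.le _
    have q3 : 0 ≤ R ^ (-(1 / 2) : ℝ) := Real.rpow_nonneg hR.le _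
    rcases le_total 0 τ with h | h
    · have : (R + τ) ^ (-(1 / 2) : ℝ) ≤ R ^ (-(1 / 2) : ℝ) :=
        Real.rpow_le_rpow_of_nonpos hR (by linarith) (by norm_num)
      nlinarith
    · have : (R - τ) ^ (-(1 / 2) : ℝ) ≤ R ^ (-(1 / 2) : ℝ) :=
        Real.rpow_le_rpow_of_nonpos hR (by linarith) (by norm_num)
      nlinarith
  have hRR : -R ≤ R := by linarith
  have hint : IntegrableOn (fun τ => R ^ (-(1 / 2) : ℝ) *
      ((R - τ) ^ (-(1 / 2) : ℝ) + (R + τ) ^ (-(1 / 2) : ℝ))) (Set.Ioo (-R) R) := by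
    rw [← integrableOn_Ioc_iff_integrableOn_Ioo, ← intervalIntegrable_iff_integrableOn_Ioc_of_le hRR]
    exact (h1.add h2).const_mul _
  calc _ ≤ ∫⁻ τ in Set.Ioo (-R) R, ENNReal.ofReal (R ^ (-(1 / 2) : ℝ) *
      ((R - τ) ^ (-(1 / 2) : ℝ) + (R + τ) ^ (-(1 / 2) : ℝ))) :=
        setLIntegral_mono' measurableSet_Ioo fun τ hτ => ENNReal.ofReal_le_ofReal (hle τ hτ)
    _ = ENNReal.ofReal (∫ τ in Set.Ioo (-R) R, R ^ (-(1 / 2) : ℝ) *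
      ((R - τ) ^ (-(1 / 2) : ℝ) + (R + τ) ^ (-(1 / 2) : ℝ))) := by
        rw [ofReal_integral_eq_lintegral_ofReal hint]
        refine (ae_restrict_iff' measurableSet_Ioo).mpr (Filter.Eventually.of_forall ?_)
        rintro τ ⟨ha, hb⟩
        have p1 : 0 < R - τ := by linarith
        have p2 : 0 < R + τ := by linarith
        simp only [Pi.zero_apply]
        positivity
    _ ≤ _ := by
        apply ENNReal.ofReal_le_ofReal
        rw [← integral_Ioc_eq_integral_Ioo, ← intervalIntegral.integral_of_le hRR,
          intervalIntegral.integral_const_mul, intervalIntegral.integral_add h1 h2,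
          intervalIntegral.integral_comp_sub_left (fun x => x ^ (-(1 / 2) : ℝ)),
          intervalIntegral.integral_comp_add_left (fun x => x ^ (-(1 / 2) : ℝ))]
        have e1 : R - -R = 2 * R := by ring
        have e2 : R + R = 2 * R := by ring
        have e3 : R + -R = 0 := by ring
        rw [e1, sub_self, e2, e3, hval, Real.mul_rpow (by norm_num) hR.le]
        have e4 : R ^ (-(1 / 2) : ℝ) * R ^ (1 / 2 : ℝ) = 1 := by
          rw [← Real.rpow_add hR]; norm_num
        have e5 : (2 : ℝ) ^ (1 / 2 : ℝ) ≤ 2 := by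
          rw [← Real.sqrt_eq_rpow]
          exact Real.sqrt_le_iff.mpr ⟨by norm_num, by norm_num⟩
        calc _ = 4 * (2 : ℝ) ^ (1 / 2 : ℝ) * (R ^ (-(1 / 2) : ℝ) * R ^ (1 / 2 : ℝ)) := by ring
          _ ≤ 8 := by rw [e4]; linarith

/-- On the hyperplane at height τ along ξ the denominator is the constant s = (τ + |ξ|)² - τ², and
the admissible points form an annulus whose squared radii differ by the same s. So s cancels,
leaving R^m/√(R² - τ²), whose integral does not depend on ξ. -/
lemma lintegral_lindhard_le (m : ℕ) {ξ : EuclideanSpace ℝ (Fin (m + 2))} (hξ : ξ ≠ 0) {R : ℝ}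
    (hR : 0 < R) :
    ∫⁻ y in {y : EuclideanSpace ℝ (Fin (m + 2)) | ‖y‖ < R ∧ R ≤ ‖y + ξ‖},
      ENNReal.ofReal (1 / (‖y + ξ‖ ^ 2 - ‖y‖ ^ 2)) ≤
      ENNReal.ofReal (ballVolume (m + 1) * (m + 1) * R ^ m * 8) := by
  obtain ⟨Ψ, hΨ, hn, hi⟩ := exists_measurePreserving_axis (m + 1) hξ
  set Ω := {y : EuclideanSpace ℝ (Fin (m + 2)) | ‖y‖ < R ∧ R ≤ ‖y + ξ‖}
  have hΩ : MeasurableSet Ω :=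
    (measurableSet_lt measurable_norm measurable_const).inter
      (measurableSet_le measurable_const (measurable_norm.comp (measurable_add_const ξ)))
  set F : EuclideanSpace ℝ (Fin (m + 2)) → ℝ≥0∞ :=
    Ω.indicator fun y => ENNReal.ofReal (1 / (‖y + ξ‖ ^ 2 - ‖y‖ ^ 2))
  have hF : Measurable F := Measurable.indicator (by fun_prop) hΩ
  rw [← lintegral_indicator hΩ]
  change ∫⁻ y, F y ≤ _
  rw [← hΨ.lintegral_comp hF, lintegral_prod (fun a => F (Ψ a)) (hF.comp hΨ.measurable).aemeasurable]
  set κ := ‖ξ‖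
  have hκ : 0 < κ := norm_pos_iff.mpr hξ
  have hadd : ∀ p, ‖Ψ p + ξ‖ ^ 2 = (p.1 + κ) ^ 2 + ‖p.2‖ ^ 2 := fun p => by
    rw [norm_add_sq_real, hn, hi]; ring
  have hin : ∀ τ : ℝ, ∫⁻ z, F (Ψ (τ, z)) ≤ (Set.Ioo (-R) R).indicator (fun τ =>
      ENNReal.ofReal (ballVolume (m + 1) * (m + 1) * R ^ m) *
        ENNReal.ofReal (1 / √(R ^ 2 - τ ^ 2))) τ := by
    intro τ
    set s := (τ + κ) ^ 2 - τ ^ 2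
    have hmem : ∀ z, Ψ (τ, z) ∈ Ω ↔ R ^ 2 - (τ + κ) ^ 2 ≤ ‖z‖ ^ 2 ∧ ‖z‖ ^ 2 < R ^ 2 - τ ^ 2 := by
      intro z
      have e1 : ‖Ψ (τ, z)‖ < R ↔ ‖z‖ ^ 2 < R ^ 2 - τ ^ 2 := by
        rw [← sq_lt_sq₀ (norm_nonneg _) hR.le, hn, lt_sub_iff_add_lt']
      have e2 : R ≤ ‖Ψ (τ, z) + ξ‖ ↔ R ^ 2 - (τ + κ) ^ 2 ≤ ‖z‖ ^ 2 := by
        rw [← sq_le_sq₀ hR.le (norm_nonneg _), hadd, sub_le_iff_le_add']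
      change (_ ∧ _) ↔ _
      rw [e1, e2, and_comm]
    set S := {z : EuclideanSpace ℝ (Fin (m + 1)) |
        R ^ 2 - (τ + κ) ^ 2 ≤ ‖z‖ ^ 2 ∧ ‖z‖ ^ 2 < R ^ 2 - τ ^ 2} with hSdef
    have hS : MeasurableSet S :=
      (measurableSet_le measurable_const (measurable_norm.pow_const 2)).inter
        (measurableSet_lt (measurable_norm.pow_const 2) measurable_const)
    have hFz : ∀ z, F (Ψ (τ, z)) = S.indicator (fun _ => ENNReal.ofReal (1 / s)) z := by
      intro z
      by_cases h : Ψ (τ, z) ∈ Ω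
      · rw [Set.indicator_of_mem (show z ∈ S from (hmem z).mp h)]
        simp only [F]
        rw [Set.indicator_of_mem h, hadd, hn]
        congr 2
        simp only [s]; ring
      · rw [Set.indicator_of_notMem (show z ∉ S from fun h' => h ((hmem z).mpr h'))]
        simp only [F]
        rw [Set.indicator_of_notMem h]
    simp only [hFz]
    rw [lintegral_indicator_const hS]
    by_cases hne : ∃ z : EuclideanSpace ℝ (Fin (m + 1)),
        R ^ 2 - (τ + κ) ^ 2 ≤ ‖z‖ ^ 2 ∧ ‖z‖ ^ 2 < R ^ 2 - τ ^ 2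
    · obtain ⟨z, hz1, hz2⟩ := hne
      have ha : 0 < R ^ 2 - τ ^ 2 := lt_of_le_of_lt (sq_nonneg _) hz2
      have hs : 0 < s := by simp only [s]; linarith
      have hτ : τ ∈ Set.Ioo (-R) R := abs_lt.mp (abs_lt_of_sq_lt_sq (by linarith) hR.le)
      rw [Set.indicator_of_mem hτ]
      have hv := volume_annulus_le m ha (b := R ^ 2 - (τ + κ) ^ 2) (by linarith)
      -- The cancellation: the gap between the squared radii is the energy denominator.
      have es : R ^ 2 - τ ^ 2 - (R ^ 2 - (τ + κ) ^ 2) = s := by simp only [s]; ring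
      rw [es] at hv
      refine (mul_le_mul_right hv _).trans ?_
      have hω := ballVolume_nonneg (m + 1)
      rw [← ENNReal.ofReal_mul (by positivity), ← ENNReal.ofReal_mul (by positivity)]
      apply ENNReal.ofReal_le_ofReal
      have hsq : √(R ^ 2 - τ ^ 2) ≤ R := Real.sqrt_le_iff.mpr ⟨hR.le, by nlinarith⟩
      have hsq0 : 0 < √(R ^ 2 - τ ^ 2) := Real.sqrt_pos.mpr ha
      calc _ = ballVolume (m + 1) * (m + 1) * √(R ^ 2 - τ ^ 2) ^ m *
            (1 / √(R ^ 2 - τ ^ 2)) := by field_simp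
        _ ≤ _ := by gcongr
    · have : S = ∅ :=
        Set.eq_empty_iff_forall_notMem.mpr fun z hz => hne ⟨z, hz⟩
      rw [this]
      simp
  refine (lintegral_mono hin).trans ?_
  rw [lintegral_indicator measurableSet_Ioo, lintegral_const_mul _ (by fun_prop)]
  have hω := ballVolume_nonneg (m + 1)
  rw [ENNReal.ofReal_mul (p := ballVolume (m + 1) * (m + 1) * R ^ m) (by positivity)]
  exact mul_le_mul_right (lintegral_inv_sqrt_le hR) _

/-- Riemann sum comparison. Moving p to any point of its cube displaces it by at most √d, so the
margins 2√d keep the point in the domain of integration. The denominator changes by at most 2√d|k|,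
which is at most its own size; hence the factor 2. -/
lemma lindhard_sum_le (m : ℕ) : ∃ C : ℝ, 0 < C ∧ ∀ (R : ℝ) (k : Fin (m + 2) → ℤ)
    (A : Finset (Fin (m + 2) → ℤ)), 0 ≤ R → (∀ p ∈ A, ‖latticePoint p‖ ≤ R - 2 * √(m + 2 : ℕ) ∧
      R + 2 * √(m + 2 : ℕ) ≤ ‖latticePoint (p + k)‖) →
    ∑ p ∈ A, 1 / (‖latticePoint (p + k)‖ ^ 2 - ‖latticePoint p‖ ^ 2) ≤ C * R ^ m := by
  have hω := ballVolume_nonneg (m + 1)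
  refine ⟨2 * (ballVolume (m + 1) * (m + 1) * 8) + 1, by positivity, ?_⟩
  intro R k A hR hA
  set D := √((m + 2 : ℕ) : ℝ)
  have hD : 0 < D := Real.sqrt_pos.mpr (by positivity)
  rcases A.eq_empty_or_nonempty with rfl | ⟨p₀, hp₀⟩
  · simp only [Finset.sum_empty]; positivity
  have hRpos : 0 < R := by
    have := (hA p₀ hp₀).1
    have := norm_nonneg (latticePoint p₀)
    linarith
  set ξ := latticePoint k
  have hξ : ξ ≠ 0 := by
    intro h
    have h1 := hA p₀ hp₀
    rw [latticePoint_add] at h1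
    change _ ∧ _ ≤ ‖_ + ξ‖ at h1
    rw [h, add_zero] at h1
    linarith
  -- Difference of squares: the norms differ by at least 4D and their sum is at least |ξ|.
  have hs : ∀ p ∈ A, 2 * D * ‖ξ‖ ≤ ‖latticePoint (p + k)‖ ^ 2 - ‖latticePoint p‖ ^ 2 := by
    intro p hp
    obtain ⟨h1, h2⟩ := hA p hp
    have h3 : ‖ξ‖ ≤ ‖latticePoint (p + k)‖ + ‖latticePoint p‖ := by
      have := norm_sub_le (latticePoint (p + k)) (latticePoint p)
      rwa [latticePoint_add, add_sub_cancel_left, ← latticePoint_add] at this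
    have h4 := norm_nonneg ξ
    nlinarith [norm_nonneg (latticePoint p)]
  have hξn : 0 < ‖ξ‖ := norm_pos_iff.mpr hξ
  have key := sum_le_lintegral_of_unitCube A
    (h := fun p => ENNReal.ofReal (1 / (‖latticePoint (p + k)‖ ^ 2 - ‖latticePoint p‖ ^ 2)))
    (g := fun y => ENNReal.ofReal 2 * ENNReal.ofReal (1 / (‖y + ξ‖ ^ 2 - ‖y‖ ^ 2)))
    (Ω := {y | ‖y‖ < R ∧ R ≤ ‖y + ξ‖}) (by
      intro p hp y hy
      obtain ⟨h1, h2⟩ := hA p hp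
      have hd := norm_sub_latticePoint_le hy
      change _ ≤ D at hd
      have hy1 : ‖y‖ < R := by
        have := norm_sub_norm_le y (latticePoint p)
        linarith
      have hy2 : R ≤ ‖y + ξ‖ := by
        have h3 := norm_sub_norm_le (latticePoint (p + k)) (y + ξ)
        have h4 : latticePoint (p + k) - (y + ξ) = -(y - latticePoint p) := by
          rw [latticePoint_add]; simp only [ξ]; abel
        rw [h4, norm_neg] at h3
        linarith
      refine ⟨⟨hy1, hy2⟩, ?_⟩
      rw [← ENNReal.ofReal_mul (by norm_num)]
      apply ENNReal.ofReal_le_ofReal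
      have hspos : 0 < ‖y + ξ‖ ^ 2 - ‖y‖ ^ 2 := by
        have := norm_nonneg y
        nlinarith
      have hsp := hs p hp
      have hsp0 : 0 < ‖latticePoint (p + k)‖ ^ 2 - ‖latticePoint p‖ ^ 2 :=
        lt_of_lt_of_le (by positivity) hsp
      have hdiff : ‖y + ξ‖ ^ 2 - ‖y‖ ^ 2 =
          (‖latticePoint (p + k)‖ ^ 2 - ‖latticePoint p‖ ^ 2) +
            2 * inner ℝ (y - latticePoint p) ξ := by
        rw [latticePoint_add, norm_add_sq_real, norm_add_sq_real, inner_sub_left]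
        simp only [ξ]
        ring
      have hcs : inner ℝ (y - latticePoint p) ξ ≤ D * ‖ξ‖ :=
        (real_inner_le_norm _ _).trans (by gcongr)
      rw [← mul_div_assoc, mul_one, div_le_div_iff₀ hsp0 hspos]
      linarith)
  rw [lintegral_const_mul _ (by fun_prop)] at key
  have key2 := key.trans (mul_le_mul_right (lintegral_lindhard_le m hξ hRpos) _)
  rw [← ENNReal.ofReal_mul (by norm_num), ← ENNReal.ofReal_sum_of_nonneg (fun p hp => by
    have := hs p hp
    exact one_div_nonneg.mpr (le_trans (by positivity) this))] at key2
  have h5 := (ENNReal.ofReal_le_ofReal_iff (by positivity)).mp key2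
  have : 0 ≤ R ^ m := by positivity
  nlinarith

end Lindhard

/-! ### Densities of contractions and the layer-cake bound -/

section Density

variable {d q : ℕ} {L : ℝ} {Y : Type*} [NormedAddCommGroup Y] [InnerProductSpace ℂ Y]

/-- The evaluation functional at `x` and spin `s` on the span of the plane waves in `A`, as a
vector. -/
def kernelVec (d q : ℕ) (L : ℝ) (A : Finset (Fin d → ℤ)) (s : Fin q)
    (x : EuclideanSpace ℝ (Fin d)) : BoxL2 d q L :=
  ∑ p ∈ A, planeWaveConj d L p x • planeWave d q L (p, s)

/-- The density at `x` of `Γ* Γ` compressed to the modes in `A`. -/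
def modeDensity (Γ : BoxL2 d q L →L[ℂ] Y) (A : Finset (Fin d → ℤ))
    (x : EuclideanSpace ℝ (Fin d)) : ℝ :=
  ∑ s : Fin q, ‖Γ (kernelVec d q L A s x)‖ ^ 2

lemma map_kernelVec (Γ : BoxL2 d q L →L[ℂ] Y) (A : Finset (Fin d → ℤ)) (s : Fin q)
    (x : EuclideanSpace ℝ (Fin d)) : Γ (kernelVec d q L A s x) =
      ∑ p ∈ A, planeWaveConj d L p x • Γ (planeWave d q L (p, s)) := by
  simp [kernelVec]

lemma norm_kernelVec_sq (hL : 0 < L) (A : Finset (Fin d → ℤ)) (s : Fin q)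
    (x : EuclideanSpace ℝ (Fin d)) : ‖kernelVec d q L A s x‖ ^ 2 = A.card * (L ^ d)⁻¹ := by
  have ho : Orthonormal ℂ fun p : Fin d → ℤ => planeWave d q L (p, s) :=
    (orthonormal_planeWave hL).comp _ fun a b h => (Prod.mk.inj h).1
  have h := ho.inner_sum (fun p => planeWaveConj d L p x) (fun p => planeWaveConj d L p x) A
  rw [← kernelVec, inner_self_eq_norm_sq_to_K] at h
  have h2 : ∀ p ∈ A, starRingEnd ℂ (planeWaveConj d L p x) * planeWaveConj d L p x =
      (((L ^ d)⁻¹ : ℝ) : ℂ) := fun p _ => by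
    rw [← norm_planeWaveConj_sq d hL p x, RCLike.conj_mul]
    norm_cast
  rw [Finset.sum_congr rfl h2, Finset.sum_const, nsmul_eq_mul] at h
  apply Complex.ofReal_injective
  push_cast at h ⊢
  exact h

lemma modeDensity_nonneg (Γ : BoxL2 d q L →L[ℂ] Y) (A : Finset (Fin d → ℤ))
    (x : EuclideanSpace ℝ (Fin d)) : 0 ≤ modeDensity Γ A x :=
  Finset.sum_nonneg fun _ _ => sq_nonneg _

lemma continuous_modeDensity (Γ : BoxL2 d q L →L[ℂ] Y) (A : Finset (Fin d → ℤ)) :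
    Continuous (modeDensity Γ A) := by
  have : modeDensity Γ A = fun x => ∑ s : Fin q,
      ‖∑ p ∈ A, planeWaveConj d L p x • Γ (planeWave d q L (p, s))‖ ^ 2 := by
    funext x
    simp only [modeDensity, map_kernelVec]
  rw [this]
  have := continuous_planeWaveConj d L
  fun_prop

/-- The Pauli principle: a contraction cannot exceed the density of completely filled modes. -/
lemma modeDensity_le (hL : 0 < L) {Γ : BoxL2 d q L →L[ℂ] Y} (hΓ : ∀ v, ‖Γ v‖ ≤ ‖v‖)
    (A : Finset (Fin d → ℤ)) (x : EuclideanSpace ℝ (Fin d)) :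
    modeDensity Γ A x ≤ q * (A.card * (L ^ d)⁻¹) := by
  have : ∀ s ∈ (Finset.univ : Finset (Fin q)),
      ‖Γ (kernelVec d q L A s x)‖ ^ 2 ≤ A.card * (L ^ d)⁻¹ := fun s _ => by
    rw [← norm_kernelVec_sq hL A s x]
    gcongr
    exact hΓ _
  exact (Finset.sum_le_card_nsmul _ _ _ this).trans_eq (by simp)

lemma norm_add_sq_le {E : Type*} [SeminormedAddCommGroup E] (u v : E) :
    ‖u + v‖ ^ 2 ≤ 2 * ‖u‖ ^ 2 + 2 * ‖v‖ ^ 2 := by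
  have := norm_add_le u v
  nlinarith [norm_nonneg (u + v), sq_nonneg (‖u‖ - ‖v‖)]

lemma kernelVec_filter_add (A : Finset (Fin d → ℤ)) (P : (Fin d → ℤ) → Prop) [DecidablePred P]
    (s : Fin q) (x : EuclideanSpace ℝ (Fin d)) :
    kernelVec d q L (A.filter P) s x + kernelVec d q L (A.filter fun p => ¬ P p) s x =
      kernelVec d q L A s x :=
  Finset.sum_filter_add_sum_filter_not _ _ _

lemma modeDensity_filter_le (Γ : BoxL2 d q L →L[ℂ] Y) (A : Finset (Fin d → ℤ))
    (P : (Fin d → ℤ) → Prop) [DecidablePred P] (x : EuclideanSpace ℝ (Fin d)) :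
    modeDensity Γ A x ≤ 2 * modeDensity Γ (A.filter P) x +
      2 * modeDensity Γ (A.filter fun p => ¬ P p) x := by
  simp only [modeDensity, Finset.mul_sum, ← Finset.sum_add_distrib]
  refine Finset.sum_le_sum fun s _ => ?_
  rw [← kernelVec_filter_add A P s x, map_add]
  exact norm_add_sq_le _ _

lemma integral_norm_sum_planeWaveConj_sq (hL : 0 < L) (A : Finset (Fin d → ℤ))
    (y : (Fin d → ℤ) → Y) :
    ∫ x, ‖∑ p ∈ A, planeWaveConj d L p x • y p‖ ^ 2 ∂(boxMeasure d L) = ∑ p ∈ A, ‖y p‖ ^ 2 := by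
  have hc : ∀ p r : Fin d → ℤ, Integrable (fun x => starRingEnd ℂ (planeWaveConj d L p x) *
      planeWaveConj d L r x) (boxMeasure d L) := fun p r => by
    refine Integrable.of_bound (C := |L ^ (-(d : ℝ) / 2)| * |L ^ (-(d : ℝ) / 2)|)
      ((Complex.continuous_conj.comp (continuous_planeWaveConj d L p)).mul
        (continuous_planeWaveConj d L r)).aestronglyMeasurable
      (Filter.Eventually.of_forall fun x => ?_)
    rw [norm_mul, RCLike.norm_conj]
    simp only [planeWaveConj, norm_mul, Complex.norm_exp_ofReal_mul_I, mul_one, Complex.norm_real,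
      Real.norm_eq_abs]
    rfl
  have h1 : ∀ x, ((‖∑ p ∈ A, planeWaveConj d L p x • y p‖ ^ 2 : ℝ) : ℂ) =
      ∑ p ∈ A, ∑ r ∈ A, (starRingEnd ℂ (planeWaveConj d L p x) * planeWaveConj d L r x) *
        inner ℂ (y p) (y r) := by
    intro x
    have := inner_self_eq_norm_sq_to_K (𝕜 := ℂ) (∑ p ∈ A, planeWaveConj d L p x • y p)
    simp only [sum_inner, inner_sum, inner_smul_left, inner_smul_right] at this
    push_cast
    refine this.symm.trans ?_
    simp only [Finset.mul_sum]
    rw [Finset.sum_comm]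
    refine Finset.sum_congr rfl fun p _ => Finset.sum_congr rfl fun r _ => ?_
    ring
  have h2 : ((∫ x, ‖∑ p ∈ A, planeWaveConj d L p x • y p‖ ^ 2 ∂(boxMeasure d L) : ℝ) : ℂ) =
      ((∑ p ∈ A, ‖y p‖ ^ 2 : ℝ) : ℂ) := by
    rw [← integral_complex_ofReal]
    simp only [h1]
    rw [integral_finsetSum _ fun p _ => integrable_finsetSum _ fun r _ => (hc p r).mul_const _]
    push_cast
    refine Finset.sum_congr rfl fun p hp => ?_
    rw [integral_finsetSum _ fun r _ => (hc p r).mul_const _]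
    simp only [integral_mul_const, integral_conj_mul_planeWaveConj hL, ite_mul, one_mul, zero_mul,
      Finset.sum_ite_eq, if_pos hp]
    exact inner_self_eq_norm_sq_to_K _
  exact_mod_cast h2

lemma integrable_of_continuous_box {F : Type*} [NormedAddCommGroup F]
    {f : EuclideanSpace ℝ (Fin d) → F} (hf : Continuous f) :
    Integrable f (boxMeasure d L) := by
  have hK : IsCompact (Metric.closedBall (0 : EuclideanSpace ℝ (Fin d)) (√(d * (L / 2) ^ 2))) :=
    isCompact_closedBall _ _
  refine (hf.continuousOn.integrableOn_compact hK).mono_set fun x hx => ?_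
  rw [mem_closedBall_zero_iff, EuclideanSpace.norm_eq]
  apply Real.sqrt_le_sqrt
  have : ∀ i ∈ (Finset.univ : Finset (Fin d)), ‖x i‖ ^ 2 ≤ (L / 2) ^ 2 := by
    intro i _
    have := hx i
    rw [Real.norm_eq_abs, sq_abs]
    exact sq_le_sq' this.1 this.2.le
  simpa using Finset.sum_le_card_nsmul _ _ _ this

lemma integral_modeDensity (hL : 0 < L) (Γ : BoxL2 d q L →L[ℂ] Y) (A : Finset (Fin d → ℤ)) :
    ∫ x, modeDensity Γ A x ∂(boxMeasure d L) =
      ∑ p ∈ A, ∑ s : Fin q, ‖Γ (planeWave d q L (p, s))‖ ^ 2 := by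
  simp only [modeDensity, map_kernelVec]
  rw [integral_finsetSum, Finset.sum_comm]
  · exact Finset.sum_congr rfl fun s _ => integral_norm_sum_planeWaveConj_sq hL A _
  · intro s _
    apply integrable_of_continuous_box
    have := continuous_planeWaveConj d L
    fun_prop

lemma lintegral_modeDensity (hL : 0 < L) (Γ : BoxL2 d q L →L[ℂ] Y) (A : Finset (Fin d → ℤ)) :
    ∫⁻ x, ENNReal.ofReal (modeDensity Γ A x) ∂(boxMeasure d L) =
      ENNReal.ofReal (∑ p ∈ A, ∑ s : Fin q, ‖Γ (planeWave d q L (p, s))‖ ^ 2) := by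
  rw [← integral_modeDensity hL, ofReal_integral_eq_lintegral_ofReal
    (integrable_of_continuous_box (continuous_modeDensity Γ A))
    (Filter.Eventually.of_forall (modeDensity_nonneg Γ A))]

lemma measurable_modeDensity_filter (Γ : BoxL2 d q L →L[ℂ] Y) (A : Finset (Fin d → ℤ))
    (w : (Fin d → ℤ) → ℝ) :
    Measurable fun z : EuclideanSpace ℝ (Fin d) × ℝ =>
      ENNReal.ofReal (modeDensity Γ (A.filter fun p => z.2 < w p) z.1) := by
  refine ENNReal.measurable_ofReal.comp ?_
  simp only [modeDensity, map_kernelVec, Finset.sum_filter]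
  refine Finset.measurable_sum _ fun s _ => Measurable.pow_const ?_ 2
  refine (StronglyMeasurable.norm ?_).measurable
  refine Finset.stronglyMeasurable_fun_sum _ fun p _ => ?_
  refine StronglyMeasurable.ite (measurableSet_lt measurable_snd measurable_const) ?_
    stronglyMeasurable_const
  exact (((continuous_planeWaveConj d L p).comp continuous_fst).smul
    continuous_const).stronglyMeasurable

lemma measurable_modeDensity_filter_right (Γ : BoxL2 d q L →L[ℂ] Y) (A : Finset (Fin d → ℤ))
    (w : (Fin d → ℤ) → ℝ) (x : EuclideanSpace ℝ (Fin d)) :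
    Measurable fun e : ℝ => ENNReal.ofReal (modeDensity Γ (A.filter fun p => e < w p) x) := by
  have h := (measurable_modeDensity_filter Γ A w).comp
    (g := fun z : EuclideanSpace ℝ (Fin d) × ℝ =>
      ENNReal.ofReal (modeDensity Γ (A.filter fun p => z.2 < w p) z.1))
    (measurable_const.prodMk measurable_id : Measurable fun e : ℝ => (x, e))
  exact h

/-- Layer cake: the mode p is kept for exactly the levels 0 < e < w p, an interval of length w p,
while Parseval in x gives its weight. -/
lemma lintegral_layer_modeDensity (hL : 0 < L) (Γ : BoxL2 d q L →L[ℂ] Y)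
    (A : Finset (Fin d → ℤ)) {w : (Fin d → ℤ) → ℝ} (hw : ∀ p, 0 ≤ w p) :
    ∫⁻ x, (∫⁻ e in Set.Ioi (0 : ℝ),
      ENNReal.ofReal (modeDensity Γ (A.filter fun p => e < w p) x)) ∂(boxMeasure d L) =
      ENNReal.ofReal (∑ p ∈ A, w p * ∑ s : Fin q, ‖Γ (planeWave d q L (p, s))‖ ^ 2) := by
  rw [lintegral_lintegral_swap (measurable_modeDensity_filter Γ A w).aemeasurable]
  have hn : ∀ p, 0 ≤ ∑ s : Fin q, ‖Γ (planeWave d q L (p, s))‖ ^ 2 := fun p =>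
    Finset.sum_nonneg fun _ _ => sq_nonneg _
  have h1 : ∀ e : ℝ, ∫⁻ x, ENNReal.ofReal (modeDensity Γ (A.filter fun p => e < w p) x)
      ∂(boxMeasure d L) = ∑ p ∈ A, (Set.Iio (w p)).indicator
        (fun _ => ENNReal.ofReal (∑ s : Fin q, ‖Γ (planeWave d q L (p, s))‖ ^ 2)) e := by
    intro e
    rw [lintegral_modeDensity hL, ENNReal.ofReal_sum_of_nonneg fun p _ => hn p, Finset.sum_filter]
    refine Finset.sum_congr rfl fun p _ => ?_
    simp only [Set.indicator, Set.mem_Iio]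
  simp only [h1]
  rw [lintegral_finsetSum _ fun p _ => measurable_const.indicator measurableSet_Iio,
    ENNReal.ofReal_sum_of_nonneg fun p _ => mul_nonneg (hw p) (hn p)]
  refine Finset.sum_congr rfl fun p _ => ?_
  rw [lintegral_indicator_const measurableSet_Iio, Measure.restrict_apply measurableSet_Iio,
    Set.inter_comm, Set.Ioi_inter_Iio, Real.volume_Ioo, sub_zero, ← ENNReal.ofReal_mul (hn p),
    mul_comm]

/-- A Lieb–Thirring type bound for the density of a contraction, by splitting into high and low
modes at a level depending on `V x`. -/
lemma lintegral_mul_modeDensity_le (hL : 0 < L) {Γ : BoxL2 d q L →L[ℂ] Y}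
    (hΓ : ∀ v, ‖Γ v‖ ≤ ‖v‖) (A : Finset (Fin d → ℤ)) {w : (Fin d → ℤ) → ℝ} (hw : ∀ p, 0 ≤ w p)
    {g : ℝ → ℝ} (hg : ∀ e e', 0 ≤ e → e ≤ e' → ((A.filter fun p => w p ≤ e).card : ℝ) ≤ g e')
    (V : EuclideanSpace ℝ (Fin d) → ℝ) {c : ℝ} (hc : 0 < c) :
    ∫⁻ x, ENNReal.ofReal (|V x| * modeDensity Γ A x) ∂(boxMeasure d L) ≤
      ENNReal.ofReal (2 / c * ∑ p ∈ A, w p * ∑ s : Fin q, ‖Γ (planeWave d q L (p, s))‖ ^ 2) +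
      ∫⁻ x, ENNReal.ofReal (2 * q * (|V x| * (g (c * |V x|) * (L ^ d)⁻¹))) ∂(boxMeasure d L) := by
  have hpt : ∀ x, ENNReal.ofReal (|V x| * modeDensity Γ A x) ≤
      ENNReal.ofReal (2 / c) * (∫⁻ e in Set.Ioi (0 : ℝ),
        ENNReal.ofReal (modeDensity Γ (A.filter fun p => e < w p) x)) +
      ENNReal.ofReal (2 * q * (|V x| * (g (c * |V x|) * (L ^ d)⁻¹))) := by
    intro x
    set v := c * |V x| with hv
    have hv0 : 0 ≤ v := by positivity
    have hg0 : 0 ≤ g v := le_trans (Nat.cast_nonneg _) (hg 0 v le_rfl hv0)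
    have hLd : 0 < (L ^ d)⁻¹ := by positivity
    set K := g v * (L ^ d)⁻¹
    have hK : 0 ≤ K := by positivity
    have hVe : |V x| = v * (1 / c) := by rw [hv]; field_simp
    -- At each level e < v, the modes with w p > e are kept, and those with w p ≤ e number at most g
    -- v and obey the Pauli bound.
    have h1 : ∀ e ∈ Set.Ioo 0 v, ENNReal.ofReal (modeDensity Γ A x) ≤
        ENNReal.ofReal 2 * ENNReal.ofReal (modeDensity Γ (A.filter fun p => e < w p) x) +
          ENNReal.ofReal (2 * q * K) := by
      rintro e ⟨he0, hev⟩
      rw [← ENNReal.ofReal_mul (by norm_num), ← ENNReal.ofReal_add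
        (mul_nonneg (by norm_num) (modeDensity_nonneg _ _ _)) (by positivity)]
      apply ENNReal.ofReal_le_ofReal
      have h2 := modeDensity_filter_le Γ A (fun p => e < w p) x
      have h3 := modeDensity_le hL hΓ (A.filter fun p => ¬ e < w p) x
      simp only [not_lt] at h2 h3
      have h4 : (q : ℝ) * ((A.filter fun p => w p ≤ e).card * (L ^ d)⁻¹) ≤ q * K := by
        have := hg e v he0.le hev.le
        simp only [K]
        gcongr
      linarith
    -- Integrate over 0 < e < v. Dividing later by c leaves 2/c in front of the kinetic term, so a
    -- larger c spends less kinetic energy.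
    have h5 : ENNReal.ofReal v * ENNReal.ofReal (modeDensity Γ A x) ≤
        ENNReal.ofReal 2 * (∫⁻ e in Set.Ioi (0 : ℝ),
          ENNReal.ofReal (modeDensity Γ (A.filter fun p => e < w p) x)) +
          ENNReal.ofReal (2 * q * K) * ENNReal.ofReal v := by
      have hm := measurable_modeDensity_filter_right Γ A w x
      calc ENNReal.ofReal v * ENNReal.ofReal (modeDensity Γ A x)
          = ∫⁻ e in Set.Ioo 0 v, ENNReal.ofReal (modeDensity Γ A x) := by
            rw [setLIntegral_const, Real.volume_Ioo, sub_zero, mul_comm]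
        _ ≤ ∫⁻ e in Set.Ioo 0 v, (ENNReal.ofReal 2 *
              ENNReal.ofReal (modeDensity Γ (A.filter fun p => e < w p) x) +
              ENNReal.ofReal (2 * q * K)) := setLIntegral_mono' measurableSet_Ioo h1
        _ = ENNReal.ofReal 2 * (∫⁻ e in Set.Ioo 0 v,
              ENNReal.ofReal (modeDensity Γ (A.filter fun p => e < w p) x)) +
              ENNReal.ofReal (2 * q * K) * ENNReal.ofReal v := by
            rw [lintegral_add_right _ measurable_const, lintegral_const_mul _ hm,
              setLIntegral_const, Real.volume_Ioo, sub_zero]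
        _ ≤ _ := by
            gcongr
            exact Set.Ioo_subset_Ioi_self
    have h6 := mul_le_mul_right h5 (ENNReal.ofReal (1 / c))
    have e1 : ENNReal.ofReal (|V x| * modeDensity Γ A x) =
        ENNReal.ofReal (1 / c) * (ENNReal.ofReal v * ENNReal.ofReal (modeDensity Γ A x)) := by
      rw [← ENNReal.ofReal_mul hv0, ← ENNReal.ofReal_mul (by positivity), hVe]
      congr 1; ring
    have e2 : ENNReal.ofReal (2 / c) = ENNReal.ofReal (1 / c) * ENNReal.ofReal 2 := by
      rw [← ENNReal.ofReal_mul (by positivity)]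
      congr 1; ring
    have e3 : ENNReal.ofReal (2 * q * (|V x| * K)) =
        ENNReal.ofReal (1 / c) * (ENNReal.ofReal (2 * q * K) * ENNReal.ofReal v) := by
      rw [← ENNReal.ofReal_mul (by positivity), ← ENNReal.ofReal_mul (by positivity), hVe]
      congr 1; ring
    rw [e1, e2, e3, mul_assoc, ← mul_add]
    exact h6
  have hm : Measurable fun x => ∫⁻ e in Set.Ioi (0 : ℝ),
      ENNReal.ofReal (modeDensity Γ (A.filter fun p => e < w p) x) :=
    (measurable_modeDensity_filter Γ A w).lintegral_prod_right'
  refine (lintegral_mono hpt).trans ?_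
  rw [lintegral_add_left (hm.const_mul _), lintegral_const_mul _ hm,
    lintegral_layer_modeDensity hL Γ A hw, ← ENNReal.ofReal_mul (by positivity)]

end Density

/-! ### Diagonal operators and the eigenbasis of a coercive form -/

section Abstract

universe u

variable {X : Type u} [NormedAddCommGroup X] [InnerProductSpace ℂ X] {ι : Type*}

lemma hasSum_repr_sq (b : HilbertBasis ι ℂ X) (u : X) :
    HasSum (fun i => ‖b.repr u i‖ ^ 2) (‖u‖ ^ 2) := by
  have h := lp.hasSum_norm (p := 2) (by norm_num) (b.repr u)
  simpa using h

lemma norm_le_of_repr_le (b : HilbertBasis ι ℂ X) {u v : X} {C : ℝ} (hC : 0 ≤ C)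
    (h : ∀ i, ‖b.repr u i‖ ≤ C * ‖b.repr v i‖) : ‖u‖ ≤ C * ‖v‖ := by
  refine (sq_le_sq₀ (norm_nonneg _) (by positivity)).mp ?_
  rw [mul_pow]
  refine hasSum_le (fun i => ?_) (hasSum_repr_sq b u) ((hasSum_repr_sq b v).mul_left (C ^ 2))
  rw [← mul_pow]
  exact pow_le_pow_left₀ (norm_nonneg _) (h i) 2

lemma memℓp_two_mul {t : ι → ℝ} {C : ℝ} (ht : ∀ i, |t i| ≤ C) (f : lp (fun _ : ι => ℂ) 2) :
    Memℓp (fun i => (t i : ℂ) * f i) 2 := by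
  have h := (lp.memℓp f).summable (by norm_num)
  refine memℓp_gen (Summable.of_nonneg_of_le (fun i => by positivity) (fun i => ?_)
    (h.mul_left (C ^ 2)))
  simp only [ENNReal.toReal_ofNat, Real.rpow_ofNat, norm_mul, mul_pow, Complex.norm_real,
    Real.norm_eq_abs]
  gcongr
  exact ht i

/-- The diagonal operator with bounded eigenvalues `t` on the Hilbert basis `b`. -/
def diagOp (b : HilbertBasis ι ℂ X) (t : ι → ℝ) {C : ℝ} (hC : 0 ≤ C) (ht : ∀ i, |t i| ≤ C) :
    X →L[ℂ] X :=
  LinearMap.mkContinuous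
    { toFun := fun u => b.repr.symm ⟨fun i => (t i : ℂ) * b.repr u i, memℓp_two_mul ht _⟩
      map_add' := fun u v => by
        apply b.repr.injective
        ext i
        simp [mul_add]
        rfl
      map_smul' := fun c u => by
        apply b.repr.injective
        ext i
        simp
        ring } C (fun u => norm_le_of_repr_le b hC fun i => by
          simp only [LinearMap.coe_mk, AddHom.coe_mk, LinearIsometryEquiv.apply_symm_apply, norm_mul,
            Complex.norm_real, Real.norm_eq_abs]
          gcongr
          exact ht i)

lemma repr_diagOp (b : HilbertBasis ι ℂ X) (t : ι → ℝ) {C : ℝ} (hC : 0 ≤ C)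
    (ht : ∀ i, |t i| ≤ C) (u : X) (i : ι) :
    b.repr (diagOp b t hC ht u) i = (t i : ℂ) * b.repr u i := by
  simp [diagOp]

lemma isSymmetric_diagOp (b : HilbertBasis ι ℂ X) (t : ι → ℝ) {C : ℝ} (hC : 0 ≤ C)
    (ht : ∀ i, |t i| ≤ C) : (diagOp b t hC ht : X →ₗ[ℂ] X).IsSymmetric := by
  intro u v
  simp only [ContinuousLinearMap.coe_coe]
  rw [← b.repr.inner_map_map, ← b.repr.inner_map_map, lp.inner_eq_tsum, lp.inner_eq_tsum]
  refine tsum_congr fun i => ?_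
  simp only [repr_diagOp, RCLike.inner_apply, map_mul, Complex.conj_ofReal]
  ring

lemma diagOp_injective (b : HilbertBasis ι ℂ X) (t : ι → ℝ) {C : ℝ} (hC : 0 ≤ C)
    (ht : ∀ i, |t i| ≤ C) (h0 : ∀ i, t i ≠ 0) : Function.Injective (diagOp b t hC ht) := by
  intro u v huv
  apply b.repr.injective
  ext i
  have h := congrArg (fun w => b.repr w i) huv
  simp only [repr_diagOp] at h
  exact mul_left_cancel₀ (by exact_mod_cast h0 i) h

/-- It is the norm limit of its finite-rank truncations, as all but finitely many eigenvalues are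
small. -/
lemma isCompactOperator_diagOp [CompleteSpace X] (b : HilbertBasis ι ℂ X) (t : ι → ℝ) {C : ℝ}
    (hC : 0 ≤ C) (ht : ∀ i, |t i| ≤ C) (h0 : Filter.Tendsto t Filter.cofinite (nhds 0)) :
    IsCompactOperator (diagOp b t hC ht) := by
  classical
  set F : Finset ι → X →L[ℂ] X := fun A =>
    ∑ i ∈ A, (t i : ℂ) • (innerSL ℂ (b i)).smulRight (b i)
  have hF : ∀ A, IsCompactOperator (F A) := by
    intro A
    have : F A ∈ compactOperator (RingHom.id ℂ) X X := by
      refine Submodule.sum_mem _ fun i _ => Submodule.smul_mem _ _ ?_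
      have h1 : IsCompactOperator (ContinuousLinearMap.toSpanSingleton ℂ (b i)) :=
        isCompactOperator_of_locallyCompactSpace_rng (ContinuousLinearMap.toSpanSingleton ℂ (b i))
      exact h1.comp_clm (innerSL ℂ (b i))
    exact this
  have hrepr : ∀ A u i, b.repr (F A u) i = if i ∈ A then (t i : ℂ) * b.repr u i else 0 := by
    intro A u i
    have : F A u = ∑ j ∈ A, ((t j : ℂ) * b.repr u j) • b j := by
      simp only [F, sum_apply, smul_apply,
        ContinuousLinearMap.smulRight_apply, innerSL_apply_apply, smul_smul, b.repr_apply_apply]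
    rw [this, map_sum]
    simp only [map_smul, b.repr_self, lp.coeFn_sum, Finset.sum_apply, lp.coeFn_smul,
      Pi.smul_apply, lp.single_apply, Pi.single_apply, smul_eq_mul, mul_ite, mul_one, mul_zero,
      Finset.sum_ite_eq]
  have hlim : Filter.Tendsto F Filter.atTop (nhds (diagOp b t hC ht)) := by
    rw [Metric.tendsto_atTop]
    intro ε hε
    have hfin := (Metric.tendsto_nhds.mp h0 (ε / 2) (by positivity))
    rw [Filter.eventually_cofinite] at hfin
    refine ⟨hfin.toFinset, fun A hA => ?_⟩
    rw [dist_eq_norm]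
    refine lt_of_le_of_lt (ContinuousLinearMap.opNorm_le_bound _ (by positivity : 0 ≤ ε / 2)
      fun u => ?_) (half_lt_self hε)
    refine norm_le_of_repr_le b (by positivity) fun i => ?_
    rw [sub_apply, map_sub, lp.coeFn_sub, Pi.sub_apply, hrepr, repr_diagOp]
    by_cases hi : i ∈ A
    · rw [if_pos hi, sub_self, norm_zero]; positivity
    · rw [if_neg hi, zero_sub, norm_neg, norm_mul, Complex.norm_real]
      have : i ∉ hfin.toFinset := fun h => hi (hA h)
      rw [Set.Finite.mem_toFinset, Set.mem_ofPred_eq, not_not, dist_zero_right] at this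
      gcongr
  exact isCompactOperator_of_tendsto hlim (Filter.Eventually.of_forall hF)

lemma half_norm_sq_le_re_inner {B : X →L[ℂ] X} (hB : ‖B‖ ≤ 1 / 2) (g : X) :
    ‖g‖ ^ 2 / 2 ≤ (inner ℂ g (g + B g)).re := by
  rw [inner_add_right, Complex.add_re, inner_self_eq_norm_sq_to_K]
  have h1 : |(inner ℂ g (B g) : ℂ).re| ≤ ‖g‖ * (1 / 2 * ‖g‖) :=
    (Complex.abs_re_le_norm _).trans ((norm_inner_le_norm _ _).trans
      (by gcongr; exact (B.le_opNorm g).trans (by gcongr)))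
  have h2 := (abs_le.mp h1).1
  have h3 : (((‖g‖ : ℝ) : ℂ) ^ 2).re = ‖g‖ ^ 2 := by norm_cast
  change _ ≤ (((‖g‖ : ℝ) : ℂ) ^ 2).re + _
  rw [h3]
  nlinarith

/-- Bessel's inequality in the inner product ⟨g, (1 + B)h⟩. The vector w = ∑ c_i f_i is the
projection of g for it: ⟨g, (1+B)w⟩, ⟨w, (1+B)w⟩ and ⟨w, (1+B)g⟩ all equal the left side, and
positivity at g - w gives the claim. -/
lemma sum_inv_mul_norm_inner_sq_le {T B : X →L[ℂ] X}
    (hTs : (T : X →ₗ[ℂ] X).IsSymmetric) (hBs : (B : X →ₗ[ℂ] X).IsSymmetric) (hB : ‖B‖ ≤ 1 / 2)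
    {κ : Type*} (e : HilbertBasis κ ℂ X) {lam : κ → ℝ} {f : κ → X}
    (h : ∀ i, 0 < lam i ∧ T (f i) = e i ∧ f i + B (f i) = ((lam i)⁻¹ : ℂ) • T (e i))
    (g : X) (F : Finset κ) :
    ∑ i ∈ F, (lam i)⁻¹ * ‖(inner ℂ (e i) (T g) : ℂ)‖ ^ 2 ≤ (inner ℂ g (g + B g)).re := by
  have hTs' : ∀ u v, inner ℂ (T u) v = inner ℂ u (T v) := hTs
  have hBs' : ∀ u v, inner ℂ (B u) v = inner ℂ u (B v) := hBs
  set c : κ → ℂ := fun i => inner ℂ (e i) (T g)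
  set w := ∑ i ∈ F, c i • f i
  have hTw : T w = ∑ i ∈ F, c i • e i := by
    simp only [w, map_sum, map_smul, (h _).2.1]
  have hAw : w + B w = ∑ i ∈ F, c i • ((lam i)⁻¹ : ℂ) • T (e i) := by
    simp only [w, map_sum, map_smul, ← Finset.sum_add_distrib, ← smul_add, (h _).2.2]
  set S : ℝ := ∑ i ∈ F, (lam i)⁻¹ * ‖c i‖ ^ 2
  have h1 : inner ℂ g (w + B w) = (S : ℂ) := by
    rw [hAw, inner_sum]
    simp only [S]
    push_cast
    refine Finset.sum_congr rfl fun i _ => ?_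
    rw [inner_smul_right, inner_smul_right, ← hTs', ← inner_conj_symm]
    change c i * (_ * starRingEnd ℂ (c i)) = _
    rw [mul_left_comm, Complex.mul_conj, Complex.normSq_eq_norm_sq]
    push_cast
    rfl
  have h2 : inner ℂ w (w + B w) = (S : ℂ) := by
    rw [hAw, inner_sum]
    simp only [S]
    push_cast
    refine Finset.sum_congr rfl fun i hi => ?_
    rw [inner_smul_right, inner_smul_right, ← hTs', hTw, ← inner_conj_symm,
      e.orthonormal.inner_right_sum _ hi, mul_left_comm, Complex.mul_conj,
      Complex.normSq_eq_norm_sq]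
    push_cast
    rfl
  have h3 : inner ℂ w (g + B g) = (S : ℂ) := by
    have : inner ℂ w (g + B g) = inner ℂ (w + B w) g := by
      rw [inner_add_left, inner_add_right, hBs']
    rw [this, ← inner_conj_symm, h1, Complex.conj_ofReal]
  have h4 := half_norm_sq_le_re_inner hB (g - w)
  have h5 : g - w + B (g - w) = (g + B g) - (w + B w) := by
    rw [map_sub]; abel
  rw [h5, inner_sub_left, inner_sub_right, inner_sub_right, h1, h2, h3] at h4
  simp only [Complex.sub_re, Complex.ofReal_re] at h4
  nlinarith [sq_nonneg ‖g - w‖]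

variable [CompleteSpace X]

/-- Hilbert bases of the mutually orthogonal eigenspaces are glued; by the spectral theorem for
compact symmetric operators nothing is orthogonal to all of them. -/
lemma exists_eigenbasis {R : X →L[ℂ] X} (hc : IsCompactOperator R)
    (hs : (R : X →ₗ[ℂ] X).IsSymmetric) :
    ∃ (κ : Type u) (e : HilbertBasis κ ℂ X) (lam : κ → ℂ), ∀ i, R (e i) = lam i • e i := by
  -- Completeness of each eigenspace comes from closedness, because the kernel may have infinite
  -- dimension.
  have hcl : ∀ μ : ℂ, IsClosed (Module.End.eigenspace (R : X →ₗ[ℂ] X) μ : Set X) := by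
    intro μ
    have : (Module.End.eigenspace (R : X →ₗ[ℂ] X) μ : Set X) = {x | R x = μ • x} := by
      ext x
      simp
    rw [this]
    exact isClosed_eq R.continuous (continuous_const_smul μ)
  have hcomp : ∀ μ : ℂ, CompleteSpace (Module.End.eigenspace (R : X →ₗ[ℂ] X) μ) :=
    fun μ => (hcl μ).completeSpace_coe
  choose w b hb using fun μ : ℂ => exists_hilbertBasis ℂ (Module.End.eigenspace (R : X →ₗ[ℂ] X) μ)
  have ho : Orthonormal ℂ fun a : Σ μ : ℂ, w μ =>
      ((b a.1 a.2 : Module.End.eigenspace (R : X →ₗ[ℂ] X) a.1) : X) :=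
    hs.orthogonalFamily_eigenspaces.orthonormal_sigma_orthonormal fun μ => (b μ).orthonormal
  refine ⟨Σ μ : ℂ, w μ, HilbertBasis.mkOfOrthogonalEqBot ho ?_, fun a => a.1, fun a => ?_⟩
  · rw [Submodule.eq_bot_iff]
    intro u hu
    have h1 : u ∈ (⨆ μ, Module.End.eigenspace (R : X →ₗ[ℂ] X) μ)ᗮ := by
      rw [← Submodule.iInf_orthogonal, Submodule.mem_iInf]
      intro μ
      rw [Submodule.mem_orthogonal]
      intro x hx
      have h2 := (b μ).hasSum_repr ⟨x, hx⟩
      have h3 := ((h2.mapL (Submodule.subtypeL _)).mapL (innerSL ℂ u))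
      have h4 : ∀ i, (innerSL ℂ u) ((Submodule.subtypeL _) ((b μ).repr ⟨x, hx⟩ i • (b μ) i)) = 0 := by
        intro i
        have h5 := (Submodule.mem_orthogonal' _ _).mp hu _ (Submodule.subset_span ⟨⟨μ, i⟩, rfl⟩)
        simp only [map_smul, innerSL_apply_apply, Submodule.subtypeL_apply, h5, smul_zero]
      simp only [h4] at h3
      have h6 := h3.unique hasSum_zero
      have h7 : inner ℂ u x = 0 := by simpa using h6
      rw [← inner_conj_symm, h7, map_zero]
    rw [ContinuousLinearMap.orthogonalComplement_iSup_eigenspaces_eq_bot hc hs] at h1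
    simpa using h1
  · rw [HilbertBasis.coe_mkOfOrthogonalEqBot]
    exact Module.End.mem_eigenspace_iff.mp (b a.1 a.2).2

/-- Existence of a complete system of eigenvectors for a form `⟨g, (1 + B) g⟩`, in the variable
`u = T g`, where `T` is compact. -/
lemma exists_form_eigenbasis {T B : X →L[ℂ] X} (hTc : IsCompactOperator T)
    (hTs : (T : X →ₗ[ℂ] X).IsSymmetric) (hTi : Function.Injective T)
    (hBs : (B : X →ₗ[ℂ] X).IsSymmetric) (hB : ‖B‖ ≤ 1 / 2) :
    ∃ (κ : Type u) (e : HilbertBasis κ ℂ X) (lam : κ → ℝ) (f : κ → X), ∀ i, 0 < lam i ∧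
      T (f i) = e i ∧ f i + B (f i) = ((lam i)⁻¹ : ℂ) • T (e i) := by
  -- J is the inverse of 1 + B, by the Neumann series.
  obtain ⟨J, hJ1, hJ2⟩ : ∃ J : X →L[ℂ] X, (∀ x, J x + B (J x) = x) ∧ ∀ x, J (x + B x) = x := by
    have hu : IsUnit (1 - (-B)) := isUnit_one_sub_of_norm_lt_one (by
      rw [norm_neg]; linarith)
    rw [sub_neg_eq_add] at hu
    obtain ⟨U, hU⟩ := hu
    refine ⟨(U⁻¹ : (X →L[ℂ] X)ˣ), fun x => ?_, fun x => ?_⟩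
    · have := congrArg (fun S : X →L[ℂ] X => S x) U.mul_inv
      rw [hU] at this
      simpa using this
    · have := congrArg (fun S : X →L[ℂ] X => S x) U.inv_mul
      rw [hU] at this
      simpa using this
  have hTs' : ∀ u v, inner ℂ (T u) v = inner ℂ u (T v) := hTs
  have hBs' : ∀ u v, inner ℂ (B u) v = inner ℂ u (B v) := hBs
  have hJs : ∀ u v, inner ℂ (J u) v = inner ℂ u (J v) := by
    intro u v
    conv_lhs => rw [← hJ1 v]
    conv_rhs => rw [← hJ1 u]
    rw [inner_add_left, inner_add_right, hBs']
  -- In the application this is the inverse of -Δ_L + V + M.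
  set R : X →L[ℂ] X := T ∘L J ∘L T
  have hRapp : ∀ u, R u = T (J (T u)) := fun u => rfl
  have hRc : IsCompactOperator R := hTc.comp_clm (J ∘L T)
  have hRs : (R : X →ₗ[ℂ] X).IsSymmetric := by
    intro u v
    simp only [ContinuousLinearMap.coe_coe, hRapp]
    rw [hTs', hJs, hTs']
  obtain ⟨κ, e, lam, he⟩ := exists_eigenbasis hRc hRs
  -- With h = J T e_i one has ⟨e_i, R e_i⟩ = ⟨(1 + B)h, h⟩, which is positive by coercivity, and h ≠
  -- 0 as T is injective.
  have hpos : ∀ i, 0 < (lam i).re ∧ ((lam i).re : ℂ) = lam i := by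
    intro i
    have hn : ‖e i‖ = 1 := e.orthonormal.1 i
    have h1 : inner ℂ (e i) (R (e i)) = lam i := by
      rw [he, inner_smul_right, inner_self_eq_norm_sq_to_K, hn]
      simp
    set h := J (T (e i)) with hh
    have h2 : inner ℂ (e i) (R (e i)) = inner ℂ (h + B h) h := by
      rw [hRapp, ← hTs', hh, hJ1]
    have h3 : inner ℂ (h + B h) h = inner ℂ h (h + B h) := by
      rw [inner_add_left, inner_add_right, hBs']
    have hne : h ≠ 0 := by
      intro h0
      have h4 : T (e i) = 0 := by rw [← hJ1 (T (e i)), ← hh, h0]; simp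
      have h5 : e i = 0 := hTi (by rw [h4, map_zero])
      rw [h5, norm_zero] at hn
      exact zero_ne_one hn
    have h6 := half_norm_sq_le_re_inner hB h
    rw [← h3, ← h2, h1] at h6
    refine ⟨lt_of_lt_of_le (by positivity) h6, ?_⟩
    have h7 : starRingEnd ℂ (lam i) = lam i := by
      rw [← h1, inner_conj_symm]
      exact hRs (e i) (e i)
    exact Complex.conj_eq_iff_re.mp h7
  refine ⟨κ, e, fun i => (lam i).re, fun i => (lam i)⁻¹ • J (T (e i)), fun i => ?_⟩
  obtain ⟨hp, hre⟩ := hpos i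
  have hne : lam i ≠ 0 := by
    rw [← hre]; exact_mod_cast hp.ne'
  refine ⟨hp, ?_, ?_⟩
  · rw [map_smul, ← hRapp, he, smul_smul, inv_mul_cancel₀ hne, one_smul]
  · rw [map_smul, ← smul_add, hJ1, hre]

end Abstract

/-! ### The trace of the negative part and orthonormal families of eigenfunctions -/

section Trace

variable {d q : ℕ} {L : ℝ} {V : EuclideanSpace ℝ (Fin d) → ℝ}

lemma energyForm_conj (u v : BoxL2 d q L) :
    starRingEnd ℂ (energyForm V u v) = energyForm V v u := by
  unfold energyForm
  rw [map_add, ← integral_conj, Complex.conj_tsum]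
  congr 1
  · refine tsum_congr fun k => ?_
    rw [map_mul, Complex.conj_ofReal, inner_conj_symm]
  · refine integral_congr_ae (Filter.Eventually.of_forall fun x => ?_)
    simp only [map_mul, Complex.conj_ofReal, inner_conj_symm]

lemma mem_eigenspace_iff {E : ℝ} {u : BoxL2 d q L} : u ∈ eigenspace d q L V E ↔
    InFormDomain V u ∧ ∀ v, InFormDomain V v → energyForm V v u = (E : ℂ) * inner ℂ v u := by
  rw [← forall₂_congr fun v (_ : InFormDomain V v) => by
    rw [← inner_smul_right (𝕜 := ℂ) v u (E : ℂ)]]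
  rfl

lemma inner_eq_zero_of_mem_eigenspace {E E' : ℝ} (h : E ≠ E') {u v : BoxL2 d q L}
    (hu : u ∈ eigenspace d q L V E) (hv : v ∈ eigenspace d q L V E') : inner ℂ u v = 0 := by
  rw [mem_eigenspace_iff] at hu hv
  have h1 := hu.2 v hv.1
  have h2 := hv.2 u hu.1
  rw [← energyForm_conj, h1, map_mul, Complex.conj_ofReal, inner_conj_symm] at h2
  have h3 : ((E - E' : ℝ) : ℂ) * inner ℂ u v = 0 := by
    push_cast; linear_combination h2
  exact (mul_eq_zero.mp h3).resolve_left (by exact_mod_cast sub_ne_zero.mpr h)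

lemma exists_orthonormal_of_le_rank {X : Type*} [NormedAddCommGroup X] [InnerProductSpace ℂ X]
    {W : Submodule ℂ X} {n : ℕ} (h : (n : ℕ∞) ≤ (Module.rank ℂ W).toENat) :
    ∃ v : Fin n → W, Orthonormal ℂ v := by
  rw [Cardinal.natCast_le_toENat, Module.le_rank_iff] at h
  obtain ⟨v, hv⟩ := h
  exact ⟨_, InnerProductSpace.gramSchmidtNormed_orthonormal hv⟩

/-- Exhausts a multiplicity that may be infinite by finite ones, so that the trace can be tested on
finite families. -/
lemma enat_eq_iSup_min (r : ℕ∞) :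
    (r : ℝ≥0∞) = ⨆ n : ℕ, (((min r n).toNat : ℕ) : ℝ≥0∞) := by
  apply le_antisymm
  · induction r using ENat.recTopCoe with
    | top => simp [ENNReal.iSup_natCast]
    | coe k => exact le_iSup_of_le k (by simp)
  · refine iSup_le fun n => ?_
    have h1 : ((min r n).toNat : ℕ∞) ≤ r :=
      (ENat.natCast_toNat (ne_top_of_le_ne_top (ENat.natCast_ne_top n) (min_le_right r n))).le.trans
        (min_le_left _ _)
    exact_mod_cast h1

/-- An upper bound for sums over finite orthonormal families of eigenfunctions is a bound for the
trace. -/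
lemma traceNeg_le {μ C : ℝ} (h : ∀ (J : Type) [Fintype J] (ψ : J → BoxL2 d q L) (E : J → ℝ),
    Orthonormal ℂ ψ → (∀ j, ψ j ∈ eigenspace d q L V (E j)) → (∀ j, E j < μ) →
      ∑ j, (μ - E j) ≤ C) :
    traceNeg d q L V μ ≤ ENNReal.ofReal C := by
  classical
  unfold traceNeg
  rw [ENNReal.tsum_eq_iSup_sum]
  refine iSup_le fun s => ?_
  set r : ℝ → ℕ∞ := fun E => (Module.rank ℂ (eigenspace d q L V E)).toENat
  have h1 : ∀ E ∈ s, ENNReal.ofReal (E - μ)⁻ * (r E : ℝ≥0∞) =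
      ⨆ n : ℕ, ENNReal.ofReal (E - μ)⁻ * (((min (r E) n).toNat : ℕ) : ℝ≥0∞) := fun E _ => by
    rw [enat_eq_iSup_min, ENNReal.mul_iSup]
  have hmono : ∀ E, Monotone fun n : ℕ =>
      ENNReal.ofReal (E - μ)⁻ * (((min (r E) n).toNat : ℕ) : ℝ≥0∞) := by
    intro E a b hab
    have : (min (r E) a).toNat ≤ (min (r E) b).toNat :=
      ENat.toNat_le_toNat (min_le_min_left _ (by exact_mod_cast hab))
        (ne_top_of_le_ne_top (ENat.natCast_ne_top b) (min_le_right _ _))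
    simp only
    gcongr
  rw [Finset.sum_congr rfl h1, ENNReal.finsetSum_iSup_of_monotone hmono]
  refine iSup_le fun n => ?_
  -- From each of finitely many eigenspaces take at most n orthonormal vectors; different
  -- eigenspaces are orthogonal, so together they form one orthonormal family.
  set N : ℝ → ℕ := fun E => (min (r E) n).toNat
  have hN : ∀ E, (N E : ℕ∞) ≤ r E := fun E =>
    (ENat.natCast_toNat (ne_top_of_le_ne_top (ENat.natCast_ne_top n) (min_le_right (r E) n))).le.trans
        (min_le_left _ _)
  choose v hv using fun E => exists_orthonormal_of_le_rank (hN E)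
  set t := s.filter (· < μ)
  have hfam := h (Σ E : t, Fin (N E)) (fun a => (v a.1 a.2 : BoxL2 d q L)) (fun a => a.1) ?_
    (fun a => (v a.1 a.2).2) (fun a => (Finset.mem_filter.mp a.1.2).2)
  · rw [Fintype.sum_sigma] at hfam
    simp only [Finset.sum_const, Finset.card_univ, Fintype.card_fin, nsmul_eq_mul] at hfam
    rw [Finset.sum_coe_sort t (fun E => (N E : ℝ) * (μ - E))] at hfam
    have h2 : ∑ E ∈ s, ENNReal.ofReal (E - μ)⁻ * ((N E : ℕ) : ℝ≥0∞) =
        ENNReal.ofReal (∑ E ∈ t, (N E : ℝ) * (μ - E)) := by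
      rw [ENNReal.ofReal_sum_of_nonneg fun E hE => mul_nonneg (Nat.cast_nonneg _)
        (sub_nonneg.mpr (Finset.mem_filter.mp hE).2.le), Finset.sum_filter]
      refine Finset.sum_congr rfl fun E _ => ?_
      split_ifs with hE
      · rw [negPart_of_nonpos (by linarith), ENNReal.ofReal_mul (Nat.cast_nonneg _),
          ENNReal.ofReal_natCast, neg_sub, mul_comm]
      · rw [negPart_of_nonneg (by linarith)]
        simp
    rw [h2]
    exact ENNReal.ofReal_le_ofReal hfam
  · constructor
    · rintro ⟨E, i⟩
      exact (hv E).1 i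
    · rintro ⟨E, i⟩ ⟨E', j⟩ hne
      by_cases hE : E = E'
      · subst hE
        exact (hv E).2 (i := i) (j := j) fun hij => hne (by rw [hij])
      · exact inner_eq_zero_of_mem_eigenspace (fun h => hE (Subtype.ext h)) (v E i).2 (v E' j).2

/-- Group the family by eigenvalue: each group is linearly independent in one eigenspace, so its
size is bounded by the multiplicity. Completeness plays no role. -/
lemma le_traceNeg {μ : ℝ} {κ : Type} {e : κ → BoxL2 d q L} {E : κ → ℝ} (he : Orthonormal ℂ e)
    (h : ∀ i, e i ∈ eigenspace d q L V (E i)) :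
    ∑' i, ENNReal.ofReal (E i - μ)⁻ ≤ traceNeg d q L V μ := by
  unfold traceNeg
  rw [← ENNReal.tsum_fiberwise _ E]
  refine ENNReal.tsum_le_tsum fun x => ?_
  have h1 : ∀ b : E ⁻¹' {x}, ENNReal.ofReal (E b - μ)⁻ = ENNReal.ofReal (x - μ)⁻ := by
    rintro ⟨b, hb⟩
    have : E b = x := hb
    simp only [this]
  simp only [h1]
  rw [ENNReal.tsum_eq_iSup_sum]
  refine iSup_le fun s => ?_
  rw [Finset.sum_const, nsmul_eq_mul, mul_comm]
  gcongr
  have h2 : LinearIndependent ℂ fun b : s =>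
      (⟨e b.1, by have := h b.1; rwa [show E b.1 = x from b.1.2] at this⟩ :
        eigenspace d q L V x) := by
    refine LinearIndependent.of_comp (Submodule.subtype _) ?_
    exact (he.comp (fun b : s => (b.1 : κ)) fun a b hab =>
      Subtype.ext (Subtype.ext hab)).linearIndependent
  have h3 := h2.cardinal_le_rank
  rw [Cardinal.mk_coe_finset, ← Cardinal.natCast_le_toENat] at h3
  exact_mod_cast h3

end Trace

/-! ### Relative form boundedness of the potential -/

section FormBound

variable {m q : ℕ} {L : ℝ} {V : EuclideanSpace ℝ (Fin (m + 2)) → ℝ}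

lemma momentumSq_eq (d : ℕ) (L : ℝ) (k : Fin d → ℤ) :
    momentumSq d L k = (2 * Real.pi / L) ^ 2 * ‖latticePoint k‖ ^ 2 := by
  rw [momentumSq, norm_latticePoint_sq]

/-- The exponent `1 + d / 2` for `d = m + 2`. -/
abbrev critExp (m : ℕ) : ℝ := 1 + ((m + 2 : ℕ) : ℝ) / 2

lemma critExp_toReal (m : ℕ) : (1 + ((m + 2 : ℕ) : ℝ≥0∞) / 2).toReal = critExp m := by
  rw [ENNReal.toReal_add (by simp) (ENNReal.div_ne_top (by simp) (by simp)), ENNReal.toReal_div,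
    ENNReal.toReal_natCast, ENNReal.toReal_one, ENNReal.toReal_ofNat]

lemma integrable_abs_rpow (hV : MemLp V (1 + ((m + 2 : ℕ) : ℝ≥0∞) / 2) (boxMeasure (m + 2) L)) :
    Integrable (fun x => |V x| ^ critExp m) (boxMeasure (m + 2) L) := by
  have h := hV.integrable_norm_rpow (by simp) (ENNReal.add_ne_top.mpr
    ⟨by simp, ENNReal.div_ne_top (by simp) (by simp)⟩)
  simpa only [critExp_toReal, Real.norm_eq_abs] using h

/-- One place where d ≥ 2 enters: on the bounded box V is then square integrable, as the cross term
needs. -/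
lemma two_le_critExp (m : ℕ) : (2 : ℝ≥0∞) ≤ 1 + ((m + 2 : ℕ) : ℝ≥0∞) / 2 := by
  have h1 : (1 : ℝ≥0∞) ≤ ((m + 2 : ℕ) : ℝ≥0∞) / 2 := by
    rw [ENNReal.le_div_iff_mul_le (by simp) (by simp), one_mul]
    exact_mod_cast (by omega : 2 ≤ m + 2)
  calc (2 : ℝ≥0∞) = 1 + 1 := by norm_num
    _ ≤ _ := by gcongr

lemma memLp_two_of_memLp
    (hV : MemLp V (1 + ((m + 2 : ℕ) : ℝ≥0∞) / 2) (boxMeasure (m + 2) L)) :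
    MemLp V 2 (boxMeasure (m + 2) L) := hV.mono_exponent (two_le_critExp m)

lemma integrable_of_memLp
    (hV : MemLp V (1 + ((m + 2 : ℕ) : ℝ≥0∞) / 2) (boxMeasure (m + 2) L)) :
    Integrable V (boxMeasure (m + 2) L) := (memLp_two_of_memLp hV).integrable (by norm_num)

/-- The layer-cake bound with the plain kinetic energy as weight and c = 4, so that half of the
kinetic energy is spent. The number of modes below e grows like 1 + e^{d/2}, and |V|(1 + |V|^{d/2})
is integrable, so the rest is a finite constant K. -/
lemma exists_lintegral_modeDensity_le (hL : 0 < L)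
    (hV : MemLp V (1 + ((m + 2 : ℕ) : ℝ≥0∞) / 2) (boxMeasure (m + 2) L)) :
    ∃ K : ℝ, 0 ≤ K ∧ ∀ (Γ : BoxL2 (m + 2) q L →L[ℂ] ℂ), (∀ v, ‖Γ v‖ ≤ ‖v‖) →
      ∀ A : Finset (Fin (m + 2) → ℤ),
      ∫⁻ x, ENNReal.ofReal (|V x| * modeDensity Γ A x) ∂(boxMeasure (m + 2) L) ≤
        ENNReal.ofReal (1 / 2 * ∑ p ∈ A, momentumSq (m + 2) L p *
          ∑ s : Fin q, ‖Γ (planeWave (m + 2) q L (p, s))‖ ^ 2) + ENNReal.ofReal K := by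
  obtain ⟨C, hC, hcard⟩ := card_ball_le m
  set a := L / (2 * Real.pi)
  have ha : 0 < a := by positivity
  set g : ℝ → ℝ := fun e => C * (1 + a * √e) ^ (m + 2)
  set G : EuclideanSpace ℝ (Fin (m + 2)) → ℝ :=
    fun x => 2 * q * (|V x| * (g (4 * |V x|) * (L ^ (m + 2))⁻¹))
  have hG0 : ∀ x, 0 ≤ G x := fun x => by positivity
  have hGi : Integrable G (boxMeasure (m + 2) L) := by
    have h1 := (integrable_of_memLp hV).abs
    have h2 := integrable_abs_rpow hV
    refine (((h1.add (h2.const_mul ((2 * a) ^ (m + 2)))).const_mul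
      (2 * q * C * 2 ^ (m + 1) * (L ^ (m + 2))⁻¹)).mono' ?_
      (Filter.Eventually.of_forall fun x => ?_))
    · have hVm := hV.1.aemeasurable
      exact (by fun_prop : AEMeasurable G (boxMeasure (m + 2) L)).aestronglyMeasurable
    · rw [Real.norm_of_nonneg (hG0 x)]
      set v := |V x|
      have hv : 0 ≤ v := abs_nonneg _
      have e1 : √(4 * v) = 2 * √v := by
        rw [Real.sqrt_mul (by norm_num), show (4 : ℝ) = 2 ^ 2 by norm_num,
          Real.sqrt_sq (by norm_num)]
      have e2 : v * √v ^ (m + 2) = v ^ critExp m := by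
        rw [critExp, Real.rpow_add_of_nonneg hv (by norm_num) (by positivity), Real.rpow_one,
          Real.sqrt_eq_rpow, ← Real.rpow_natCast, ← Real.rpow_mul hv]
        congr 2
        ring
      have h3 : (1 + a * √(4 * v)) ^ (m + 2) ≤
          2 ^ (m + 1) * (1 + (2 * a) ^ (m + 2) * √v ^ (m + 2)) := by
        have := add_pow_le (zero_le_one (α := ℝ)) (by positivity : 0 ≤ a * √(4 * v)) (m + 2)
        rw [e1] at this ⊢
        rw [one_pow] at this
        refine this.trans_eq ?_
        rw [← mul_pow, show m + 2 - 1 = m + 1 by omega]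
        ring
      calc G x ≤ 2 * q * (v * (C * (2 ^ (m + 1) * (1 + (2 * a) ^ (m + 2) * √v ^ (m + 2))) *
            (L ^ (m + 2))⁻¹)) := by
            simp only [G, g]
            gcongr
        _ = 2 * q * C * 2 ^ (m + 1) * (L ^ (m + 2))⁻¹ *
            (v + (2 * a) ^ (m + 2) * (v * √v ^ (m + 2))) := by ring
        _ = _ := by rw [e2]; rfl
  refine ⟨∫ x, G x ∂(boxMeasure (m + 2) L), integral_nonneg hG0, fun Γ hΓ A => ?_⟩
  have h := lintegral_mul_modeDensity_le hL hΓ A (w := momentumSq (m + 2) L)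
    (momentumSq_nonneg (m + 2) L) (g := g) (fun e e' he hee' => ?_) V (c := 4) (by norm_num)
  · rw [ofReal_integral_eq_lintegral_ofReal hGi (Filter.Eventually.of_forall hG0)]
    rw [show (2 : ℝ) / 4 = 1 / 2 by norm_num] at h
    exact h
  · refine (hcard (a * √e') _ (by positivity) fun k hk => ?_)
    have h1 := (Finset.mem_filter.mp hk).2.trans hee'
    rw [momentumSq_eq] at h1
    have h2 : ‖latticePoint k‖ = a * √((2 * Real.pi / L) ^ 2 * ‖latticePoint k‖ ^ 2) := by
      rw [← mul_pow, Real.sqrt_sq (by positivity)]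
      simp only [a]
      field_simp
    rw [h2]
    gcongr

lemma coeFn_sum_planeWave {d : ℕ} (S : Finset ((Fin d → ℤ) × Fin q))
    (c : (Fin d → ℤ) × Fin q → ℂ) :
    ⇑(∑ i ∈ S, c i • planeWave d q L i) =ᵐ[boxMeasure d L] fun x =>
      ∑ i ∈ S, c i • starRingEnd ℂ (planeWaveConj d L i.1 x) •
        EuclideanSpace.single i.2 (1 : ℂ) := by
  classical
  induction S using Finset.induction_on with
  | empty =>
    simp only [Finset.sum_empty]
    exact Lp.coeFn_zero _ _ _
  | insert i S hi ih =>
    simp only [Finset.sum_insert hi]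
    filter_upwards [Lp.coeFn_add (c i • planeWave d q L i) (∑ i ∈ S, c i • planeWave d q L i), ih,
      Lp.coeFn_smul (c i) (planeWave d q L i),
      (memLp_planeWave d L i.1 (EuclideanSpace.single i.2 (1 : ℂ))).coeFn_toLp] with x h1 h2 h3 h4
    rw [h1, Pi.add_apply, h2, h3, Pi.smul_apply, planeWave, h4]

/-- The projection of `u` to the modes in `A`. -/
def truncate {d : ℕ} (A : Finset (Fin d → ℤ)) (u : BoxL2 d q L) : BoxL2 d q L :=
  ∑ i ∈ A ×ˢ Finset.univ, (inner ℂ (planeWave d q L i) u : ℂ) • planeWave d q L i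

lemma coeFn_truncate {d : ℕ} (A : Finset (Fin d → ℤ)) (u : BoxL2 d q L) :
    ∀ᵐ x ∂(boxMeasure d L), ∀ s, truncate A u x s = inner ℂ (kernelVec d q L A s x) u := by
  filter_upwards [coeFn_sum_planeWave (L := L) (A ×ˢ (Finset.univ : Finset (Fin q)))
    fun i => (inner ℂ (planeWave d q L i) u : ℂ)] with x hx s
  rw [truncate, hx, Finset.sum_product, kernelVec, sum_inner, WithLp.ofLp_sum, Finset.sum_apply]
  refine Finset.sum_congr rfl fun p _ => ?_
  rw [WithLp.ofLp_sum, Finset.sum_apply, inner_smul_left]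
  simp [mul_comm]

lemma norm_truncate_sq {d : ℕ} (A : Finset (Fin d → ℤ)) (u : BoxL2 d q L) :
    (fun x => ‖truncate A u x‖ ^ 2) =ᵐ[boxMeasure d L] modeDensity (innerSL ℂ u) A := by
  filter_upwards [coeFn_truncate A u] with x hx
  rw [EuclideanSpace.norm_sq_eq, modeDensity]
  refine Finset.sum_congr rfl fun s _ => ?_
  rw [hx s, innerSL_apply_apply, norm_inner_symm]

lemma tendsto_truncate {d : ℕ} (hL : 0 < L) (u : BoxL2 d q L) :
    Filter.Tendsto (fun A => truncate A u) Filter.atTop (nhds u) := by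
  have h := (planeWaveBasis d q hL).hasSum_repr u
  have h2 : Filter.Tendsto (fun A : Finset (Fin d → ℤ) => A ×ˢ (Finset.univ : Finset (Fin q)))
      Filter.atTop Filter.atTop := by
    refine Filter.tendsto_atTop_finset_of_monotone (fun A B hAB => ?_) fun i => ⟨{i.1}, by simp⟩
    exact Finset.product_subset_product_left hAB
  refine (h.comp h2).congr fun A => ?_
  simp only [Function.comp_apply, truncate, HilbertBasis.repr_apply_apply, coe_planeWaveBasis]

lemma norm_fourierCoeff_sq {d : ℕ} (u : BoxL2 d q L) (k : Fin d → ℤ) :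
    ‖fourierCoeff u k‖ ^ 2 = ∑ s : Fin q, ‖(inner ℂ (planeWave d q L (k, s)) u : ℂ)‖ ^ 2 := by
  rw [EuclideanSpace.norm_sq_eq]
  simp only [inner_planeWave]

/-- Relative form boundedness of `V` with respect to the Laplacian. -/
lemma exists_form_bound (hL : 0 < L)
    (hV : MemLp V (1 + ((m + 2 : ℕ) : ℝ≥0∞) / 2) (boxMeasure (m + 2) L)) :
    ∃ K : ℝ, 0 ≤ K ∧ ∀ u : BoxL2 (m + 2) q L,
      Summable (fun k => momentumSq (m + 2) L k * ‖fourierCoeff u k‖ ^ 2) →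
      InFormDomain V u ∧ ∫ x, |V x| * ‖u x‖ ^ 2 ∂(boxMeasure (m + 2) L) ≤
        1 / 2 * ∑' k, momentumSq (m + 2) L k * ‖fourierCoeff u k‖ ^ 2 + K * ‖u‖ ^ 2 := by
  obtain ⟨K, hK, hb⟩ := exists_lintegral_modeDensity_le (q := q) hL hV
  refine ⟨K, hK, fun u hu => ?_⟩
  set T := ∑' k, momentumSq (m + 2) L k * ‖fourierCoeff u k‖ ^ 2
  have hterm : ∀ k, 0 ≤ momentumSq (m + 2) L k * ‖fourierCoeff u k‖ ^ 2 := fun k =>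
    mul_nonneg (momentumSq_nonneg _ _ _) (sq_nonneg _)
  have hT : 0 ≤ T := tsum_nonneg hterm
  have key : ∫⁻ x, ENNReal.ofReal (|V x| * ‖u x‖ ^ 2) ∂(boxMeasure (m + 2) L) ≤
      ENNReal.ofReal (1 / 2 * T + K * ‖u‖ ^ 2) := by
    rcases eq_or_ne u 0 with rfl | hu0
    · have : ∀ᵐ x ∂(boxMeasure (m + 2) L),
          ENNReal.ofReal (|V x| * ‖(0 : BoxL2 (m + 2) q L) x‖ ^ 2) = 0 := by
        filter_upwards [Lp.coeFn_zero (EuclideanSpace ℂ (Fin q)) 2 (boxMeasure (m + 2) L)] with x hx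
        rw [hx]; simp
      rw [lintegral_congr_ae this]
      simp
    set r := ‖u‖
    have hr : 0 < r := norm_pos_iff.mpr hu0
    -- The bound is known for finitely many modes. Along a sequence of truncations converging almost
    -- everywhere, Fatou's lemma passes it to u.
    obtain ⟨A, hA, hAe⟩ := (tendstoInMeasure_of_tendsto_Lp
      (tendsto_truncate hL u)).exists_seq_tendsto_ae'
    have hVm := hV.1.aemeasurable
    set Γ : BoxL2 (m + 2) q L →L[ℂ] ℂ := ((r : ℂ)⁻¹) • innerSL ℂ u
    have hΓ : ∀ v, ‖Γ v‖ ≤ ‖v‖ := by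
      intro v
      have : Γ v = (r : ℂ)⁻¹ * inner ℂ u v := rfl
      rw [this, norm_mul, norm_inv, Complex.norm_real, Real.norm_of_nonneg hr.le,
        inv_mul_le_iff₀ hr]
      exact norm_inner_le_norm u v
    have hΓs : ∀ v, ‖(innerSL ℂ u) v‖ ^ 2 = r ^ 2 * ‖Γ v‖ ^ 2 := by
      intro v
      have : Γ v = (r : ℂ)⁻¹ * (innerSL ℂ u) v := rfl
      rw [this, norm_mul, norm_inv, Complex.norm_real, Real.norm_of_nonneg hr.le]
      field_simp
    have hAn : ∀ n, ∫⁻ x, ENNReal.ofReal (|V x| * ‖truncate (A n) u x‖ ^ 2)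
        ∂(boxMeasure (m + 2) L) ≤ ENNReal.ofReal (1 / 2 * T + K * r ^ 2) := by
      intro n
      have e1 : ∫⁻ x, ENNReal.ofReal (|V x| * ‖truncate (A n) u x‖ ^ 2) ∂(boxMeasure (m + 2) L) =
          ENNReal.ofReal (r ^ 2) *
            ∫⁻ x, ENNReal.ofReal (|V x| * modeDensity Γ (A n) x) ∂(boxMeasure (m + 2) L) := by
        rw [← lintegral_const_mul'' (f := fun x => ENNReal.ofReal (|V x| * modeDensity Γ (A n) x)) _
          ((hVm.abs.mul (continuous_modeDensity Γ (A n)).aemeasurable).ennreal_ofReal)]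
        refine lintegral_congr_ae ?_
        filter_upwards [norm_truncate_sq (A n) u] with x hx
        rw [hx, ← ENNReal.ofReal_mul (by positivity)]
        congr 1
        simp only [modeDensity, hΓs, ← Finset.mul_sum]
        ring
      rw [e1]
      refine (mul_le_mul_right (hb Γ hΓ (A n)) _).trans ?_
      have h0 : 0 ≤ ∑ p ∈ A n, momentumSq (m + 2) L p *
          ∑ s : Fin q, ‖Γ (planeWave (m + 2) q L (p, s))‖ ^ 2 :=
        Finset.sum_nonneg fun p _ => mul_nonneg (momentumSq_nonneg _ _ _)
          (Finset.sum_nonneg fun _ _ => sq_nonneg _)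
      rw [← ENNReal.ofReal_add (by positivity) hK, ← ENNReal.ofReal_mul (by positivity)]
      apply ENNReal.ofReal_le_ofReal
      have h1 : r ^ 2 * ∑ p ∈ A n, momentumSq (m + 2) L p *
          ∑ s : Fin q, ‖Γ (planeWave (m + 2) q L (p, s))‖ ^ 2 ≤ T := by
        refine le_trans (le_of_eq ?_) (hu.sum_le_tsum (A n) fun k _ => hterm k)
        rw [Finset.mul_sum]
        refine Finset.sum_congr rfl fun p _ => ?_
        rw [norm_fourierCoeff_sq, mul_left_comm, Finset.mul_sum]
        simp only [← hΓs, innerSL_apply_apply, norm_inner_symm u]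
      nlinarith
    have hlim : ∀ᵐ x ∂(boxMeasure (m + 2) L), ENNReal.ofReal (|V x| * ‖u x‖ ^ 2) ≤
        Filter.liminf (fun n => ENNReal.ofReal (|V x| * ‖truncate (A n) u x‖ ^ 2))
          Filter.atTop := by
      filter_upwards [hAe] with x hx
      have h1 : Filter.Tendsto (fun n => ENNReal.ofReal (|V x| * ‖truncate (A n) u x‖ ^ 2))
          Filter.atTop (nhds (ENNReal.ofReal (|V x| * ‖u x‖ ^ 2))) :=
        ENNReal.tendsto_ofReal (((hx.norm).pow 2).const_mul _)
      exact h1.liminf_eq.ge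
    refine (lintegral_mono_ae hlim).trans ((lintegral_liminf_le' fun n => ?_).trans ?_)
    · exact (hVm.abs.mul ((Lp.aestronglyMeasurable _).norm.aemeasurable.pow_const 2)).ennreal_ofReal
    · refine (Filter.liminf_le_liminf (Filter.Eventually.of_forall hAn)).trans ?_
      simp
  have hi : Integrable (fun x => |V x| * ‖u x‖ ^ 2) (boxMeasure (m + 2) L) := by
    refine ⟨(hV.1.norm.mul ((Lp.aestronglyMeasurable u).norm.pow 2)), ?_⟩
    rw [hasFiniteIntegral_iff_ofReal (Filter.Eventually.of_forall fun x => by positivity)]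
    exact lt_of_le_of_lt key ENNReal.ofReal_lt_top
  refine ⟨⟨hu, ?_⟩, ?_⟩
  · refine hi.mono' (hV.1.mul ((Lp.aestronglyMeasurable u).norm.pow 2))
      (Filter.Eventually.of_forall fun x => ?_)
    simp
  · rw [integral_eq_lintegral_of_nonneg_ae (Filter.Eventually.of_forall fun x => by positivity) hi.1]
    exact ENNReal.toReal_le_of_le_ofReal (by positivity) key

end FormBound

/-! ### The form as a bounded perturbation, its eigenbasis and the variational principle -/

section FormRepresentation

lemma repr_planeWaveBasis {d q : ℕ} {L : ℝ} (hL : 0 < L) (u : BoxL2 d q L)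
    (i : (Fin d → ℤ) × Fin q) : (planeWaveBasis d q hL).repr u i = fourierCoeff u i.1 i.2 := by
  rw [HilbertBasis.repr_apply_apply, coe_planeWaveBasis, inner_planeWave]

lemma hasSum_inner_fourierCoeff {d q : ℕ} {L : ℝ} (hL : 0 < L) (u v : BoxL2 d q L) :
    HasSum (fun k => (inner ℂ (fourierCoeff u k) (fourierCoeff v k) : ℂ)) (inner ℂ u v) := by
  have h := (planeWaveBasis d q hL).hasSum_inner_mul_inner u v
  have h2 := h.prod_fiberwise (fun k => hasSum_fintype _)
  refine (congrArg (fun f => HasSum f _) (funext fun k => ?_)).mpr h2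
  rw [PiLp.inner_apply]
  refine Finset.sum_congr rfl fun s _ => ?_
  rw [coe_planeWaveBasis, ← inner_conj_symm u, inner_planeWave, inner_planeWave, RCLike.inner_apply,
    mul_comm]

lemma hasSum_norm_fourierCoeff_sq {d q : ℕ} {L : ℝ} (hL : 0 < L) (u : BoxL2 d q L) :
    HasSum (fun k => ‖fourierCoeff u k‖ ^ 2) (‖u‖ ^ 2) := by
  have h := hasSum_inner_fourierCoeff hL u u
  simp only [inner_self_eq_norm_sq_to_K] at h
  exact_mod_cast h

lemma tendsto_momentumSq {d : ℕ} (q : ℕ) {L : ℝ} (hL : 0 < L) :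
    Filter.Tendsto (fun i : (Fin d → ℤ) × Fin q => momentumSq d L i.1) Filter.cofinite
      Filter.atTop := by
  refine Filter.tendsto_atTop.mpr fun b => ?_
  rw [Filter.eventually_cofinite]
  refine ((finite_norm_latticePoint_le (L / (2 * Real.pi) * √b)).prod
    (Set.finite_univ (α := Fin q))).subset fun i hi => ⟨?_, trivial⟩
  have h1 : momentumSq d L i.1 ≤ b := (not_le.mp hi).le
  rw [momentumSq_eq] at h1
  have h2 : ‖latticePoint i.1‖ = L / (2 * Real.pi) *
      √((2 * Real.pi / L) ^ 2 * ‖latticePoint i.1‖ ^ 2) := by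
    rw [← mul_pow, Real.sqrt_sq (by positivity)]
    field_simp
  change ‖latticePoint i.1‖ ≤ _
  rw [h2]
  gcongr

variable {m q : ℕ} {L : ℝ} {V : EuclideanSpace ℝ (Fin (m + 2)) → ℝ}

/-- With `T = (-Δ_L + M)^{-1/2}`, the form of `-Δ_L + V + M` is `⟨f, g + B g⟩` on `T f`, `T g`,
for a symmetric `B` with `‖B‖ ≤ 1/2`. -/
lemma exists_form_representation (hL : 0 < L)
    (hV : MemLp V (1 + ((m + 2 : ℕ) : ℝ≥0∞) / 2) (boxMeasure (m + 2) L)) :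
    ∃ (M : ℝ) (T B : BoxL2 (m + 2) q L →L[ℂ] BoxL2 (m + 2) q L),
      IsCompactOperator T ∧ (T : BoxL2 (m + 2) q L →ₗ[ℂ] BoxL2 (m + 2) q L).IsSymmetric ∧
      Function.Injective T ∧
      (B : BoxL2 (m + 2) q L →ₗ[ℂ] BoxL2 (m + 2) q L).IsSymmetric ∧ ‖B‖ ≤ 1 / 2 ∧
      (∀ u, InFormDomain V u ↔ ∃ g, T g = u) ∧
      (∀ f g, energyForm V (T f) (T g) = inner ℂ f (g + B g) - M * inner ℂ (T f) (T g)) ∧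
      ∀ A f, truncate A (T f) = T (truncate A f) := by
  obtain ⟨K, hK, hform⟩ := exists_form_bound (q := q) hL hV
  -- Makes M/2 absorb K, so that ∫|V||Tf|² ≤ ‖f‖²/2, and makes |p|² + M ≥ 1, so that T is a
  -- contraction.
  set M := 2 * K + 1
  set b := planeWaveBasis (m + 2) q hL
  have hm := momentumSq_nonneg (m + 2) L
  have hmM : ∀ k, 0 < momentumSq (m + 2) L k + M := fun k => by have := hm k; positivity
  set τ : (Fin (m + 2) → ℤ) → ℝ := fun k => (√(momentumSq (m + 2) L k + M))⁻¹
  have hτ0 : ∀ k, 0 < τ k := fun k => inv_pos.mpr (Real.sqrt_pos.mpr (hmM k))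
  have hτ1 : ∀ k, (momentumSq (m + 2) L k + M) * τ k ^ 2 = 1 := fun k => by
    simp only [τ, inv_pow, Real.sq_sqrt (hmM k).le, mul_inv_cancel₀ (hmM k).ne']
  have hτ : ∀ i : (Fin (m + 2) → ℤ) × Fin q, |τ i.1| ≤ 1 := fun i => by
    rw [abs_of_pos (hτ0 _)]
    refine inv_le_one_of_one_le₀ (Real.one_le_sqrt.mpr ?_)
    have := hm i.1
    linarith
  set T := diagOp b (fun i => τ i.1) zero_le_one hτ
  have hTf : ∀ f k, fourierCoeff (T f) k = (τ k : ℂ) • fourierCoeff f k := by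
    intro f k
    ext s
    have h := repr_diagOp b (fun i => τ i.1) zero_le_one hτ f (k, s)
    rwa [repr_planeWaveBasis, repr_planeWaveBasis] at h
  have hTn : ∀ f k, ‖fourierCoeff (T f) k‖ ^ 2 = τ k ^ 2 * ‖fourierCoeff f k‖ ^ 2 := by
    intro f k
    rw [hTf, norm_smul, Complex.norm_real, mul_pow, Real.norm_eq_abs, sq_abs]
  have hkin : ∀ f k, momentumSq (m + 2) L k * ‖fourierCoeff (T f) k‖ ^ 2 =
      ‖fourierCoeff f k‖ ^ 2 - M * ‖fourierCoeff (T f) k‖ ^ 2 := by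
    intro f k
    rw [hTn]
    linear_combination (‖fourierCoeff f k‖ ^ 2) * hτ1 k
  have hkinS : ∀ f, HasSum (fun k => momentumSq (m + 2) L k * ‖fourierCoeff (T f) k‖ ^ 2)
      (‖f‖ ^ 2 - M * ‖T f‖ ^ 2) := by
    intro f
    simp only [hkin]
    exact (hasSum_norm_fourierCoeff_sq hL f).sub
      ((hasSum_norm_fourierCoeff_sq hL (T f)).mul_left M)
  have hdom : ∀ f, InFormDomain V (T f) := fun f => (hform _ (hkinS f).summable).1
  have hpot : ∀ f, ∫ x, |V x| * ‖T f x‖ ^ 2 ∂(boxMeasure (m + 2) L) ≤ 1 / 2 * ‖f‖ ^ 2 := by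
    intro f
    have h := (hform _ (hkinS f).summable).2
    rw [(hkinS f).tsum_eq] at h
    nlinarith [sq_nonneg ‖T f‖]
  have hkin2 : ∀ f g, ∑' k, (momentumSq (m + 2) L k : ℂ) *
      inner ℂ (fourierCoeff (T f) k) (fourierCoeff (T g) k) =
      inner ℂ f g - M * inner ℂ (T f) (T g) := by
    intro f g
    rw [← ((hasSum_inner_fourierCoeff hL f g).sub
      ((hasSum_inner_fourierCoeff hL (T f) (T g)).mul_left (M : ℂ))).tsum_eq]
    refine tsum_congr fun k => ?_
    simp only [hTf, inner_smul_left, inner_smul_right, Complex.conj_ofReal]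
    have h : ((momentumSq (m + 2) L k : ℂ) + M) * (τ k : ℂ) ^ 2 = 1 := by exact_mod_cast hτ1 k
    linear_combination (inner ℂ (fourierCoeff f k) (fourierCoeff g k) : ℂ) * h
  -- This is ∫ V⟨Tf, Tg⟩, written as a difference of known forms so that sesquilinearity and
  -- hermiticity are inherited.
  set S : BoxL2 (m + 2) q L → BoxL2 (m + 2) q L → ℂ := fun f g =>
    energyForm V (T f) (T g) - inner ℂ f g + M * inner ℂ (T f) (T g)
  have hSint : ∀ f g, S f g = ∫ x, (V x : ℂ) * inner ℂ (T f x) (T g x) ∂(boxMeasure (m + 2) L) := by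
    intro f g
    simp only [S, energyForm, hkin2]
    ring
  have hSconj : ∀ f g, starRingEnd ℂ (S f g) = S g f := by
    intro f g
    simp only [S, map_add, map_sub, map_mul, energyForm_conj, inner_conj_symm, Complex.conj_ofReal]
  have hSadd : ∀ f g g', S f (g + g') = S f g + S f g' := by
    intro f g g'
    simp only [S, map_add, energyForm_add (hdom f) (hdom g) (hdom g'), inner_add_right]
    ring
  have hSsmul : ∀ (c : ℂ) f g, S f (c • g) = c * S f g := by
    intro c f g
    simp only [S, map_smul, energyForm_smul, inner_smul_right]
    ring
  have hSadd' : ∀ f f' g, S (f + f') g = S f g + S f' g := by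
    intro f f' g
    rw [← hSconj g, hSadd, map_add, hSconj, hSconj]
  have hSsmul' : ∀ (c : ℂ) f g, S (c • f) g = starRingEnd ℂ c * S f g := by
    intro c f g
    rw [← hSconj g, hSsmul, map_mul, hSconj]
  have hSε : ∀ f g, ‖S f g‖ ≤ (‖f‖ ^ 2 + ‖g‖ ^ 2) / 4 := by
    intro f g
    rw [hSint]
    have hfi : ∀ f, Integrable (fun x => |V x| * ‖T f x‖ ^ 2) (boxMeasure (m + 2) L) := fun f => by
      refine (hdom f).2.norm.congr (Filter.Eventually.of_forall fun x => ?_)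
      simp
    calc ‖∫ x, (V x : ℂ) * inner ℂ (T f x) (T g x) ∂(boxMeasure (m + 2) L)‖
        ≤ ∫ x, 1 / 2 * (|V x| * ‖T f x‖ ^ 2 + |V x| * ‖T g x‖ ^ 2) ∂(boxMeasure (m + 2) L) := by
          refine norm_integral_le_of_norm_le (((hfi f).add (hfi g)).const_mul _)
            (Filter.Eventually.of_forall fun x => ?_)
          rw [norm_mul, Complex.norm_real, Real.norm_eq_abs, ← mul_add, mul_left_comm]
          refine mul_le_mul_of_nonneg_left ?_ (abs_nonneg _)
          have := norm_inner_le_norm (𝕜 := ℂ) (T f x) (T g x)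
          nlinarith [sq_nonneg (‖T f x‖ - ‖T g x‖)]
      _ ≤ _ := by
          rw [integral_const_mul, integral_add (hfi f) (hfi g)]
          linarith [hpot f, hpot g]
  have hSb : ∀ f g, ‖S f g‖ ≤ 1 / 2 * ‖f‖ * ‖g‖ := by
    intro f g
    rcases eq_or_ne f 0 with rfl | hf
    · have := hSsmul' 0 0 g
      simp only [zero_smul, map_zero, zero_mul] at this
      simp [this]
    rcases eq_or_ne g 0 with rfl | hg
    · have := hSsmul 0 f 0
      simp only [zero_smul, zero_mul] at this
      simp [this]
    have hf' := norm_pos_iff.mpr hf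
    have hg' := norm_pos_iff.mpr hg
    -- Normalising f and g turns the bound by (‖f‖² + ‖g‖²)/4 into one by the product ‖f‖‖g‖/2.
    have h := hSε ((‖f‖⁻¹ : ℂ) • f) ((‖g‖⁻¹ : ℂ) • g)
    rw [hSsmul, hSsmul', norm_smul, norm_smul, norm_mul, norm_mul] at h
    simp only [map_inv₀, Complex.conj_ofReal, norm_inv, Complex.norm_real, norm_norm,
      inv_mul_cancel₀ hf'.ne', inv_mul_cancel₀ hg'.ne'] at h
    rw [← mul_assoc, ← mul_inv, inv_mul_le_iff₀ (by positivity)] at h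
    linarith
  set Sl : BoxL2 (m + 2) q L →L⋆[ℂ] BoxL2 (m + 2) q L →L[ℂ] ℂ :=
    LinearMap.mkContinuous₂ (LinearMap.mk₂'ₛₗ (starRingEnd ℂ) (RingHom.id ℂ) S hSadd'
      (fun c f g => hSsmul' c f g) hSadd (fun c f g => hSsmul c f g)) (1 / 2) hSb
  set B := InnerProductSpace.continuousLinearMapOfBilin Sl
  have hBS : ∀ f g, inner ℂ (B f) g = S f g := fun f g =>
    InnerProductSpace.continuousLinearMapOfBilin_apply Sl f g
  have hBs : ∀ f g, inner ℂ (B f) g = inner ℂ f (B g) := fun f g => by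
    rw [hBS, ← hSconj, ← hBS, inner_conj_symm]
  refine ⟨M, T, B, isCompactOperator_diagOp _ _ _ _ ?_, isSymmetric_diagOp _ _ _ _,
    diagOp_injective _ _ _ _ fun i => (hτ0 i.1).ne', hBs, ?_, fun u => ⟨fun hu => ?_, ?_⟩, ?_, ?_⟩
  · exact tendsto_inv_atTop_zero.comp (Real.tendsto_sqrt_atTop.comp
      (Filter.tendsto_atTop_add_const_right _ M (tendsto_momentumSq q hL)))
  · refine B.opNorm_le_bound (by norm_num) fun f => ?_
    have h := hSb f (B f)
    rw [← hBS, inner_self_eq_norm_sq_to_K, norm_pow] at h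
    have h1 : ‖((‖B f‖ : ℝ) : ℂ)‖ = ‖B f‖ := by simp
    rcases (norm_nonneg (B f)).eq_or_lt' with h0 | h0
    · rw [h0]; positivity
    · refine le_of_mul_le_mul_right ?_ h0
      change ‖((‖B f‖ : ℝ) : ℂ)‖ ^ 2 ≤ _ at h
      rw [h1] at h
      nlinarith
  -- The preimage of u under T has coefficients û/τ; they are square summable because τ^{-2} = |p|²
  -- + M.
  · have hs : Summable fun i : (Fin (m + 2) → ℤ) × Fin q =>
        ‖(((τ i.1)⁻¹ : ℝ) : ℂ) * b.repr u i‖ ^ 2 := by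
      rw [summable_prod_of_nonneg fun i => by positivity]
      refine ⟨fun k => (hasSum_fintype _).summable, ?_⟩
      refine (hu.1.add ((hasSum_norm_fourierCoeff_sq hL u).summable.mul_left M)).congr fun k => ?_
      rw [tsum_fintype, EuclideanSpace.norm_sq_eq, ← add_mul, Finset.mul_sum]
      refine Finset.sum_congr rfl fun s _ => ?_
      rw [repr_planeWaveBasis, norm_mul, mul_pow, Complex.norm_real, Real.norm_eq_abs, sq_abs,
        inv_pow, ← eq_inv_of_mul_eq_one_left (hτ1 k)]
    refine ⟨b.repr.symm ⟨fun i => (((τ i.1)⁻¹ : ℝ) : ℂ) * b.repr u i,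
      memℓp_gen (by simpa using hs)⟩, b.repr.injective ?_⟩
    ext i
    rw [repr_diagOp, LinearIsometryEquiv.apply_symm_apply]
    have := (hτ0 i.1).ne'
    change (τ i.1 : ℂ) * ((((τ i.1)⁻¹ : ℝ) : ℂ) * b.repr u i) = _
    push_cast
    rw [mul_inv_cancel_left₀ (by exact_mod_cast this)]
  · rintro ⟨g, rfl⟩
    exact hdom g
  · intro f g
    rw [inner_add_right, ← hBs, hBS]
    simp only [S]
    ring
  · intro A f
    simp only [truncate, map_sum, map_smul]
    refine Finset.sum_congr rfl fun i _ => ?_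
    have hTs := isSymmetric_diagOp b (fun i => τ i.1) zero_le_one hτ (planeWave (m + 2) q L i) f
    have hTb : T (planeWave (m + 2) q L i) = (τ i.1 : ℂ) • planeWave (m + 2) q L i := by
      apply b.repr.injective
      ext j
      rw [repr_diagOp, ← congrFun (coe_planeWaveBasis (d := m + 2) (q := q) hL) i, map_smul]
      simp only [lp.coeFn_smul, Pi.smul_apply, smul_eq_mul]
      by_cases hij : j = i
      · rw [hij]
      · have h0 : b.repr (b i) j = 0 := by
          rw [HilbertBasis.repr_apply_apply]
          exact b.orthonormal.2 hij
        change (τ j.1 : ℂ) * b.repr (b i) j = τ i.1 * b.repr (b i) j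
        rw [h0, mul_zero, mul_zero]
    rw [hTb, smul_smul]
    congr 1
    change inner ℂ (T _) f = inner ℂ _ (T f) at hTs
    rw [← hTs, hTb, inner_smul_left, Complex.conj_ofReal, mul_comm]

/-- An orthonormal basis of eigenvectors, together with the Bessel inequality in the form. -/
lemma exists_eigenbasis_energyForm (hL : 0 < L)
    (hV : MemLp V (1 + ((m + 2 : ℕ) : ℝ≥0∞) / 2) (boxMeasure (m + 2) L)) :
    ∃ (M : ℝ) (κ : Type) (e : HilbertBasis κ ℂ (BoxL2 (m + 2) q L)) (E : κ → ℝ),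
      (∀ i, 0 < E i + M ∧ e i ∈ eigenspace (m + 2) q L V (E i)) ∧
      ∀ u, InFormDomain V u → ∀ F : Finset κ,
        ∑ i ∈ F, (E i + M) * ‖(inner ℂ (e i) u : ℂ)‖ ^ 2 ≤
          (energyForm V u u).re + M * ‖u‖ ^ 2 := by
  obtain ⟨M, T, B, hTc, hTs, hTi, hBs, hB, hdom, hE, -⟩ :=
    exists_form_representation (q := q) hL hV
  obtain ⟨κ, e, lam, f, h⟩ := exists_form_eigenbasis hTc hTs hTi hBs hB
  refine ⟨M, κ, e, fun i => (lam i)⁻¹ - M, fun i => ?_, fun u hu F => ?_⟩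
  · obtain ⟨h1, h2, h3⟩ := h i
    refine ⟨by simpa using h1, ?_⟩
    rw [mem_eigenspace_iff]
    refine ⟨(hdom _).mpr ⟨_, h2⟩, fun v hv => ?_⟩
    obtain ⟨g, rfl⟩ := (hdom v).mp hv
    have h4 : inner ℂ (T g) (e i) = inner ℂ g (T (e i)) := hTs g (e i)
    rw [← h2, hE, h3, inner_smul_right, h2, ← h4]
    push_cast
    ring
  · obtain ⟨g, rfl⟩ := (hdom u).mp hu
    have h1 := sum_inv_mul_norm_inner_sq_le hTs hBs hB e h g F
    have h2 : (energyForm V (T g) (T g)).re = (inner ℂ g (g + B g) : ℂ).re - M * ‖T g‖ ^ 2 := by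
      rw [hE, inner_self_eq_norm_sq_to_K, Complex.sub_re, Complex.re_ofReal_mul]
      congr 2
      norm_cast
    rw [h2]
    simp only [sub_add_cancel]
    exact h1

/-- Writing u = T g, the form is norm continuous in g, and T commutes with truncation because it is
diagonal. No convergence theorem for the potential term is needed. -/
lemma tendsto_energyForm_truncate (hL : 0 < L)
    (hV : MemLp V (1 + ((m + 2 : ℕ) : ℝ≥0∞) / 2) (boxMeasure (m + 2) L))
    {u : BoxL2 (m + 2) q L} (hu : InFormDomain V u) :
    Filter.Tendsto (fun A => energyForm V (truncate A u) (truncate A u)) Filter.atTop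
      (nhds (energyForm V u u)) := by
  obtain ⟨M, T, B, -, -, -, -, -, hdom, hE, hA⟩ := exists_form_representation (q := q) hL hV
  obtain ⟨g, rfl⟩ := (hdom u).mp hu
  simp only [hA, hE]
  have h : Continuous fun f : BoxL2 (m + 2) q L =>
      (inner ℂ f (f + B f) : ℂ) - M * inner ℂ (T f) (T f) := by fun_prop
  exact (h.tendsto g).comp (tendsto_truncate hL g)

/-- The variational principle: `tr(H - μ)_-` bounds `-∑ ⟨φ_l, (H - μ) φ_l⟩` for orthonormal
`φ_l`. -/
lemma sum_sub_energyForm_le {μ : ℝ} (hL : 0 < L)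
    (hV : MemLp V (1 + ((m + 2 : ℕ) : ℝ≥0∞) / 2) (boxMeasure (m + 2) L))
    (hfin : traceNeg (m + 2) q L V μ ≠ ⊤) {J : Type*} [Fintype J] {φ : J → BoxL2 (m + 2) q L}
    (hφ : Orthonormal ℂ φ) (hdom : ∀ j, InFormDomain V (φ j)) :
    ∑ j, (μ - (energyForm V (φ j) (φ j)).re) ≤ (traceNeg (m + 2) q L V μ).toReal := by
  obtain ⟨M, κ, e, E, he, hb⟩ := exists_eigenbasis_energyForm (q := q) hL hV
  have htr := le_traceNeg (μ := μ) e.orthonormal fun i => (he i).2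
  have hsum : Summable fun i => (E i - μ)⁻ := by
    have := ENNReal.summable_toReal (ne_top_of_le_ne_top hfin htr)
    refine this.congr fun i => ENNReal.toReal_ofReal (negPart_nonneg _)
  have htr' : ∑' i, (E i - μ)⁻ ≤ (traceNeg (m + 2) q L V μ).toReal := by
    refine (ENNReal.ofReal_le_iff_le_toReal hfin).mp ?_
    rw [ENNReal.ofReal_tsum_of_nonneg (fun i => negPart_nonneg _) hsum]
    exact htr
  refine le_trans ?_ htr'
  have hpar : ∀ j, HasSum (fun i => ‖(inner ℂ (e i) (φ j) : ℂ)‖ ^ 2) 1 := fun j => by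
    have h := hasSum_repr_sq e (φ j)
    simpa only [HilbertBasis.repr_apply_apply, hφ.1 j, one_pow] using h
  have hlow : ∀ j, Summable (fun i => (E i + M) * ‖(inner ℂ (e i) (φ j) : ℂ)‖ ^ 2) ∧
      ∑' i, (E i + M) * ‖(inner ℂ (e i) (φ j) : ℂ)‖ ^ 2 ≤ (energyForm V (φ j) (φ j)).re + M := by
    intro j
    have h1 : ∀ F : Finset κ, ∑ i ∈ F, (E i + M) * ‖(inner ℂ (e i) (φ j) : ℂ)‖ ^ 2 ≤
        (energyForm V (φ j) (φ j)).re + M := fun F => by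
      have := hb _ (hdom j) F
      rwa [hφ.1 j, one_pow, mul_one] at this
    have h0 : ∀ i, 0 ≤ (E i + M) * ‖(inner ℂ (e i) (φ j) : ℂ)‖ ^ 2 := fun i =>
      mul_nonneg (he i).1.le (sq_nonneg _)
    have hs := summable_of_sum_le h0 h1
    exact ⟨hs, hs.tsum_le_of_sum_le h1⟩
  have hj : ∀ j, HasSum (fun i => (μ - E i) * ‖(inner ℂ (e i) (φ j) : ℂ)‖ ^ 2)
      (μ + M - ∑' i, (E i + M) * ‖(inner ℂ (e i) (φ j) : ℂ)‖ ^ 2) := fun j => by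
    have h := ((hpar j).mul_left (μ + M)).sub (hlow j).1.hasSum
    rw [mul_one] at h
    refine (congrArg (fun f => HasSum f _) (funext fun i => ?_)).mpr h
    ring
  calc ∑ j, (μ - (energyForm V (φ j) (φ j)).re)
      ≤ ∑ j, (μ + M - ∑' i, (E i + M) * ‖(inner ℂ (e i) (φ j) : ℂ)‖ ^ 2) :=
        Finset.sum_le_sum fun j _ => by linarith [(hlow j).2]
    _ ≤ ∑' i, (E i - μ)⁻ := by
        refine hasSum_le (fun i => ?_) (hasSum_sum fun j _ => hj j) hsum.hasSum
        rw [← Finset.mul_sum]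
        -- Bessel for the trial family: the occupation of each e_i lies between 0 and 1, so it
        -- cannot collect more than (E_i - μ)₋.
        have hB : ∑ j, ‖(inner ℂ (e i) (φ j) : ℂ)‖ ^ 2 ≤ 1 := by
          have h := hφ.sum_inner_products_le (e i) (s := Finset.univ)
          rw [e.orthonormal.1 i, one_pow] at h
          exact (Finset.sum_le_sum fun j _ => (by rw [norm_inner_symm])).trans h
        have h0 : 0 ≤ ∑ j, ‖(inner ℂ (e i) (φ j) : ℂ)‖ ^ 2 :=
          Finset.sum_nonneg fun j _ => sq_nonneg _
        have h1 : μ - E i ≤ (E i - μ)⁻ := by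
          have := neg_le_negPart (E i - μ)
          linarith
        calc _ ≤ (E i - μ)⁻ * ∑ j, ‖(inner ℂ (e i) (φ j) : ℂ)‖ ^ 2 := by gcongr
          _ ≤ (E i - μ)⁻ * 1 := by
            gcongr
          _ = _ := mul_one _

end FormRepresentation

/-! ### The coupling between the inside and the outside of the Fermi ball -/

section CrossTerm

/-- The Fourier coefficients of a scalar function on the box. -/
def scalarCoeff (d : ℕ) (L : ℝ) (U : EuclideanSpace ℝ (Fin d) → ℝ) (k : Fin d → ℤ) : ℂ :=
  ∫ x, (U x : ℂ) * planeWaveConj d L k x ∂(boxMeasure d L)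

/-- Parseval on the box with a single spin component, applied to U as a vector of `BoxL2 d 1 L`. -/
lemma sum_norm_scalarCoeff_sq_le {d : ℕ} {L : ℝ} (hL : 0 < L) {U : EuclideanSpace ℝ (Fin d) → ℝ}
    (hU : MemLp U 2 (boxMeasure d L)) (G : Finset (Fin d → ℤ)) :
    ∑ k ∈ G, ‖scalarCoeff d L U k‖ ^ 2 ≤ ∫ x, U x ^ 2 ∂(boxMeasure d L) := by
  set z : EuclideanSpace ℂ (Fin 1) := EuclideanSpace.single 0 1
  have hz : ‖z‖ = 1 := by simp [z]
  have hUz : MemLp (fun x => (U x : ℂ) • z) 2 (boxMeasure d L) := by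
    refine MemLp.of_le hU ((Complex.continuous_ofReal.comp_aestronglyMeasurable hU.1).smul_const z)
      (Filter.Eventually.of_forall fun x => ?_)
    rw [norm_smul, hz, mul_one, Complex.norm_real]
  set u : BoxL2 d 1 L := hUz.toLp _
  have hu : ∀ᵐ x ∂(boxMeasure d L), u x = (U x : ℂ) • z := hUz.coeFn_toLp
  have hc : ∀ k, fourierCoeff u k = scalarCoeff d L U k • z := by
    intro k
    rw [fourierCoeff, scalarCoeff, ← integral_smul_const]
    refine integral_congr_ae ?_
    filter_upwards [hu] with x hx
    rw [hx, smul_smul, mul_comm]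
  have hn : ‖u‖ ^ 2 = ∫ x, U x ^ 2 ∂(boxMeasure d L) := by
    have h := L2.inner_def (𝕜 := ℂ) u u
    rw [inner_self_eq_norm_sq_to_K] at h
    have h2 : ∫ x, (inner ℂ (u x) (u x) : ℂ) ∂(boxMeasure d L) =
        ((∫ x, U x ^ 2 ∂(boxMeasure d L) : ℝ) : ℂ) := by
      rw [← integral_complex_ofReal]
      refine integral_congr_ae ?_
      filter_upwards [hu] with x hx
      rw [hx, inner_self_eq_norm_sq_to_K, norm_smul, hz, mul_one, Complex.norm_real]
      norm_cast
      rw [Real.norm_eq_abs, sq_abs]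
      rfl
    rw [h2] at h
    have h3 : ((‖u‖ ^ 2 : ℝ) : ℂ) = ((∫ x, U x ^ 2 ∂(boxMeasure d L) : ℝ) : ℂ) := by
      rw [← h]
      push_cast
      rfl
    exact Complex.ofReal_injective h3
  have h := (hasSum_norm_fourierCoeff_sq hL u).summable.sum_le_tsum G fun _ _ => sq_nonneg _
  rw [(hasSum_norm_fourierCoeff_sq hL u).tsum_eq, hn] at h
  simpa only [hc, norm_smul, hz, mul_one] using h

lemma conj_mul_planeWaveConj_eq {d : ℕ} {L : ℝ} (p r : Fin d → ℤ) (x : EuclideanSpace ℝ (Fin d)) :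
    starRingEnd ℂ (planeWaveConj d L p x) * planeWaveConj d L r x =
      ((L ^ (-(d : ℝ) / 2) : ℝ) : ℂ) * planeWaveConj d L (r - p) x := by
  simp only [planeWaveConj, map_mul, Complex.conj_ofReal, ← Complex.exp_conj, Complex.conj_I]
  rw [mul_mul_mul_comm, ← Complex.exp_add, mul_assoc]
  congr 3
  simp only [Pi.sub_apply, Int.cast_sub, sub_mul, Finset.sum_sub_distrib]
  push_cast
  ring

/-- Group the pairs (p, r) by the momentum transfer k = r - p: for each k the denominators add up to
a Lindhard sum, at most C, and the weights g k then sum to at most S. -/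
lemma sum_div_sub_le {m : ℕ} {C R a : ℝ} (hlind : ∀ (k : Fin (m + 2) → ℤ)
      (A : Finset (Fin (m + 2) → ℤ)), (∀ p ∈ A, ‖latticePoint p‖ ≤ R - a ∧
      R + a ≤ ‖latticePoint (p + k)‖) →
      ∑ p ∈ A, 1 / (‖latticePoint (p + k)‖ ^ 2 - ‖latticePoint p‖ ^ 2) ≤ C)
    {I O : Finset (Fin (m + 2) → ℤ)} (hI : ∀ p ∈ I, ‖latticePoint p‖ ≤ R - a)
    (hO : ∀ p ∈ O, R + a ≤ ‖latticePoint p‖) {g : (Fin (m + 2) → ℤ) → ℝ} (hg : ∀ k, 0 ≤ g k)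
    {S : ℝ} (hS : ∀ G : Finset (Fin (m + 2) → ℤ), ∑ k ∈ G, g k ≤ S) (hC : 0 ≤ C) :
    ∑ p ∈ I, ∑ r ∈ O, g (r - p) / (‖latticePoint r‖ ^ 2 - ‖latticePoint p‖ ^ 2) ≤ C * S := by
  classical
  rw [← Finset.sum_product']
  set G := (I ×ˢ O).image fun x => x.2 - x.1
  rw [← Finset.sum_fiberwise_of_maps_to (s := I ×ˢ O) (t := G) (g := fun x => x.2 - x.1)
    fun x hx => Finset.mem_image_of_mem _ hx]
  calc _ ≤ ∑ k ∈ G, C * g k := by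
        refine Finset.sum_le_sum fun k _ => ?_
        set B := I.filter fun p => p + k ∈ O
        have h := hlind k B fun p hp =>
          ⟨hI p (Finset.mem_filter.mp hp).1, hO _ (Finset.mem_filter.mp hp).2⟩
        refine le_trans (le_of_eq ?_) (mul_le_mul_of_nonneg_right h (hg k))
        rw [Finset.sum_mul]
        refine Finset.sum_bij' (fun x _ => x.1) (fun p _ => (p, p + k)) ?_ ?_ ?_ ?_ ?_
        · intro x hx
          simp only [Finset.mem_filter, Finset.mem_product] at hx
          obtain ⟨⟨h1, h2⟩, h3⟩ := hx
          simp only [B, Finset.mem_filter]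
          refine ⟨h1, ?_⟩
          rwa [← h3, add_sub_cancel]
        · intro p hp
          simp only [B, Finset.mem_filter] at hp
          simp [hp.1, hp.2]
        · intro x hx
          have h3 := (Finset.mem_filter.mp hx).2
          simp [← h3]
        · intro p _
          rfl
        · intro x hx
          have h3 := (Finset.mem_filter.mp hx).2
          rw [h3, ← h3, add_sub_cancel, one_div, div_eq_inv_mul]
    _ ≤ C * S := by
        rw [← Finset.mul_sum]
        exact mul_le_mul_of_nonneg_left (hS G) hC

variable {m q : ℕ} {L : ℝ}

lemma integral_mul_sum_inner {d : ℕ} {U : EuclideanSpace ℝ (Fin d) → ℝ}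
    (hU : Integrable U (boxMeasure d L)) (Γ : BoxL2 d q L →L[ℂ] BoxL2 d q L)
    (I O : Finset (Fin d → ℤ)) :
    ∫ x, (U x : ℂ) * ∑ s : Fin q, inner ℂ (Γ (kernelVec d q L I s x))
        (Γ (kernelVec d q L O s x)) ∂(boxMeasure d L) =
      ∑ s : Fin q, ∑ p ∈ I, ∑ r ∈ O, ((L ^ (-(d : ℝ) / 2) : ℝ) : ℂ) * scalarCoeff d L U (r - p) *
        inner ℂ (Γ (planeWave d q L (p, s))) (Γ (planeWave d q L (r, s))) := by
  have hi : ∀ k, Integrable (fun x => (U x : ℂ) * planeWaveConj d L k x) (boxMeasure d L) := by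
    intro k
    refine hU.ofReal.mul_bdd (c := |L ^ (-(d : ℝ) / 2)|)
      (continuous_planeWaveConj d L k).aestronglyMeasurable
      (Filter.Eventually.of_forall fun x => ?_)
    rw [planeWaveConj, norm_mul, Complex.norm_exp_ofReal_mul_I, mul_one, Complex.norm_real,
      Real.norm_eq_abs]
  have e : ∀ x, (U x : ℂ) * ∑ s : Fin q, inner ℂ (Γ (kernelVec d q L I s x))
        (Γ (kernelVec d q L O s x)) = ∑ s : Fin q, ∑ p ∈ I, ∑ r ∈ O,
        (((L ^ (-(d : ℝ) / 2) : ℝ) : ℂ) *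
          inner ℂ (Γ (planeWave d q L (p, s))) (Γ (planeWave d q L (r, s)))) *
          ((U x : ℂ) * planeWaveConj d L (r - p) x) := by
    intro x
    simp only [map_kernelVec, sum_inner, inner_sum, inner_smul_left, inner_smul_right,
      Finset.mul_sum]
    refine Finset.sum_congr rfl fun s _ => ?_
    rw [Finset.sum_comm]
    refine Finset.sum_congr rfl fun p _ => Finset.sum_congr rfl fun r _ => ?_
    linear_combination ((U x : ℂ) * inner ℂ (Γ (planeWave d q L (p, s)))
      (Γ (planeWave d q L (r, s)))) * conj_mul_planeWaveConj_eq (L := L) p r x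
  simp only [e]
  rw [integral_finsetSum _ fun s _ => integrable_finsetSum _ fun p _ =>
    integrable_finsetSum _ fun r _ => (hi _).const_mul _]
  refine Finset.sum_congr rfl fun s _ => ?_
  rw [integral_finsetSum _ fun p _ => integrable_finsetSum _ fun r _ => (hi _).const_mul _]
  refine Finset.sum_congr rfl fun p _ => ?_
  rw [integral_finsetSum _ fun r _ => (hi _).const_mul _]
  refine Finset.sum_congr rfl fun r _ => ?_
  rw [integral_const_mul, scalarCoeff]
  ring

/-- The hypothesis says that Γ is an orthogonal projection. Together with Γ + Γ' = 1 it makes Γ' the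
complementary projection, and the next lemmas record the consequences for particles (Γ) and holes
(Γ'). -/
lemma inner_map_eq_inner_map {X : Type*} [NormedAddCommGroup X] [InnerProductSpace ℂ X]
    {Γ : X →L[ℂ] X} (h : ∀ u v, (inner ℂ (Γ u) (Γ v) : ℂ) = inner ℂ (Γ u) v) (u v : X) :
    (inner ℂ (Γ u) (Γ v) : ℂ) = inner ℂ u (Γ v) := by
  rw [← inner_conj_symm, h, inner_conj_symm]

lemma inner_compl_map {X : Type*} [NormedAddCommGroup X] [InnerProductSpace ℂ X]
    {Γ Γ' : X →L[ℂ] X} (h : ∀ u v, (inner ℂ (Γ u) (Γ v) : ℂ) = inner ℂ (Γ u) v)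
    (hs : ∀ u, Γ u + Γ' u = u) (u v : X) :
    (inner ℂ (Γ' u) (Γ' v) : ℂ) = inner ℂ u v - inner ℂ (Γ u) (Γ v) := by
  have h1 := inner_map_eq_inner_map h u v
  have h2 := h u v
  rw [eq_sub_of_add_eq' (hs u), eq_sub_of_add_eq' (hs v), inner_sub_left, inner_sub_right,
    inner_sub_right, ← h1, ← h2]
  ring

lemma inner_compl_map_self {X : Type*} [NormedAddCommGroup X] [InnerProductSpace ℂ X]
    {Γ Γ' : X →L[ℂ] X} (h : ∀ u v, (inner ℂ (Γ u) (Γ v) : ℂ) = inner ℂ (Γ u) v)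
    (hs : ∀ u, Γ u + Γ' u = u) (u v : X) :
    (inner ℂ (Γ' u) (Γ' v) : ℂ) = inner ℂ (Γ' u) v := by
  rw [inner_compl_map h hs, h u v, eq_sub_of_add_eq' (hs u), inner_sub_left]

lemma norm_map_le_of_inner {X : Type*} [NormedAddCommGroup X] [InnerProductSpace ℂ X]
    {Γ : X →L[ℂ] X} (h : ∀ u v, (inner ℂ (Γ u) (Γ v) : ℂ) = inner ℂ (Γ u) v) (u : X) :
    ‖Γ u‖ ≤ ‖u‖ := by
  have h1 := norm_inner_le_norm (𝕜 := ℂ) (Γ u) u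
  rw [← h, inner_self_eq_norm_sq_to_K, norm_pow] at h1
  have h2 : ‖((‖Γ u‖ : ℝ) : ℂ)‖ = ‖Γ u‖ := by simp
  change ‖((‖Γ u‖ : ℝ) : ℂ)‖ ^ 2 ≤ _ at h1
  rw [h2] at h1
  rcases (norm_nonneg (Γ u)).eq_or_lt' with h0 | h0
  · rw [h0]; exact norm_nonneg _
  · exact le_of_mul_le_mul_left (by linarith [sq ‖Γ u‖]) h0

/-- The integral is a sum of Û(r - p)⟨Γb_p, Γb_r⟩ over p inside and r outside. Young's inequality
with weight w_p + w_r, which equals |r|² - |p|² up to a factor, splits it. The weighted squares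
⟨Γb_p, Γb_r⟩² are bounded through Bessel by the excitation energy, and |Û(r - p)|²/(w_p + w_r) sums
to a Lindhard function times ∫U². -/
lemma exists_integral_cross_le (m : ℕ) : ∃ C : ℝ, 0 < C ∧ ∀ (q : ℕ) (L R : ℝ), 0 < L → 0 ≤ R →
    ∀ (U : EuclideanSpace ℝ (Fin (m + 2)) → ℝ), MemLp U 2 (boxMeasure (m + 2) L) →
    ∀ (Γ Γ' : BoxL2 (m + 2) q L →L[ℂ] BoxL2 (m + 2) q L),
      (∀ u v, (inner ℂ (Γ u) (Γ v) : ℂ) = inner ℂ (Γ u) v) → (∀ u, Γ u + Γ' u = u) →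
    ∀ I O : Finset (Fin (m + 2) → ℤ),
      (∀ p ∈ I, ‖latticePoint p‖ ≤ R - 2 * √(m + 2 : ℕ)) →
      (∀ p ∈ O, R + 2 * √(m + 2 : ℕ) ≤ ‖latticePoint p‖) →
      2 * ‖∫ x, (U x : ℂ) * ∑ s : Fin q, inner ℂ (Γ (kernelVec (m + 2) q L I s x))
        (Γ (kernelVec (m + 2) q L O s x)) ∂(boxMeasure (m + 2) L)‖ ≤
      1 / 2 * (∑ p ∈ I, (2 * Real.pi / L) ^ 2 * |‖latticePoint p‖ ^ 2 - R ^ 2| *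
          ∑ s : Fin q, ‖Γ' (planeWave (m + 2) q L (p, s))‖ ^ 2 +
        ∑ p ∈ O, (2 * Real.pi / L) ^ 2 * |‖latticePoint p‖ ^ 2 - R ^ 2| *
          ∑ s : Fin q, ‖Γ (planeWave (m + 2) q L (p, s))‖ ^ 2) +
      q * C * ((2 * Real.pi / L * R) ^ m * ∫ x, U x ^ 2 ∂(boxMeasure (m + 2) L)) := by
  obtain ⟨C, hC, hlind⟩ := lindhard_sum_le m
  refine ⟨2 * C, by positivity, fun q L R hL hR U hU Γ Γ' hΓ hs I O hI hO => ?_⟩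
  rw [integral_mul_sum_inner (hU.integrable (by norm_num))]
  set a := 2 * √((m + 2 : ℕ) : ℝ)
  have ha : 0 < a := by positivity
  set c := 2 * Real.pi / L
  have hc : 0 < c := by positivity
  set κ := L ^ (-((m + 2 : ℕ) : ℝ) / 2)
  have hκ : κ ^ 2 = (L ^ (m + 2))⁻¹ := rpow_neg_half_sq (m + 2) hL
  have hκ0 : 0 ≤ κ := by positivity
  set w : (Fin (m + 2) → ℤ) → ℝ := fun p => c ^ 2 * |‖latticePoint p‖ ^ 2 - R ^ 2|
  have hw0 : ∀ p, 0 ≤ w p := fun p => by positivity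
  set b := planeWave (m + 2) q L
  have hb : Orthonormal ℂ b := orthonormal_planeWave hL
  have hlt : ∀ p ∈ I, ∀ r ∈ O, 0 < ‖latticePoint r‖ ^ 2 - ‖latticePoint p‖ ^ 2 ∧
      w p + w r = c ^ 2 * (‖latticePoint r‖ ^ 2 - ‖latticePoint p‖ ^ 2) := by
    intro p hp r hr
    have h1 := hI p hp
    have h2 := hO r hr
    have h3 := norm_nonneg (latticePoint p)
    have h4 : ‖latticePoint p‖ ^ 2 < R ^ 2 := by gcongr; linarith
    have h5 : R ^ 2 < ‖latticePoint r‖ ^ 2 := by gcongr; linarith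
    refine ⟨by linarith, ?_⟩
    simp only [w]
    rw [abs_of_neg (by linarith), abs_of_pos (by linarith)]
    ring
  set T : (Fin (m + 2) → ℤ) → (Fin (m + 2) → ℤ) → Fin q → ℝ := fun p r s =>
    ‖(inner ℂ (Γ (b (p, s))) (Γ (b (r, s))) : ℂ)‖ ^ 2
  have hbes : ∀ (Γ : BoxL2 (m + 2) q L →L[ℂ] BoxL2 (m + 2) q L) (s : Fin q)
      (A : Finset (Fin (m + 2) → ℤ)) (v : BoxL2 (m + 2) q L),
      (∀ u v, (inner ℂ (Γ u) (Γ v) : ℂ) = inner ℂ (Γ u) v) →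
      ∑ r ∈ A, ‖(inner ℂ (Γ v) (Γ (b (r, s))) : ℂ)‖ ^ 2 ≤ ‖Γ v‖ ^ 2 := by
    intro Γ s A v hΓ
    have ho : Orthonormal ℂ fun p : Fin (m + 2) → ℤ => b (p, s) :=
      hb.comp _ fun a b h => (Prod.mk.inj h).1
    refine le_trans (le_of_eq (Finset.sum_congr rfl fun r _ => ?_))
      (ho.sum_inner_products_le (Γ v) (s := A))
    rw [hΓ, norm_inner_symm]
  -- For p ≠ r, ⟨Γb_p, Γb_r⟩ = -⟨Γ'b_p, Γ'b_r⟩; this is how the sum over r becomes a hole occupation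
  -- and not a particle occupation.
  have hTI : ∀ s, ∀ p ∈ I, ∑ r ∈ O, T p r s ≤ ‖Γ' (b (p, s))‖ ^ 2 := by
    intro s p hp
    refine le_trans (le_of_eq (Finset.sum_congr rfl fun r hr => ?_))
      (hbes Γ' s O (b (p, s)) (inner_compl_map_self hΓ hs))
    have hne : p ≠ r := by
      rintro rfl
      exact absurd (hlt p hp p hr).1 (by simp)
    have h0 : (inner ℂ (b (p, s)) (b (r, s)) : ℂ) = 0 := hb.2 fun h => hne (Prod.mk.inj h).1
    rw [inner_compl_map hΓ hs, h0, zero_sub, norm_neg]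
  have hTO : ∀ s, ∀ r ∈ O, ∑ p ∈ I, T p r s ≤ ‖Γ (b (r, s))‖ ^ 2 := by
    intro s r _
    refine le_trans (le_of_eq (Finset.sum_congr rfl fun p _ => ?_)) (hbes Γ s I (b (r, s)) hΓ)
    simp only [T]
    rw [norm_inner_symm]
  have hsum1 : ∀ s, ∑ p ∈ I, ∑ r ∈ O, (w p + w r) * T p r s ≤
      ∑ p ∈ I, w p * ‖Γ' (b (p, s))‖ ^ 2 + ∑ r ∈ O, w r * ‖Γ (b (r, s))‖ ^ 2 := by
    intro s
    simp only [add_mul, Finset.sum_add_distrib]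
    refine add_le_add ?_ ?_
    · refine Finset.sum_le_sum fun p hp => ?_
      rw [← Finset.mul_sum]
      exact mul_le_mul_of_nonneg_left (hTI s p hp) (hw0 p)
    · rw [Finset.sum_comm]
      refine Finset.sum_le_sum fun r hr => ?_
      rw [← Finset.mul_sum]
      exact mul_le_mul_of_nonneg_left (hTO s r hr) (hw0 r)
  have hsum2 : ∑ p ∈ I, ∑ r ∈ O, κ ^ 2 * ‖scalarCoeff (m + 2) L U (r - p)‖ ^ 2 / (w p + w r) ≤
      C * ((c * R) ^ m * ∫ x, U x ^ 2 ∂(boxMeasure (m + 2) L)) := by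
    have h := sum_div_sub_le (C := C * R ^ m) (fun k A hA => hlind R k A hR hA) hI hO
      (g := fun k => ‖scalarCoeff (m + 2) L U k‖ ^ 2) (fun k => sq_nonneg _)
      (fun G => sum_norm_scalarCoeff_sq_le hL hU G) (by positivity)
    have e : ∑ p ∈ I, ∑ r ∈ O, κ ^ 2 * ‖scalarCoeff (m + 2) L U (r - p)‖ ^ 2 / (w p + w r) =
        κ ^ 2 / c ^ 2 * ∑ p ∈ I, ∑ r ∈ O, ‖scalarCoeff (m + 2) L U (r - p)‖ ^ 2 /
          (‖latticePoint r‖ ^ 2 - ‖latticePoint p‖ ^ 2) := by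
      simp only [Finset.mul_sum]
      refine Finset.sum_congr rfl fun p hp => Finset.sum_congr rfl fun r hr => ?_
      rw [(hlt p hp r hr).2, mul_div_mul_comm]
    -- Since cL = 2π, the prefactor κ²/c² is c^m divided by (2π)^(m+2).
    have hκc : κ ^ 2 / c ^ 2 * R ^ m ≤ (c * R) ^ m := by
      have h1 : κ ^ 2 / c ^ 2 = c ^ m / (2 * Real.pi) ^ (m + 2) := by
        rw [hκ, div_eq_div_iff (by positivity) (by positivity), ← pow_add]
        simp only [c, div_pow]
        ring
      rw [h1, mul_pow c R, div_mul_eq_mul_div]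
      refine div_le_self (by positivity) (one_le_pow₀ ?_)
      linarith [Real.pi_gt_three]
    have hS : 0 ≤ ∫ x, U x ^ 2 ∂(boxMeasure (m + 2) L) := integral_nonneg fun x => sq_nonneg _
    rw [e]
    calc _ ≤ κ ^ 2 / c ^ 2 * (C * R ^ m * ∫ x, U x ^ 2 ∂(boxMeasure (m + 2) L)) := by gcongr
      _ = C * ((κ ^ 2 / c ^ 2 * R ^ m) * ∫ x, U x ^ 2 ∂(boxMeasure (m + 2) L)) := by ring
      _ ≤ _ := by gcongr
  calc _ ≤ 2 * ∑ s : Fin q, ∑ p ∈ I, ∑ r ∈ O, κ * ‖scalarCoeff (m + 2) L U (r - p)‖ *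
        ‖(inner ℂ (Γ (b (p, s))) (Γ (b (r, s))) : ℂ)‖ := by
        gcongr
        refine (norm_sum_le _ _).trans (Finset.sum_le_sum fun s _ =>
          (norm_sum_le _ _).trans (Finset.sum_le_sum fun p _ =>
          (norm_sum_le _ _).trans (Finset.sum_le_sum fun r _ => ?_)))
        rw [norm_mul, norm_mul, Complex.norm_real, Real.norm_of_nonneg hκ0]
    _ ≤ ∑ s : Fin q, ∑ p ∈ I, ∑ r ∈ O, (1 / 2 * ((w p + w r) * T p r s) +
        2 * (κ ^ 2 * ‖scalarCoeff (m + 2) L U (r - p)‖ ^ 2 / (w p + w r))) := by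
        rw [Finset.mul_sum]
        refine Finset.sum_le_sum fun s _ => ?_
        rw [Finset.mul_sum]
        refine Finset.sum_le_sum fun p hp => ?_
        rw [Finset.mul_sum]
        refine Finset.sum_le_sum fun r hr => ?_
        have hW : 0 < w p + w r := by
          rw [(hlt p hp r hr).2]
          exact mul_pos (by positivity) (hlt p hp r hr).1
        simp only [T]
        set y := ‖(inner ℂ (Γ (b (p, s))) (Γ (b (r, s))) : ℂ)‖
        set z := κ * ‖scalarCoeff (m + 2) L U (r - p)‖
        rw [← mul_pow]
        -- Young's inequality 2zy ≤ Wy²/2 + 2z²/W by completing the square; the 1/2 is the share of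
        -- the excitation energy allotted to the cross term.
        have h1 : 1 / 2 * ((w p + w r) * y ^ 2) + 2 * (z ^ 2 / (w p + w r)) - 2 * (z * y) =
            ((w p + w r) * y - 2 * z) ^ 2 / (2 * (w p + w r)) := by
          field_simp
          ring
        have h2 : 0 ≤ ((w p + w r) * y - 2 * z) ^ 2 / (2 * (w p + w r)) := by positivity
        linarith
    _ = ∑ s : Fin q, (1 / 2 * ∑ p ∈ I, ∑ r ∈ O, (w p + w r) * T p r s) +
        ∑ s : Fin q, 2 * ∑ p ∈ I, ∑ r ∈ O,
          κ ^ 2 * ‖scalarCoeff (m + 2) L U (r - p)‖ ^ 2 / (w p + w r) := by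
        simp only [Finset.sum_add_distrib, Finset.mul_sum]
    _ ≤ ∑ s : Fin q, (1 / 2 * (∑ p ∈ I, w p * ‖Γ' (b (p, s))‖ ^ 2 +
          ∑ r ∈ O, w r * ‖Γ (b (r, s))‖ ^ 2)) +
        ∑ s : Fin q, 2 * (C * ((c * R) ^ m * ∫ x, U x ^ 2 ∂(boxMeasure (m + 2) L))) := by
        gcongr with s _ s _
        exact hsum1 s
    _ = _ := by
        rw [Finset.sum_const, Finset.card_univ, Fintype.card_fin, nsmul_eq_mul, ← Finset.mul_sum,
          Finset.sum_add_distrib, Finset.sum_comm, Finset.sum_comm (s := Finset.univ) (t := O)]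
        simp only [Finset.mul_sum]
        ring

end CrossTerm

/-! ### Diagonal terms and the pointwise decomposition of the density -/

section CoreInequality

lemma sqrt_pow_mul_self {m : ℕ} {v : ℝ} (hv : 0 ≤ v) : v * √v ^ (m + 2) = v ^ critExp m := by
  rw [critExp, Real.rpow_add_of_nonneg hv (by norm_num) (by positivity), Real.rpow_one,
    Real.sqrt_eq_rpow, ← Real.rpow_natCast, ← Real.rpow_mul hv]
  congr 2
  ring

lemma integrable_sq_of_memLp {m : ℕ} {L : ℝ} {U : EuclideanSpace ℝ (Fin (m + 2)) → ℝ}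
    (hU : MemLp U (1 + ((m + 2 : ℕ) : ℝ≥0∞) / 2) (boxMeasure (m + 2) L)) :
    Integrable (fun x => U x ^ 2) (boxMeasure (m + 2) L) :=
  (memLp_two_of_memLp hU).integrable_sq

/-- The layer-cake bound with weight ||p|² - μ|. Outside the shell the number of modes with weight
at most e is of order eR^m + e^{d/2} by `card_inner_le` and `card_outer_le`; at e proportional to
|U| this yields U² and |U|^{1+d/2}. -/
lemma exists_integral_mul_modeDensity_le (m : ℕ) : ∃ C : ℝ, 0 < C ∧ ∀ (q : ℕ) (L R : ℝ), 0 < L →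
    0 ≤ R → ∀ (U : EuclideanSpace ℝ (Fin (m + 2)) → ℝ),
    MemLp U (1 + ((m + 2 : ℕ) : ℝ≥0∞) / 2) (boxMeasure (m + 2) L) →
    ∀ (Γ : BoxL2 (m + 2) q L →L[ℂ] BoxL2 (m + 2) q L), (∀ v, ‖Γ v‖ ≤ ‖v‖) →
    ∀ A : Finset (Fin (m + 2) → ℤ), (∀ p ∈ A, ‖latticePoint p‖ ≤ R - 2 * √(m + 2 : ℕ) ∨
        R + 2 * √(m + 2 : ℕ) ≤ ‖latticePoint p‖) →
      ∫ x, |U x| * modeDensity Γ A x ∂(boxMeasure (m + 2) L) ≤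
        1 / 4 * ∑ p ∈ A, (2 * Real.pi / L) ^ 2 * |‖latticePoint p‖ ^ 2 - R ^ 2| *
          ∑ s : Fin q, ‖Γ (planeWave (m + 2) q L (p, s))‖ ^ 2 +
        q * C * ∫ x, ((2 * Real.pi / L * R) ^ m * U x ^ 2 + |U x| ^ critExp m)
          ∂(boxMeasure (m + 2) L) := by
  obtain ⟨C₁, hC₁, hin⟩ := card_inner_le m
  obtain ⟨C₂, hC₂, hout⟩ := card_outer_le m
  refine ⟨2 * (C₁ + C₂) * (8 + 3 ^ (m + 2)), by positivity,
    fun q L R hL hR U hU Γ hΓ A hA => ?_⟩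
  set a := 2 * √((m + 2 : ℕ) : ℝ)
  have ha : 0 < a := by positivity
  set c := 2 * Real.pi / L
  have hc : 0 < c := by positivity
  set w : (Fin (m + 2) → ℤ) → ℝ := fun p => c ^ 2 * |‖latticePoint p‖ ^ 2 - R ^ 2|
  set g : ℝ → ℝ := fun e => (C₁ + C₂) * (e / c ^ 2 * R ^ m + √(e / c ^ 2) ^ (m + 2))
  have hg : ∀ e e', 0 ≤ e → e ≤ e' → ((A.filter fun p => w p ≤ e).card : ℝ) ≤ g e' := by
    intro e e' he hee'
    set B := A.filter fun p => w p ≤ e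
    have hε : 0 ≤ e' / c ^ 2 := div_nonneg (he.trans hee') (by positivity)
    have hB : ∀ p ∈ B, |‖latticePoint p‖ ^ 2 - R ^ 2| ≤ e' / c ^ 2 := fun p hp => by
      rw [le_div_iff₀' (by positivity)]
      exact (Finset.mem_filter.mp hp).2.trans hee'
    have h1 := hin R (e' / c ^ 2) (B.filter fun p => ‖latticePoint p‖ ≤ R) hR hε fun p hp => by
      obtain ⟨hp1, hp2⟩ := Finset.mem_filter.mp hp
      refine ⟨(hA p (Finset.mem_filter.mp hp1).1).resolve_right (by linarith), ?_⟩
      linarith [(abs_le.mp (hB p hp1)).1]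
    have h2 := hout R (e' / c ^ 2) (B.filter fun p => ¬ ‖latticePoint p‖ ≤ R) hR hε fun p hp => by
      obtain ⟨hp1, hp2⟩ := Finset.mem_filter.mp hp
      refine ⟨(hA p (Finset.mem_filter.mp hp1).1).resolve_left (by linarith), ?_⟩
      linarith [(abs_le.mp (hB p hp1)).2]
    rw [← Finset.card_filter_add_card_filter_not (s := B) fun p => ‖latticePoint p‖ ≤ R]
    push_cast
    have h3 : 0 ≤ C₁ * √(e' / c ^ 2) ^ (m + 2) := by positivity
    have h4 : 0 ≤ e' / c ^ 2 * R ^ m := by positivity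
    simp only [g]
    nlinarith
  -- Level c = 8 spends 2/8 = 1/4 of the kinetic energy. The diagonal terms enter the final estimate
  -- twice, so with the 1/2 of the cross term exactly the whole excitation energy is used.
  have h := lintegral_mul_modeDensity_le hL hΓ A (w := w) (fun p => by positivity) hg U
    (c := 8) (by norm_num)
  set H : EuclideanSpace ℝ (Fin (m + 2)) → ℝ :=
    fun x => (c * R) ^ m * U x ^ 2 + |U x| ^ critExp m
  have hH0 : ∀ x, 0 ≤ H x := fun x => by positivity
  have hHi : Integrable H (boxMeasure (m + 2) L) :=
    ((integrable_sq_of_memLp hU).const_mul _).add (integrable_abs_rpow hU)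
  have hcL : 1 ≤ c * L := by
    simp only [c]
    rw [div_mul_cancel₀ _ hL.ne']
    linarith [Real.pi_gt_three]
  have hGH : ∀ x, 2 * q * (|U x| * (g (8 * |U x|) * (L ^ (m + 2))⁻¹)) ≤
      q * (2 * (C₁ + C₂) * (8 + 3 ^ (m + 2))) * H x := by
    intro x
    set v := |U x|
    have hv : 0 ≤ v := abs_nonneg _
    have h1 : R ^ m / c ^ 2 * (L ^ (m + 2))⁻¹ ≤ (c * R) ^ m := by
      rw [← div_eq_mul_inv, div_div, div_le_iff₀ (by positivity), mul_pow]
      calc R ^ m = R ^ m * 1 := (mul_one _).symm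
        _ ≤ R ^ m * (c * L) ^ (m + 2) := by gcongr; exact one_le_pow₀ hcL
        _ = _ := by ring
    have h2 : √(8 * v / c ^ 2) ^ (m + 2) * (L ^ (m + 2))⁻¹ ≤ 3 ^ (m + 2) * √v ^ (m + 2) := by
      rw [← inv_pow, ← mul_pow, ← mul_pow]
      refine pow_le_pow_left₀ (by positivity) ?_ _
      rw [Real.sqrt_div (by positivity), Real.sqrt_sq hc.le, Real.sqrt_mul (by norm_num),
        ← div_eq_mul_inv, div_div, div_le_iff₀ (by positivity)]
      have h8 : √8 ≤ 3 := by
        rw [Real.sqrt_le_left (by norm_num)]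
        norm_num
      calc √8 * √v ≤ 3 * √v * 1 := by rw [mul_one]; gcongr
        _ ≤ _ := by gcongr
    have h3 : |U x| ^ critExp m = v * √v ^ (m + 2) := (sqrt_pow_mul_self hv).symm
    have h4 : U x ^ 2 = v ^ 2 := (sq_abs _).symm
    have e1 : 2 * q * (v * (g (8 * v) * (L ^ (m + 2))⁻¹)) = 2 * q * (C₁ + C₂) *
        (8 * v ^ 2 * (R ^ m / c ^ 2 * (L ^ (m + 2))⁻¹) +
          v * (√(8 * v / c ^ 2) ^ (m + 2) * (L ^ (m + 2))⁻¹)) := by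
      simp only [g]
      ring
    have e2 : q * (2 * (C₁ + C₂) * (8 + 3 ^ (m + 2))) * H x = 2 * q * (C₁ + C₂) *
        ((8 + 3 ^ (m + 2)) * (v ^ 2 * (c * R) ^ m + v * √v ^ (m + 2))) := by
      simp only [H]
      rw [h3, h4]
      ring
    rw [e1, e2]
    have h5 : 0 ≤ v ^ 2 * (c * R) ^ m := by positivity
    have h6 : 0 ≤ v * √v ^ (m + 2) := by positivity
    refine mul_le_mul_of_nonneg_left ?_ (by positivity)
    calc _ ≤ 8 * v ^ 2 * (c * R) ^ m + v * (3 ^ (m + 2) * √v ^ (m + 2)) := by gcongr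
      _ ≤ _ := by
        have : (0 : ℝ) ≤ 3 ^ (m + 2) := by positivity
        nlinarith [mul_nonneg this h5]
  have hK0 : 0 ≤ ∑ p ∈ A, w p * ∑ s : Fin q, ‖Γ (planeWave (m + 2) q L (p, s))‖ ^ 2 :=
    Finset.sum_nonneg fun p _ => mul_nonneg (by positivity)
      (Finset.sum_nonneg fun _ _ => sq_nonneg _)
  have hI0 : 0 ≤ q * (2 * (C₁ + C₂) * (8 + 3 ^ (m + 2))) * ∫ x, H x ∂(boxMeasure (m + 2) L) :=
    mul_nonneg (by positivity) (integral_nonneg hH0)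
  have h2 : ∫⁻ x, ENNReal.ofReal (|U x| * modeDensity Γ A x) ∂(boxMeasure (m + 2) L) ≤
      ENNReal.ofReal (1 / 4 * ∑ p ∈ A, w p * ∑ s : Fin q, ‖Γ (planeWave (m + 2) q L (p, s))‖ ^ 2 +
        q * (2 * (C₁ + C₂) * (8 + 3 ^ (m + 2))) * ∫ x, H x ∂(boxMeasure (m + 2) L)) := by
    rw [ENNReal.ofReal_add (by positivity) hI0]
    refine h.trans (add_le_add (le_of_eq (by norm_num)) ?_)
    rw [← integral_const_mul, ofReal_integral_eq_lintegral_ofReal (hHi.const_mul _)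
      (Filter.Eventually.of_forall fun x => mul_nonneg (by positivity) (hH0 x))]
    exact lintegral_mono fun x => ENNReal.ofReal_le_ofReal (hGH x)
  rw [integral_eq_lintegral_of_nonneg_ae
    (Filter.Eventually.of_forall fun x => mul_nonneg (abs_nonneg _) (modeDensity_nonneg _ _ _))
    (hU.1.norm.mul (continuous_modeDensity Γ A).aestronglyMeasurable)]
  exact ENNReal.toReal_le_of_le_ofReal (by positivity) h2

/-- Here u, v, w are the parts inside, in the shell and outside. Expand the square: ‖Γu‖² is ‖u‖²
minus a hole term, and ⟨Γu, Γv⟩ = -⟨Γ'u, Γ'v⟩ as u ⊥ v, so all products with v are bounded by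
Cauchy–Schwarz. Only the coupling of u and w has to be kept. -/
lemma abs_norm_map_add_sq_sub_le {X : Type*} [NormedAddCommGroup X] [InnerProductSpace ℂ X]
    {Γ Γ' : X →L[ℂ] X} (h : ∀ u v, (inner ℂ (Γ u) (Γ v) : ℂ) = inner ℂ (Γ u) v)
    (hs : ∀ u, Γ u + Γ' u = u) {u v w : X} (huv : (inner ℂ u v : ℂ) = 0) :
    |‖Γ (u + v + w)‖ ^ 2 - ‖u‖ ^ 2 - 2 * (inner ℂ (Γ u) (Γ w) : ℂ).re| ≤
      2 * ‖Γ' u‖ ^ 2 + 2 * ‖Γ w‖ ^ 2 + 3 * ‖v‖ ^ 2 := by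
  have h' := inner_compl_map_self h hs
  have e1 : ‖Γ (u + v + w)‖ ^ 2 = ‖Γ u‖ ^ 2 + ‖Γ v‖ ^ 2 + ‖Γ w‖ ^ 2 +
      2 * (inner ℂ (Γ u) (Γ v) : ℂ).re + 2 * (inner ℂ (Γ u) (Γ w) : ℂ).re +
      2 * (inner ℂ (Γ v) (Γ w) : ℂ).re := by
    rw [map_add, map_add, norm_add_sq (𝕜 := ℂ), norm_add_sq (𝕜 := ℂ), inner_add_left]
    simp only [RCLike.re_to_complex, Complex.add_re]
    ring
  have e2 : ‖Γ' u‖ ^ 2 = ‖u‖ ^ 2 - ‖Γ u‖ ^ 2 := by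
    have h1 := congrArg Complex.re (inner_compl_map h hs u u)
    rw [Complex.sub_re] at h1
    have h2 : ∀ z : X, (inner ℂ z z : ℂ).re = ‖z‖ ^ 2 := fun z =>
      inner_self_eq_norm_sq (𝕜 := ℂ) z
    simpa only [h2] using h1
  have e3 : (inner ℂ (Γ' u) (Γ' v) : ℂ).re = - (inner ℂ (Γ u) (Γ v) : ℂ).re := by
    rw [inner_compl_map h hs, huv, zero_sub, Complex.neg_re]
  have b1 : |(inner ℂ (Γ' u) (Γ' v) : ℂ).re| ≤ ‖Γ' u‖ * ‖v‖ :=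
    (Complex.abs_re_le_norm _).trans ((norm_inner_le_norm _ _).trans
      (mul_le_mul_of_nonneg_left (norm_map_le_of_inner h' v) (norm_nonneg _)))
  have b2 : |(inner ℂ (Γ v) (Γ w) : ℂ).re| ≤ ‖v‖ * ‖Γ w‖ :=
    (Complex.abs_re_le_norm _).trans ((norm_inner_le_norm _ _).trans
      (mul_le_mul_of_nonneg_right (norm_map_le_of_inner h v) (norm_nonneg _)))
  have b3 : ‖Γ v‖ ^ 2 ≤ ‖v‖ ^ 2 := by gcongr; exact norm_map_le_of_inner h v
  rw [e3] at b1
  rw [abs_le] at b1 b2 ⊢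
  have c1 := sq_nonneg (‖Γ' u‖ - ‖v‖)
  have c2 := sq_nonneg (‖v‖ - ‖Γ w‖)
  have c3 := sq_nonneg ‖Γ v‖
  have c4 := sq_nonneg ‖Γ w‖
  constructor <;> nlinarith

lemma inner_kernelVec_eq_zero {d q : ℕ} {L : ℝ} (hL : 0 < L) {A B : Finset (Fin d → ℤ)}
    (h : Disjoint A B) (s : Fin q) (x : EuclideanSpace ℝ (Fin d)) :
    (inner ℂ (kernelVec d q L A s x) (kernelVec d q L B s x) : ℂ) = 0 := by
  simp only [kernelVec, sum_inner, inner_sum, inner_smul_left, inner_smul_right, Finset.mul_sum]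
  refine Finset.sum_eq_zero fun r hr => Finset.sum_eq_zero fun p hp => ?_
  have : (inner ℂ (planeWave d q L (p, s)) (planeWave d q L (r, s)) : ℂ) = 0 :=
    (orthonormal_planeWave hL).2 fun e => by
      have := (Prod.mk.inj e).1
      subst this
      exact Finset.disjoint_left.mp h hp hr
  simp [this]

/-- Apply the previous expansion to the evaluation vectors at x. The Fermi ball F exceeds I by at
most the shell S, which raises the coefficient of the shell count from 3 to 4. -/
lemma abs_modeDensity_sub_le {d q : ℕ} {L : ℝ} (hL : 0 < L)
    {Γ Γ' : BoxL2 d q L →L[ℂ] BoxL2 d q L}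
    (h : ∀ u v, (inner ℂ (Γ u) (Γ v) : ℂ) = inner ℂ (Γ u) v) (hs : ∀ u, Γ u + Γ' u = u)
    {I S O F A : Finset (Fin d → ℤ)} (hIS : Disjoint I S) (hISO : Disjoint (I ∪ S) O)
    (hA : A = I ∪ S ∪ O) (hIF : I ⊆ F) (hFIS : F ⊆ I ∪ S) (x : EuclideanSpace ℝ (Fin d)) :
    |modeDensity Γ A x - q * (F.card * (L ^ d)⁻¹) - 2 * (∑ s : Fin q,
      (inner ℂ (Γ (kernelVec d q L I s x)) (Γ (kernelVec d q L O s x)) : ℂ)).re| ≤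
    2 * modeDensity Γ' I x + 2 * modeDensity Γ O x + q * (4 * (S.card * (L ^ d)⁻¹)) := by
  have hkv : ∀ s : Fin q, kernelVec d q L A s x =
      kernelVec d q L I s x + kernelVec d q L S s x + kernelVec d q L O s x := fun s => by
    rw [hA, kernelVec, Finset.sum_union hISO, Finset.sum_union hIS]
    rfl
  have hterm : ∀ s : Fin q, |‖Γ (kernelVec d q L A s x)‖ ^ 2 - F.card * (L ^ d)⁻¹ -
      2 * (inner ℂ (Γ (kernelVec d q L I s x)) (Γ (kernelVec d q L O s x)) : ℂ).re| ≤
      2 * ‖Γ' (kernelVec d q L I s x)‖ ^ 2 + 2 * ‖Γ (kernelVec d q L O s x)‖ ^ 2 +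
        4 * (S.card * (L ^ d)⁻¹) := by
    intro s
    have h1 := abs_norm_map_add_sq_sub_le h hs (w := kernelVec d q L O s x)
      (inner_kernelVec_eq_zero hL hIS s x)
    rw [← hkv, norm_kernelVec_sq hL, norm_kernelVec_sq hL] at h1
    have h2 : (I.card : ℝ) ≤ F.card := by exact_mod_cast Finset.card_le_card hIF
    have h3 : (F.card : ℝ) ≤ I.card + S.card := by
      exact_mod_cast (Finset.card_le_card hFIS).trans (Finset.card_union_le I S)
    have h4 : 0 < (L ^ d)⁻¹ := by positivity
    rw [abs_le] at h1 ⊢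
    constructor <;> nlinarith
  have e : modeDensity Γ A x - q * (F.card * (L ^ d)⁻¹) - 2 * (∑ s : Fin q,
      (inner ℂ (Γ (kernelVec d q L I s x)) (Γ (kernelVec d q L O s x)) : ℂ)).re =
      ∑ s : Fin q, (‖Γ (kernelVec d q L A s x)‖ ^ 2 - F.card * (L ^ d)⁻¹ -
      2 * (inner ℂ (Γ (kernelVec d q L I s x)) (Γ (kernelVec d q L O s x)) : ℂ).re) := by
    rw [Finset.sum_sub_distrib, Finset.sum_sub_distrib, Complex.re_sum, Finset.mul_sum,
      Finset.sum_const, Finset.card_univ, Fintype.card_fin, nsmul_eq_mul, modeDensity]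
  rw [e]
  refine (Finset.abs_sum_le_sum_abs _ _).trans ((Finset.sum_le_sum fun s _ => hterm s).trans
    (le_of_eq ?_))
  rw [Finset.sum_add_distrib, Finset.sum_add_distrib, ← Finset.mul_sum, ← Finset.mul_sum,
    Finset.sum_const, Finset.card_univ, Fintype.card_fin, nsmul_eq_mul, modeDensity, modeDensity]

end CoreInequality

/-! ### The density shift controlled by the excitation energy -/

section LowerBound

/-- The kinetic energy, relative to the Fermi level, of the state `Γ` compared with the filled
Fermi ball of radius `R` (in units of `2π/L`). -/
def excitationEnergy {d q : ℕ} {L : ℝ} (R : ℝ) (Γ Γ' : BoxL2 d q L →L[ℂ] BoxL2 d q L)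
    (A : Finset (Fin d → ℤ)) : ℝ :=
  ∑ p ∈ A with ‖latticePoint p‖ ≤ R, (2 * Real.pi / L) ^ 2 * |‖latticePoint p‖ ^ 2 - R ^ 2| *
    ∑ s : Fin q, ‖Γ' (planeWave d q L (p, s))‖ ^ 2 +
  ∑ p ∈ A with ¬ ‖latticePoint p‖ ≤ R, (2 * Real.pi / L) ^ 2 * |‖latticePoint p‖ ^ 2 - R ^ 2| *
    ∑ s : Fin q, ‖Γ (planeWave d q L (p, s))‖ ^ 2

lemma integrable_mul_modeDensity {d q : ℕ} {L : ℝ} (hL : 0 < L)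
    {U : EuclideanSpace ℝ (Fin d) → ℝ} (hU : Integrable U (boxMeasure d L))
    {Γ : BoxL2 d q L →L[ℂ] BoxL2 d q L} (hΓ : ∀ v, ‖Γ v‖ ≤ ‖v‖) (A : Finset (Fin d → ℤ)) :
    Integrable (fun x => U x * modeDensity Γ A x) (boxMeasure d L) := by
  refine hU.mul_bdd (c := q * (A.card * (L ^ d)⁻¹))
    (continuous_modeDensity Γ A).aestronglyMeasurable (Filter.Eventually.of_forall fun x => ?_)
  rw [Real.norm_of_nonneg (modeDensity_nonneg _ _ _)]
  exact modeDensity_le hL hΓ A x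

lemma integrable_mul_sum_inner {d q : ℕ} {L : ℝ} (hL : 0 < L)
    {U : EuclideanSpace ℝ (Fin d) → ℝ} (hU : Integrable U (boxMeasure d L))
    {Γ : BoxL2 d q L →L[ℂ] BoxL2 d q L} (hΓ : ∀ v, ‖Γ v‖ ≤ ‖v‖) (I O : Finset (Fin d → ℤ)) :
    Integrable (fun x => (U x : ℂ) * ∑ s : Fin q, inner ℂ (Γ (kernelVec d q L I s x))
      (Γ (kernelVec d q L O s x))) (boxMeasure d L) := by
  refine hU.ofReal.mul_bdd (c := ∑ _s : Fin q, √(I.card * (L ^ d)⁻¹) * √(O.card * (L ^ d)⁻¹))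
    ?_ (Filter.Eventually.of_forall fun x => ?_)
  · apply Continuous.aestronglyMeasurable
    simp only [map_kernelVec]
    have := continuous_planeWaveConj d L
    fun_prop
  · refine (norm_sum_le _ _).trans (Finset.sum_le_sum fun s _ => ?_)
    rw [← norm_kernelVec_sq hL I s x, ← norm_kernelVec_sq hL O s x, Real.sqrt_sq (norm_nonneg _),
      Real.sqrt_sq (norm_nonneg _)]
    exact (norm_inner_le_norm _ _).trans (mul_le_mul (hΓ _) (hΓ _) (norm_nonneg _) (norm_nonneg _))

/-- The error density in the lower bound. -/
def errorDensity (m : ℕ) (L R : ℝ) (u : ℝ) : ℝ :=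
  (2 * Real.pi / L * R) ^ m * u ^ 2 + |u| ^ critExp m + (1 + R) ^ (m + 1) * (L ^ (m + 2))⁻¹ * |u|

lemma integrable_errorDensity {m : ℕ} {L : ℝ} (R : ℝ) {U : EuclideanSpace ℝ (Fin (m + 2)) → ℝ}
    (hU : MemLp U (1 + ((m + 2 : ℕ) : ℝ≥0∞) / 2) (boxMeasure (m + 2) L)) :
    Integrable (fun x => errorDensity m L R (U x)) (boxMeasure (m + 2) L) :=
  (((integrable_sq_of_memLp hU).const_mul _).add (integrable_abs_rpow hU)).add
    ((integrable_of_memLp hU).abs.const_mul _)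

/-- The analytic heart. The pointwise decomposition is integrated against U: hole and particle
densities are bounded by the layer-cake estimate, the coupling of inside and outside by the Lindhard
estimate, the shell by its number of modes. -/
lemma exists_neg_excitationEnergy_le (m : ℕ) : ∃ C : ℝ, 0 < C ∧ ∀ (q : ℕ) (L R : ℝ), 0 < L →
    0 ≤ R → ∀ (U : EuclideanSpace ℝ (Fin (m + 2)) → ℝ),
    MemLp U (1 + ((m + 2 : ℕ) : ℝ≥0∞) / 2) (boxMeasure (m + 2) L) →
    ∀ (Γ Γ' : BoxL2 (m + 2) q L →L[ℂ] BoxL2 (m + 2) q L),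
      (∀ u v, (inner ℂ (Γ u) (Γ v) : ℂ) = inner ℂ (Γ u) v) → (∀ u, Γ u + Γ' u = u) →
    ∀ A : Finset (Fin (m + 2) → ℤ),
      -excitationEnergy R Γ Γ' A -
        q * C * ∫ x, errorDensity m L R (U x) ∂(boxMeasure (m + 2) L) ≤
      ∫ x, U x * (modeDensity Γ A x -
        q * ((A.filter fun p => ‖latticePoint p‖ ≤ R).card * (L ^ (m + 2))⁻¹))
          ∂(boxMeasure (m + 2) L) := by
  classical
  obtain ⟨C₁, hC₁, hdiag⟩ := exists_integral_mul_modeDensity_le m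
  obtain ⟨C₂, hC₂, hcross⟩ := exists_integral_cross_le m
  obtain ⟨C₃, hC₃, hshell⟩ := card_thin_shell_le m
  -- Two diagonal terms with factor 2 give 4C₁, the cross term gives C₂, and the shell coefficient
  -- gives 4C₃.
  refine ⟨4 * C₁ + C₂ + 4 * C₃, by positivity, fun q L R hL hR U hU Γ Γ' hΓ hs A => ?_⟩
  set a := 2 * √((m + 2 : ℕ) : ℝ)
  have ha : 0 < a := by positivity
  set I := A.filter fun p => ‖latticePoint p‖ ≤ R - a
  set O := A.filter fun p => R + a ≤ ‖latticePoint p‖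
  set S := A.filter fun p => R - a < ‖latticePoint p‖ ∧ ‖latticePoint p‖ < R + a
  set F := A.filter fun p => ‖latticePoint p‖ ≤ R
  have hΓ' := inner_compl_map_self hΓ hs
  have hΓc := norm_map_le_of_inner hΓ
  have hΓc' := norm_map_le_of_inner hΓ'
  have hUi := integrable_of_memLp hU
  have hIS : Disjoint I S := by
    rw [Finset.disjoint_filter]
    intro p _ h1 h2
    linarith [h2.1]
  have hISeq : I ∪ S = A.filter fun p => ‖latticePoint p‖ < R + a := by
    rw [← Finset.filter_or]
    refine Finset.filter_congr fun p _ => ⟨fun h => ?_, fun h => ?_⟩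
    · rcases h with h | h
      · linarith
      · exact h.2
    · rcases le_or_gt ‖latticePoint p‖ (R - a) with h1 | h1
      · exact Or.inl h1
      · exact Or.inr ⟨h1, h⟩
  have hISO : Disjoint (I ∪ S) O := by
    rw [hISeq, Finset.disjoint_filter]
    intro p _ h1 h2
    linarith
  have hA : A = I ∪ S ∪ O := by
    rw [hISeq, ← Finset.filter_or, Finset.filter_true_of_mem fun p _ => lt_or_ge _ _]
  have hIF : I ⊆ F := Finset.monotone_filter_right _ fun p _ h => h.trans (by linarith)
  have hFIS : F ⊆ I ∪ S := by
    rw [hISeq]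
    exact Finset.monotone_filter_right _ fun p _ h => lt_of_le_of_lt h (by linarith)
  have hOF : O ⊆ A.filter fun p => ¬ ‖latticePoint p‖ ≤ R :=
    Finset.monotone_filter_right _ fun p _ h => by
      have : R + a ≤ ‖latticePoint p‖ := h
      exact not_le.mpr (by linarith)
  have hpt := abs_modeDensity_sub_le hL hΓ hs hIS hISO hA hIF hFIS
  have hSc : (S.card : ℝ) ≤ C₃ * (1 + R) ^ (m + 1) := hshell R S hR fun p hp =>
    ⟨(Finset.mem_filter.mp hp).2.1.le, (Finset.mem_filter.mp hp).2.2.le⟩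
  have hd1 := hdiag q L R hL hR U hU Γ' hΓc' I fun p hp => Or.inl (Finset.mem_filter.mp hp).2
  have hd2 := hdiag q L R hL hR U hU Γ hΓc O fun p hp => Or.inr (Finset.mem_filter.mp hp).2
  have hcr := hcross q L R hL hR U (memLp_two_of_memLp hU) Γ Γ' hΓ hs I O
    (fun p hp => (Finset.mem_filter.mp hp).2) fun p hp => (Finset.mem_filter.mp hp).2
  set Z : EuclideanSpace ℝ (Fin (m + 2)) → ℂ := fun x => ∑ s : Fin q,
    inner ℂ (Γ (kernelVec (m + 2) q L I s x)) (Γ (kernelVec (m + 2) q L O s x))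
  have hZi : Integrable (fun x => (U x : ℂ) * Z x) (boxMeasure (m + 2) L) :=
    integrable_mul_sum_inner hL hUi hΓc I O
  have hZre : Integrable (fun x => U x * (Z x).re) (boxMeasure (m + 2) L) := by
    refine hZi.re.congr (Filter.Eventually.of_forall fun x => ?_)
    simp
  have hZint : ∫ x, U x * (Z x).re ∂(boxMeasure (m + 2) L) =
      (∫ x, (U x : ℂ) * Z x ∂(boxMeasure (m + 2) L)).re := by
    have h := integral_re hZi
    rw [RCLike.re_to_complex] at h
    rw [← h]
    refine integral_congr_ae (Filter.Eventually.of_forall fun x => ?_)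
    simp
  have i1 := integrable_mul_modeDensity hL hUi.abs hΓc' I
  have i2 := integrable_mul_modeDensity hL hUi.abs hΓc O
  have i12 : Integrable (fun x => 2 * (|U x| * modeDensity Γ' I x) +
      2 * (|U x| * modeDensity Γ O x)) (boxMeasure (m + 2) L) :=
    (i1.const_mul 2).add (i2.const_mul 2)
  have i3 : Integrable (fun x => q * (4 * (S.card * (L ^ (m + 2))⁻¹)) * |U x|)
      (boxMeasure (m + 2) L) := hUi.abs.const_mul _
  have i123 : Integrable (fun x => 2 * (|U x| * modeDensity Γ' I x) +
      2 * (|U x| * modeDensity Γ O x) + q * (4 * (S.card * (L ^ (m + 2))⁻¹)) * |U x|)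
      (boxMeasure (m + 2) L) := i12.add i3
  have hlow : ∫ x, (2 * (U x * (Z x).re) - (2 * (|U x| * modeDensity Γ' I x) +
      2 * (|U x| * modeDensity Γ O x) + q * (4 * (S.card * (L ^ (m + 2))⁻¹)) * |U x|))
        ∂(boxMeasure (m + 2) L) ≤ ∫ x, U x * (modeDensity Γ A x -
        q * (F.card * (L ^ (m + 2))⁻¹)) ∂(boxMeasure (m + 2) L) := by
    refine integral_mono ((hZre.const_mul 2).sub i123) ?_ fun x => ?_
    · refine ((integrable_mul_modeDensity hL hUi hΓc A).sub
        (hUi.mul_const (q * (F.card * (L ^ (m + 2))⁻¹)))).congr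
        (Filter.Eventually.of_forall fun x => ?_)
      simp only [Pi.sub_apply]
      ring
    · have h1 : |U x * (modeDensity Γ A x - q * (F.card * (L ^ (m + 2))⁻¹) - 2 * (Z x).re)| ≤
          |U x| * (2 * modeDensity Γ' I x + 2 * modeDensity Γ O x +
            q * (4 * (S.card * (L ^ (m + 2))⁻¹))) := by
        rw [abs_mul]
        exact mul_le_mul_of_nonneg_left (hpt x) (abs_nonneg _)
      simp only
      linarith [(abs_le.mp h1).1]
  refine le_trans ?_ hlow
  rw [integral_sub (hZre.const_mul 2) i123, integral_add i12 i3,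
    integral_add (i1.const_mul 2) (i2.const_mul 2), integral_const_mul, integral_const_mul,
    integral_const_mul, integral_const_mul, hZint]
  have hre := (abs_le.mp (Complex.abs_re_le_norm
    (∫ x, (U x : ℂ) * Z x ∂(boxMeasure (m + 2) L)))).1
  set P := ∫ x, |U x| ∂(boxMeasure (m + 2) L)
  set Q := ∫ x, U x ^ 2 ∂(boxMeasure (m + 2) L)
  set W := ∫ x, |U x| ^ critExp m ∂(boxMeasure (m + 2) L)
  have hP : 0 ≤ P := integral_nonneg fun x => abs_nonneg _
  have hQ : 0 ≤ Q := integral_nonneg fun x => sq_nonneg _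
  have hW : 0 ≤ W := integral_nonneg fun x => by positivity
  have q1 := (integrable_sq_of_memLp hU).const_mul ((2 * Real.pi / L * R) ^ m)
  have q2 := integrable_abs_rpow hU
  have q12 : Integrable (fun x => (2 * Real.pi / L * R) ^ m * U x ^ 2 + |U x| ^ critExp m)
      (boxMeasure (m + 2) L) := q1.add q2
  have hH : ∫ x, ((2 * Real.pi / L * R) ^ m * U x ^ 2 + |U x| ^ critExp m)
      ∂(boxMeasure (m + 2) L) = (2 * Real.pi / L * R) ^ m * Q + W := by
    rw [integral_add q1 q2, integral_const_mul]
  have herr : ∫ x, errorDensity m L R (U x) ∂(boxMeasure (m + 2) L) =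
      (2 * Real.pi / L * R) ^ m * Q + W + (1 + R) ^ (m + 1) * (L ^ (m + 2))⁻¹ * P := by
    simp only [errorDensity]
    rw [integral_add q12 (hUi.abs.const_mul _), integral_add q1 q2, integral_const_mul,
      integral_const_mul]
  rw [hH] at hd1 hd2
  rw [herr]
  have hwn : ∀ (Γ : BoxL2 (m + 2) q L →L[ℂ] BoxL2 (m + 2) q L) (p : Fin (m + 2) → ℤ),
      0 ≤ (2 * Real.pi / L) ^ 2 * |‖latticePoint p‖ ^ 2 - R ^ 2| *
        ∑ s : Fin q, ‖Γ (planeWave (m + 2) q L (p, s))‖ ^ 2 := fun Γ p =>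
    mul_nonneg (by positivity) (Finset.sum_nonneg fun _ _ => sq_nonneg _)
  have hK : (∑ p ∈ I, (2 * Real.pi / L) ^ 2 * |‖latticePoint p‖ ^ 2 - R ^ 2| *
        ∑ s : Fin q, ‖Γ' (planeWave (m + 2) q L (p, s))‖ ^ 2) +
      ∑ p ∈ O, (2 * Real.pi / L) ^ 2 * |‖latticePoint p‖ ^ 2 - R ^ 2| *
        ∑ s : Fin q, ‖Γ (planeWave (m + 2) q L (p, s))‖ ^ 2 ≤ excitationEnergy R Γ Γ' A :=
    add_le_add (Finset.sum_le_sum_of_subset_of_nonneg hIF fun p _ _ => hwn Γ' p)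
      (Finset.sum_le_sum_of_subset_of_nonneg hOF fun p _ _ => hwn Γ p)
  have hcR : 0 ≤ (2 * Real.pi / L * R) ^ m := by positivity
  have hsh : q * (4 * (S.card * (L ^ (m + 2))⁻¹)) * P ≤
      q * (4 * C₃) * ((1 + R) ^ (m + 1) * (L ^ (m + 2))⁻¹ * P) := by
    calc _ ≤ q * (4 * (C₃ * (1 + R) ^ (m + 1) * (L ^ (m + 2))⁻¹)) * P := by gcongr
      _ = _ := by ring
  set B := (1 + R) ^ (m + 1) * (L ^ (m + 2))⁻¹ * P
  have hB : 0 ≤ B := by positivity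
  set D := (2 * Real.pi / L * R) ^ m * Q
  have hD : 0 ≤ D := by positivity
  have hq : (0 : ℝ) ≤ q := by positivity
  have f1 : 0 ≤ q * (4 * C₁) * B := by positivity
  have f2 : 0 ≤ q * C₂ * B := by positivity
  have f3 : 0 ≤ q * C₂ * W := by positivity
  have f4 : 0 ≤ q * (4 * C₃) * (D + W) := by positivity
  have e : q * (4 * C₁ + C₂ + 4 * C₃) * (D + W + B) = 4 * (q * C₁ * (D + W)) + q * (4 * C₁) * B +
      q * C₂ * D + q * C₂ * W + q * C₂ * B + q * (4 * C₃) * (D + W) + q * (4 * C₃) * B := by ring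
  rw [e]
  linarith

end LowerBound

/-! ### Sums over eigenvalues below the Fermi level -/

section EigenvalueSum

lemma fourierCoeff_truncate {d q : ℕ} {L : ℝ} (hL : 0 < L) (A : Finset (Fin d → ℤ))
    (u : BoxL2 d q L) (k : Fin d → ℤ) [Decidable (k ∈ A)] :
    fourierCoeff (truncate A u) k = if k ∈ A then fourierCoeff u k else 0 := by
  ext s
  have hb := orthonormal_planeWave (d := d) (q := q) hL
  have e : fourierCoeff (truncate A u) k s = inner ℂ (planeWave d q L (k, s)) (truncate A u) :=
    (inner_planeWave (k, s) _).symm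
  rw [e, truncate]
  split_ifs with h
  · rw [hb.inner_right_sum _ (by simpa using h : (k, s) ∈ A ×ˢ Finset.univ), inner_planeWave]
  · rw [inner_sum]
    refine (Finset.sum_eq_zero fun i hi => ?_).trans rfl
    rw [inner_smul_right, hb.2, mul_zero]
    rintro rfl
    exact h (Finset.mem_product.mp hi).1

lemma energyForm_truncate {d q : ℕ} {L : ℝ} (hL : 0 < L) (V : EuclideanSpace ℝ (Fin d) → ℝ)
    (A : Finset (Fin d → ℤ)) (u : BoxL2 d q L) :
    (energyForm V (truncate A u) (truncate A u)).re =
      ∑ k ∈ A, momentumSq d L k * ‖fourierCoeff u k‖ ^ 2 +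
        ∫ x, V x * modeDensity (innerSL ℂ u) A x ∂(boxMeasure d L) := by
  classical
  rw [energyForm, Complex.add_re]
  congr 1
  · rw [tsum_eq_sum (s := A), Complex.re_sum]
    · refine Finset.sum_congr rfl fun k hk => ?_
      rw [fourierCoeff_truncate hL, if_pos hk, Complex.re_ofReal_mul]
      congr 1
      exact inner_self_eq_norm_sq (𝕜 := ℂ) _
    · intro k hk
      rw [fourierCoeff_truncate hL, if_neg hk, inner_zero_left, mul_zero]
  · have h : ∫ x, (V x : ℂ) * inner ℂ (truncate A u x) (truncate A u x) ∂(boxMeasure d L) =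
        ((∫ x, V x * modeDensity (innerSL ℂ u) A x ∂(boxMeasure d L) : ℝ) : ℂ) := by
      rw [← integral_complex_ofReal]
      refine integral_congr_ae ?_
      filter_upwards [norm_truncate_sq A u] with x hx
      rw [← hx, inner_self_eq_norm_sq_to_K]
      push_cast
      rfl
    rw [h, Complex.ofReal_re]

/-- The orthogonal projection onto the span of an orthonormal family. -/
def orthProj {X : Type*} [NormedAddCommGroup X] [InnerProductSpace ℂ X] {J : Type*} [Fintype J]
    (ψ : J → X) : X →L[ℂ] X :=
  ∑ j, (innerSL ℂ (ψ j)).smulRight (ψ j)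

section OrthProj

variable {X : Type*} [NormedAddCommGroup X] [InnerProductSpace ℂ X] {J : Type*} [Fintype J]
  {ψ : J → X}

lemma orthProj_apply (u : X) : orthProj ψ u = ∑ j, (inner ℂ (ψ j) u : ℂ) • ψ j := by
  simp [orthProj]

lemma inner_orthProj (hψ : Orthonormal ℂ ψ) (u v : X) :
    (inner ℂ (orthProj ψ u) (orthProj ψ v) : ℂ) = inner ℂ (orthProj ψ u) v := by
  rw [orthProj_apply, orthProj_apply, hψ.inner_sum, sum_inner]
  simp only [inner_smul_left]

lemma norm_orthProj_sq (hψ : Orthonormal ℂ ψ) (u : X) :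
    ‖orthProj ψ u‖ ^ 2 = ∑ j, ‖(inner ℂ (ψ j) u : ℂ)‖ ^ 2 := by
  have h : (inner ℂ (orthProj ψ u) (orthProj ψ u) : ℂ) =
      ((∑ j, ‖(inner ℂ (ψ j) u : ℂ)‖ ^ 2 : ℝ) : ℂ) := by
    rw [orthProj_apply, hψ.inner_sum]
    push_cast
    exact Finset.sum_congr rfl fun j _ => RCLike.conj_mul _
  have h2 := congrArg Complex.re h
  rw [Complex.ofReal_re] at h2
  rw [← h2]
  exact (inner_self_eq_norm_sq (𝕜 := ℂ) _).symm

end OrthProj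

/-- The momenta in the Fermi ball of radius `R`, in units of `2π/L`. -/
def fermiBall (d : ℕ) (R : ℝ) : Finset (Fin d → ℤ) := (finite_norm_latticePoint_le R).toFinset

lemma mem_fermiBall {d : ℕ} {R : ℝ} {k : Fin d → ℤ} :
    k ∈ fermiBall d R ↔ ‖latticePoint k‖ ≤ R := by
  simp [fermiBall]

/-- Particle-hole bookkeeping: inside the ball an occupation is q minus the holes, outside it is
counted directly, and μ - |p|² changes sign across the sphere. -/
lemma sum_mul_eq_sub_excitationEnergy {d q : ℕ} {L R : ℝ} (hL : 0 < L) (hR : 0 ≤ R)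
    {Γ Γ' : BoxL2 d q L →L[ℂ] BoxL2 d q L}
    (hΓ : ∀ u v, (inner ℂ (Γ u) (Γ v) : ℂ) = inner ℂ (Γ u) v) (hs : ∀ u, Γ u + Γ' u = u)
    (A : Finset (Fin d → ℤ)) :
    ∑ p ∈ A, ((2 * Real.pi / L) ^ 2 * R ^ 2 - momentumSq d L p) *
        ∑ s : Fin q, ‖Γ (planeWave d q L (p, s))‖ ^ 2 =
      q * ∑ p ∈ A with ‖latticePoint p‖ ≤ R, ((2 * Real.pi / L) ^ 2 * R ^ 2 - momentumSq d L p) -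
        excitationEnergy R Γ Γ' A := by
  have hb := orthonormal_planeWave (d := d) (q := q) hL
  have hγ : ∀ p, ∑ s : Fin q, ‖Γ (planeWave d q L (p, s))‖ ^ 2 =
      q - ∑ s : Fin q, ‖Γ' (planeWave d q L (p, s))‖ ^ 2 := by
    intro p
    rw [eq_sub_iff_add_eq, ← Finset.sum_add_distrib]
    have : ∀ s ∈ (Finset.univ : Finset (Fin q)), ‖Γ (planeWave d q L (p, s))‖ ^ 2 +
        ‖Γ' (planeWave d q L (p, s))‖ ^ 2 = 1 := by
      intro s _
      have h1 := congrArg Complex.re (inner_compl_map hΓ hs (planeWave d q L (p, s))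
        (planeWave d q L (p, s)))
      have h2 : ∀ z : BoxL2 d q L, (inner ℂ z z : ℂ).re = ‖z‖ ^ 2 := fun z =>
        inner_self_eq_norm_sq (𝕜 := ℂ) z
      rw [Complex.sub_re, h2, h2, h2, hb.1, one_pow] at h1
      linarith
    rw [Finset.sum_congr rfl this]
    simp
  rw [← Finset.sum_filter_add_sum_filter_not A fun p => ‖latticePoint p‖ ≤ R, excitationEnergy,
    Finset.mul_sum, ← sub_sub, ← Finset.sum_sub_distrib, sub_eq_add_neg, ← Finset.sum_neg_distrib]
  congr 1
  · refine Finset.sum_congr rfl fun p hp => ?_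
    have h1 : ‖latticePoint p‖ ^ 2 ≤ R ^ 2 := by
      have := (Finset.mem_filter.mp hp).2
      gcongr
    rw [hγ, momentumSq_eq, abs_of_nonpos (by linarith)]
    ring
  · refine Finset.sum_congr rfl fun p hp => ?_
    have h1 : R ^ 2 ≤ ‖latticePoint p‖ ^ 2 := by
      have := not_le.mp (Finset.mem_filter.mp hp).2
      gcongr
    rw [momentumSq_eq, abs_of_nonneg (by linarith)]
    ring

/-- With Γ the projection onto the ψ_j, the occupations and densities of the ψ_j add up to those of
Γ, and the excitation energy from the kinetic part cancels the one lost in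
`exists_neg_excitationEnergy_le`. This holds for finite sets of modes first. -/
lemma exists_sum_sub_eigenvalue_le (m : ℕ) : ∃ C : ℝ, 0 < C ∧ ∀ (q : ℕ) (L R : ℝ), 0 < L →
    0 ≤ R → ∀ (V U : EuclideanSpace ℝ (Fin (m + 2)) → ℝ),
    MemLp V (1 + ((m + 2 : ℕ) : ℝ≥0∞) / 2) (boxMeasure (m + 2) L) →
    MemLp U (1 + ((m + 2 : ℕ) : ℝ≥0∞) / 2) (boxMeasure (m + 2) L) → (∀ x, U x ≤ V x) →
    ∀ (J : Type) [Fintype J] (ψ : J → BoxL2 (m + 2) q L) (E : J → ℝ), Orthonormal ℂ ψ →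
      (∀ j, ψ j ∈ eigenspace (m + 2) q L V (E j)) →
      ∑ j, ((2 * Real.pi / L) ^ 2 * R ^ 2 - E j) ≤
        q * ∑ p ∈ fermiBall (m + 2) R,
          ((2 * Real.pi / L) ^ 2 * R ^ 2 - momentumSq (m + 2) L p) -
        q * ((fermiBall (m + 2) R).card * (L ^ (m + 2))⁻¹) * ∫ x, U x ∂(boxMeasure (m + 2) L) +
        q * C * ∫ x, errorDensity m L R (U x) ∂(boxMeasure (m + 2) L) := by
  classical
  obtain ⟨C, hC, hcore⟩ := exists_neg_excitationEnergy_le m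
  refine ⟨C, hC, fun q L R hL hR V U hV hU hUV J _ ψ E hψ hE => ?_⟩
  set μ := (2 * Real.pi / L) ^ 2 * R ^ 2
  have hμ : 0 ≤ μ := by positivity
  set Γ := orthProj ψ
  set Γ' := ContinuousLinearMap.id ℂ (BoxL2 (m + 2) q L) - Γ
  have hΓ : ∀ u v, (inner ℂ (Γ u) (Γ v) : ℂ) = inner ℂ (Γ u) v := inner_orthProj hψ
  have hs : ∀ u, Γ u + Γ' u = u := fun u => by
    change Γ u + (u - Γ u) = u
    abel
  have hΓc := norm_map_le_of_inner hΓ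
  have hE' := fun j => mem_eigenspace_iff.mp (hE j)
  have hEn : ∀ j, (energyForm V (ψ j) (ψ j)).re = E j := fun j => by
    rw [(hE' j).2 _ (hE' j).1, inner_self_eq_norm_sq_to_K, hψ.1 j]
    simp
  have hγ : ∀ k, ∑ j, ‖fourierCoeff (ψ j) k‖ ^ 2 =
      ∑ s : Fin q, ‖Γ (planeWave (m + 2) q L (k, s))‖ ^ 2 := by
    intro k
    simp only [norm_fourierCoeff_sq, Γ, norm_orthProj_sq hψ]
    rw [Finset.sum_comm]
    exact Finset.sum_congr rfl fun s _ => Finset.sum_congr rfl fun j _ => by rw [norm_inner_symm]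
  have hρ : ∀ A x, ∑ j, modeDensity (innerSL ℂ (ψ j)) A x = modeDensity Γ A x := by
    intro A x
    simp only [modeDensity, innerSL_apply_apply, Γ, norm_orthProj_sq hψ]
    exact Finset.sum_comm
  have hVi := integrable_of_memLp hV
  have hUi := integrable_of_memLp hU
  -- Truncation loses norm; the first term on the right is μ times the missing mass, which vanishes
  -- in the limit.
  have hfin : ∀ A, fermiBall (m + 2) R ⊆ A →
      ∑ j, (μ - (energyForm V (truncate A (ψ j)) (truncate A (ψ j))).re) ≤
      μ * (∑ _j : J, (1 : ℝ) - ∑ k ∈ A, ∑ j, ‖fourierCoeff (ψ j) k‖ ^ 2) +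
      (q * ∑ p ∈ fermiBall (m + 2) R, (μ - momentumSq (m + 2) L p) -
        q * ((fermiBall (m + 2) R).card * (L ^ (m + 2))⁻¹) * ∫ x, U x ∂(boxMeasure (m + 2) L) +
        q * C * ∫ x, errorDensity m L R (U x) ∂(boxMeasure (m + 2) L)) := by
    intro A hA
    have hF : (A.filter fun p => ‖latticePoint p‖ ≤ R) = fermiBall (m + 2) R := by
      ext p
      rw [Finset.mem_filter, mem_fermiBall]
      exact ⟨fun h => h.2, fun h => ⟨hA (mem_fermiBall.mpr h), h⟩⟩
    have h1 := hcore q L R hL hR U hU Γ Γ' hΓ hs A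
    have h2 := sum_mul_eq_sub_excitationEnergy hL hR hΓ hs A
    rw [hF] at h1 h2
    have hVρ := integrable_mul_modeDensity hL hVi hΓc A
    have hUρ := integrable_mul_modeDensity hL hUi hΓc A
    have h3 : ∫ x, U x * (modeDensity Γ A x - q * ((fermiBall (m + 2) R).card * (L ^ (m + 2))⁻¹))
        ∂(boxMeasure (m + 2) L) = ∫ x, U x * modeDensity Γ A x ∂(boxMeasure (m + 2) L) -
        q * ((fermiBall (m + 2) R).card * (L ^ (m + 2))⁻¹) *
          ∫ x, U x ∂(boxMeasure (m + 2) L) := by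
      rw [← integral_const_mul, ← integral_sub hUρ (hUi.const_mul _)]
      refine integral_congr_ae (Filter.Eventually.of_forall fun x => ?_)
      simp only
      ring
    -- The replacement of V by U happens here and uses only that the density is nonnegative.
    have h4 : ∫ x, U x * modeDensity Γ A x ∂(boxMeasure (m + 2) L) ≤
        ∫ x, V x * modeDensity Γ A x ∂(boxMeasure (m + 2) L) :=
      integral_mono hUρ hVρ fun x => mul_le_mul_of_nonneg_right (hUV x) (modeDensity_nonneg _ _ _)
    have hji : ∀ j, Integrable (fun x => V x * modeDensity (innerSL ℂ (ψ j)) A x)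
        (boxMeasure (m + 2) L) := by
      intro j
      refine hVρ.norm.mono' (hV.1.mul (continuous_modeDensity _ A).aestronglyMeasurable)
        (Filter.Eventually.of_forall fun x => ?_)
      rw [norm_mul, norm_mul, Real.norm_of_nonneg (modeDensity_nonneg _ _ _),
        Real.norm_of_nonneg (modeDensity_nonneg _ _ _), ← hρ]
      exact mul_le_mul_of_nonneg_left (Finset.single_le_sum
        (f := fun j => modeDensity (innerSL ℂ (ψ j)) A x)
        (fun j _ => modeDensity_nonneg _ _ _) (Finset.mem_univ j)) (norm_nonneg _)
    have h5 : ∑ j, (energyForm V (truncate A (ψ j)) (truncate A (ψ j))).re =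
        ∑ k ∈ A, momentumSq (m + 2) L k * ∑ s : Fin q, ‖Γ (planeWave (m + 2) q L (k, s))‖ ^ 2 +
          ∫ x, V x * modeDensity Γ A x ∂(boxMeasure (m + 2) L) := by
      simp only [energyForm_truncate hL, Finset.sum_add_distrib]
      congr 1
      · rw [Finset.sum_comm]
        refine Finset.sum_congr rfl fun k _ => ?_
        rw [← Finset.mul_sum, hγ]
      · rw [← integral_finsetSum _ fun j _ => hji j]
        simp only [← Finset.mul_sum, hρ]
    simp only [hγ]
    rw [Finset.sum_sub_distrib, h5]
    have h2' : ∑ p ∈ A, (μ - momentumSq (m + 2) L p) *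
        ∑ s : Fin q, ‖Γ (planeWave (m + 2) q L (p, s))‖ ^ 2 =
        μ * ∑ p ∈ A, ∑ s : Fin q, ‖Γ (planeWave (m + 2) q L (p, s))‖ ^ 2 -
        ∑ p ∈ A, momentumSq (m + 2) L p *
          ∑ s : Fin q, ‖Γ (planeWave (m + 2) q L (p, s))‖ ^ 2 := by
      simp only [sub_mul, Finset.sum_sub_distrib, ← Finset.mul_sum]
    change ∑ p ∈ A, (μ - momentumSq (m + 2) L p) * _ = q * ∑ p ∈ _, (μ - _) - _ at h2
    rw [h2'] at h2
    rw [h3] at h1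
    have h6 : ∑ _j : J, μ = μ * ∑ _j : J, (1 : ℝ) := by rw [Finset.mul_sum, mul_one]
    rw [h6]
    linarith
  have hlim1 : Filter.Tendsto (fun A =>
      ∑ j, (μ - (energyForm V (truncate A (ψ j)) (truncate A (ψ j))).re)) Filter.atTop
      (nhds (∑ j, (μ - E j))) := by
    refine tendsto_finsetSum _ fun j _ => tendsto_const_nhds.sub ?_
    rw [← hEn j]
    exact (Complex.continuous_re.tendsto _).comp (tendsto_energyForm_truncate hL hV (hE' j).1)
  have hlim2 : Filter.Tendsto (fun A => ∑ k ∈ A, ∑ j, ‖fourierCoeff (ψ j) k‖ ^ 2) Filter.atTop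
      (nhds (∑ _j : J, (1 : ℝ))) := by
    refine hasSum_sum fun j _ => ?_
    have h := hasSum_norm_fourierCoeff_sq hL (ψ j)
    rwa [hψ.1 j, one_pow] at h
  have hlim3 := ((hlim2.const_sub (∑ _j : J, (1 : ℝ))).const_mul μ).add_const
    (q * ∑ p ∈ fermiBall (m + 2) R, (μ - momentumSq (m + 2) L p) -
        q * ((fermiBall (m + 2) R).card * (L ^ (m + 2))⁻¹) * ∫ x, U x ∂(boxMeasure (m + 2) L) +
        q * C * ∫ x, errorDensity m L R (U x) ∂(boxMeasure (m + 2) L))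
  rw [sub_self, mul_zero, zero_add] at hlim3
  exact le_of_tendsto_of_tendsto hlim1 hlim3
    (Filter.eventually_atTop.mpr ⟨fermiBall (m + 2) R, hfin⟩)

end EigenvalueSum

/-! ### Upper and lower bounds for the relative energy -/

section RelativeEnergy

lemma norm_planeWave_apply_sq {d q : ℕ} {L : ℝ} (hL : 0 < L) (i : (Fin d → ℤ) × Fin q) :
    (fun x => ‖planeWave d q L i x‖ ^ 2) =ᵐ[boxMeasure d L] fun _ => (L ^ d)⁻¹ := by
  filter_upwards [(memLp_planeWave d L i.1 (EuclideanSpace.single i.2 (1 : ℂ))).coeFn_toLp]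
    with x hx
  rw [planeWave, hx, norm_smul, RCLike.norm_conj, mul_pow, norm_planeWaveConj_sq d hL]
  simp

lemma inFormDomain_planeWave {d q : ℕ} {L : ℝ} (hL : 0 < L) {V : EuclideanSpace ℝ (Fin d) → ℝ}
    (hV : Integrable V (boxMeasure d L)) (i : (Fin d → ℤ) × Fin q) :
    InFormDomain V (planeWave d q L i) := by
  refine ⟨summable_of_ne_finset_zero (s := {i.1}) fun k hk => ?_, ?_⟩
  · rw [fourierCoeff_planeWave hL, if_neg (fun h => hk (by simp [h]))]
    simp
  · refine (hV.mul_const (L ^ d)⁻¹).congr ?_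
    filter_upwards [norm_planeWave_apply_sq hL i] with x hx
    rw [hx]

lemma energyForm_planeWave {d q : ℕ} {L : ℝ} (hL : 0 < L) (V : EuclideanSpace ℝ (Fin d) → ℝ)
    (i : (Fin d → ℤ) × Fin q) :
    (energyForm V (planeWave d q L i) (planeWave d q L i)).re =
      momentumSq d L i.1 + (L ^ d)⁻¹ * ∫ x, V x ∂(boxMeasure d L) := by
  rw [energyForm, Complex.add_re]
  congr 1
  · rw [tsum_eq_single i.1]
    · rw [fourierCoeff_planeWave hL, if_pos rfl]
      simp
    · intro k hk
      rw [fourierCoeff_planeWave hL, if_neg hk.symm, inner_zero_left, mul_zero]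
  · have h : ∫ x, (V x : ℂ) * inner ℂ (planeWave d q L i x) (planeWave d q L i x)
        ∂(boxMeasure d L) = (((L ^ d)⁻¹ * ∫ x, V x ∂(boxMeasure d L) : ℝ) : ℂ) := by
      rw [← integral_const_mul, ← integral_complex_ofReal]
      refine integral_congr_ae ?_
      filter_upwards [norm_planeWave_apply_sq hL i] with x hx
      rw [inner_self_eq_norm_sq_to_K, mul_comm (L ^ d)⁻¹, ← hx]
      push_cast
      rfl
    rw [h, Complex.ofReal_re]

lemma setOf_momentumSq_le {d : ℕ} {L R : ℝ} (hL : 0 < L) (hR : 0 ≤ R) :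
    {k : Fin d → ℤ | momentumSq d L k ≤ (2 * Real.pi / L) ^ 2 * R ^ 2} = fermiBall d R := by
  ext k
  rw [Finset.mem_coe, mem_fermiBall]
  change momentumSq d L k ≤ _ ↔ _
  rw [momentumSq_eq, mul_le_mul_iff_right₀ (by positivity), sq_le_sq₀ (norm_nonneg _) hR]

lemma boxDensity_eq {d : ℕ} (q : ℕ) {L R : ℝ} (hL : 0 < L) (hR : 0 ≤ R) :
    boxDensity d q L ((2 * Real.pi / L) ^ 2 * R ^ 2) =
      q * ((fermiBall d R).card * (L ^ d)⁻¹) := by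
  rw [boxDensity, setOf_momentumSq_le hL hR, Set.ncard_coe_finset]
  ring

lemma freeDensity_eq {d : ℕ} (hd : d ≠ 0) (q : ℕ) {L R : ℝ} (hL : 0 < L) (hR : 0 ≤ R) :
    freeDensity d q ((2 * Real.pi / L) ^ 2 * R ^ 2) =
      q * (ballVolume d * R ^ d * (L ^ d)⁻¹) := by
  have h : {p : EuclideanSpace ℝ (Fin d) | ‖p‖ ^ 2 < (2 * Real.pi / L) ^ 2 * R ^ 2} =
      Metric.ball 0 (2 * Real.pi / L * R) := by
    ext p
    rw [mem_ball_zero_iff]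
    change ‖p‖ ^ 2 < _ ↔ _
    rw [← mul_pow, sq_lt_sq₀ (norm_nonneg _) (by positivity)]
  have hb := ballVolume_nonneg d
  rw [freeDensity, h, volume_ball_eq hd (by positivity), ENNReal.toReal_ofReal (by positivity),
    Real.rpow_neg (by positivity), Real.rpow_natCast, mul_pow (2 * Real.pi / L) R, div_pow]
  field_simp

/-- In lattice units the two densities compare the number of lattice points of a ball with its
volume. The discrepancy has the order of the shell error, so both choices of ρ satisfy the same
bound. -/
lemma exists_abs_density_sub_le (m : ℕ) : ∃ C : ℝ, 0 < C ∧ ∀ (q : ℕ) (L R : ℝ), 0 < L → 0 ≤ R →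
    |freeDensity (m + 2) q ((2 * Real.pi / L) ^ 2 * R ^ 2) -
      boxDensity (m + 2) q L ((2 * Real.pi / L) ^ 2 * R ^ 2)| ≤
      q * C * ((1 + R) ^ (m + 1) * (L ^ (m + 2))⁻¹) := by
  set D := √((m + 1 + 1 : ℕ) : ℝ)
  have hD : 1 ≤ D := Real.one_le_sqrt.mpr (by exact_mod_cast (by omega : 1 ≤ m + 1 + 1))
  have hω := ballVolume_nonneg (m + 2)
  refine ⟨ballVolume (m + 2) * ((m + 2) * D * D ^ (m + 1)) + 1, by positivity,
    fun q L R hL hR => ?_⟩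
  rw [freeDensity_eq (by omega) q hL hR, boxDensity_eq q hL hR, abs_sub_comm, ← mul_sub, ← sub_mul,
    abs_mul, abs_mul, abs_of_nonneg (by positivity : (0 : ℝ) ≤ q),
    abs_of_nonneg (by positivity : (0 : ℝ) ≤ (L ^ (m + 2))⁻¹), mul_assoc (q : ℝ),
    ← mul_assoc (_ + 1 : ℝ)]
  refine mul_le_mul_of_nonneg_left (mul_le_mul_of_nonneg_right ?_ (by positivity)) (by positivity)
  have h := abs_card_ball_sub_le (m := m + 1) (A := fermiBall (m + 2) R) hR
    fun k => mem_fermiBall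
  refine h.trans ?_
  have h1 : (R + D) ^ (m + 1) ≤ D ^ (m + 1) * (1 + R) ^ (m + 1) := by
    rw [← mul_pow]
    gcongr
    nlinarith
  have h2 : 0 ≤ (1 + R) ^ (m + 1) := by positivity
  calc _ = ballVolume (m + 2) * ((m + 2) * D * (R + D) ^ (m + 1)) := by
        rw [show ((m + 1 : ℕ) : ℝ) + 1 = m + 2 by push_cast; ring]
    _ ≤ ballVolume (m + 2) * ((m + 2) * D * (D ^ (m + 1) * (1 + R) ^ (m + 1))) := by gcongr
    _ ≤ _ := by linarith

/-- The total error density, for a potential `v` that is replaced by `u ≤ v`. -/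
def totalErrorDensity (m : ℕ) (L R : ℝ) (v u : ℝ) : ℝ :=
  errorDensity m L R u + (1 + R) ^ (m + 1) * (L ^ (m + 2))⁻¹ * |v| +
    (1 + R) ^ (m + 2) * (L ^ (m + 2))⁻¹ * (v - u)

lemma integrable_totalErrorDensity {m : ℕ} {L : ℝ} (R : ℝ)
    {V U : EuclideanSpace ℝ (Fin (m + 2)) → ℝ}
    (hV : MemLp V (1 + ((m + 2 : ℕ) : ℝ≥0∞) / 2) (boxMeasure (m + 2) L))
    (hU : MemLp U (1 + ((m + 2 : ℕ) : ℝ≥0∞) / 2) (boxMeasure (m + 2) L)) :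
    Integrable (fun x => totalErrorDensity m L R (V x) (U x)) (boxMeasure (m + 2) L) :=
  ((integrable_errorDensity R hU).add ((integrable_of_memLp hV).abs.const_mul _)).add
    (((integrable_of_memLp hV).sub (integrable_of_memLp hU)).const_mul _)

/-- The eigenvalue sum bounds the trace from above, plane waves bound it from below. At V = 0 both
bounds equal the free sum, which identifies tr(-Δ_L - μ)₋. -/
lemma exists_relativeEnergy_bounds (m : ℕ) : ∃ C : ℝ, 0 < C ∧ ∀ (q : ℕ) (L R : ℝ), 0 < L →
    0 ≤ R → ∀ (V : EuclideanSpace ℝ (Fin (m + 2)) → ℝ),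
    MemLp V (1 + ((m + 2 : ℕ) : ℝ≥0∞) / 2) (boxMeasure (m + 2) L) →
    traceNeg (m + 2) q L V ((2 * Real.pi / L) ^ 2 * R ^ 2) ≠ ⊤ ∧
    relativeEnergy (m + 2) q L V ((2 * Real.pi / L) ^ 2 * R ^ 2)
      (boxDensity (m + 2) q L ((2 * Real.pi / L) ^ 2 * R ^ 2)) ≤ 0 ∧
    ∀ U : EuclideanSpace ℝ (Fin (m + 2)) → ℝ,
      MemLp U (1 + ((m + 2 : ℕ) : ℝ≥0∞) / 2) (boxMeasure (m + 2) L) → (∀ x, U x ≤ V x) →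
      ∀ ρ, ρ = boxDensity (m + 2) q L ((2 * Real.pi / L) ^ 2 * R ^ 2) ∨
          ρ = freeDensity (m + 2) q ((2 * Real.pi / L) ^ 2 * R ^ 2) →
        -(q * C * ∫ x, totalErrorDensity m L R (V x) (U x) ∂(boxMeasure (m + 2) L)) ≤
          relativeEnergy (m + 2) q L V ((2 * Real.pi / L) ^ 2 * R ^ 2) ρ := by
  obtain ⟨C₁, hC₁, heig⟩ := exists_sum_sub_eigenvalue_le m
  obtain ⟨C₂, hC₂, hdens⟩ := exists_abs_density_sub_le m
  obtain ⟨C₃, hC₃, hball⟩ := card_ball_le m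
  refine ⟨C₁ + C₂ + C₃, by positivity, fun q L R hL hR V hV => ?_⟩
  set μ := (2 * Real.pi / L) ^ 2 * R ^ 2
  set N := (fermiBall (m + 2) R).card
  set T₀ := q * ∑ p ∈ fermiBall (m + 2) R, (μ - momentumSq (m + 2) L p)
  have hVi := integrable_of_memLp hV
  have htr : ∀ V U : EuclideanSpace ℝ (Fin (m + 2)) → ℝ,
      MemLp V (1 + ((m + 2 : ℕ) : ℝ≥0∞) / 2) (boxMeasure (m + 2) L) →
      MemLp U (1 + ((m + 2 : ℕ) : ℝ≥0∞) / 2) (boxMeasure (m + 2) L) → (∀ x, U x ≤ V x) →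
      traceNeg (m + 2) q L V μ ≠ ⊤ ∧ (traceNeg (m + 2) q L V μ).toReal ≤
        T₀ - q * (N * (L ^ (m + 2))⁻¹) * ∫ x, U x ∂(boxMeasure (m + 2) L) +
        q * C₁ * ∫ x, errorDensity m L R (U x) ∂(boxMeasure (m + 2) L) := by
    intro V U hV hU hUV
    have h := heig q L R hL hR V U hV hU hUV
    have h1 := traceNeg_le fun J _ ψ E hψ hE _ => h J ψ E hψ hE
    -- The empty family shows that the right side is nonnegative, as needed to pass from
    -- `ENNReal.ofReal` back to reals.
    have h0 := h Empty (fun j => j.elim) (fun j => j.elim)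
      ⟨fun j => j.elim, fun j => j.elim⟩ fun j => j.elim
    rw [Finset.univ_eq_empty, Finset.sum_empty] at h0
    exact ⟨ne_top_of_le_ne_top ENNReal.ofReal_ne_top h1, ENNReal.toReal_le_of_le_ofReal h0 h1⟩
  -- Trial states: all plane waves of the Fermi ball with all spins.
  have hlow : ∀ V : EuclideanSpace ℝ (Fin (m + 2)) → ℝ,
      MemLp V (1 + ((m + 2 : ℕ) : ℝ≥0∞) / 2) (boxMeasure (m + 2) L) →
      T₀ - q * (N * (L ^ (m + 2))⁻¹) * ∫ x, V x ∂(boxMeasure (m + 2) L) ≤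
        (traceNeg (m + 2) q L V μ).toReal := by
    intro V hV
    have ho := (orthonormal_planeWave (d := m + 2) (q := q) hL).comp
      (fun j : fermiBall (m + 2) R × Fin q => ((j.1 : Fin (m + 2) → ℤ), j.2)) fun a b h => by
        obtain ⟨h1, h2⟩ := Prod.mk.inj h
        exact Prod.ext (Subtype.ext h1) h2
    refine le_trans (le_of_eq ?_) (sum_sub_energyForm_le hL hV (htr V V hV hV fun _ => le_rfl).1 ho
      fun j => inFormDomain_planeWave hL (integrable_of_memLp hV) _)
    simp only [Function.comp_apply, energyForm_planeWave hL]
    rw [Fintype.sum_prod_type]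
    simp only [Finset.sum_const, Finset.card_univ, Fintype.card_fin, nsmul_eq_mul]
    rw [← Finset.mul_sum, Finset.sum_coe_sort (fermiBall (m + 2) R) fun p =>
      μ - (momentumSq (m + 2) L p + (L ^ (m + 2))⁻¹ * ∫ x, V x ∂(boxMeasure (m + 2) L))]
    simp only [T₀, ← sub_sub, Finset.sum_sub_distrib, Finset.sum_const, nsmul_eq_mul]
    ring
  have hz : MemLp (0 : EuclideanSpace ℝ (Fin (m + 2)) → ℝ) (1 + ((m + 2 : ℕ) : ℝ≥0∞) / 2)
      (boxMeasure (m + 2) L) := MemLp.zero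
  have h0 : (traceNeg (m + 2) q L 0 μ).toReal = T₀ := by
    have hc : critExp m ≠ 0 := by
      have : 0 < critExp m := by positivity
      exact this.ne'
    refine le_antisymm ?_ ?_
    · have h := (htr 0 0 hz hz fun _ => le_rfl).2
      simpa [errorDensity, Real.zero_rpow hc] using h
    · have h := hlow 0 hz
      simpa using h
  have hbox := boxDensity_eq (d := m + 2) q hL hR
  refine ⟨(htr V V hV hV fun _ => le_rfl).1, ?_, fun U hU hUV ρ hρ => ?_⟩
  · have h := hlow V hV
    rw [relativeEnergy, h0, hbox]
    linarith
  · have h := (htr V U hV hU hUV).2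
    have hUi := integrable_of_memLp hU
    have hρ' : |ρ - q * (N * (L ^ (m + 2))⁻¹)| ≤
        q * C₂ * ((1 + R) ^ (m + 1) * (L ^ (m + 2))⁻¹) := by
      rcases hρ with rfl | rfl
      · rw [hbox, sub_self, abs_zero]
        positivity
      · have := hdens q L R hL hR
        rwa [hbox] at this
    have hN : (N : ℝ) ≤ C₃ * (1 + R) ^ (m + 2) := hball R _ hR fun k hk => mem_fermiBall.mp hk
    set P := ∫ x, |V x| ∂(boxMeasure (m + 2) L)
    set Q := ∫ x, (V x - U x) ∂(boxMeasure (m + 2) L)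
    set W := ∫ x, errorDensity m L R (U x) ∂(boxMeasure (m + 2) L)
    have hQ0 : 0 ≤ Q := integral_nonneg fun x => sub_nonneg.mpr (hUV x)
    have hP0 : 0 ≤ P := integral_nonneg fun x => abs_nonneg _
    have hW0 : 0 ≤ W := integral_nonneg fun x => by
      simp only [errorDensity, Pi.zero_apply]
      positivity
    have hQ : Q = (∫ x, V x ∂(boxMeasure (m + 2) L)) - ∫ x, U x ∂(boxMeasure (m + 2) L) :=
      integral_sub hVi hUi
    have hP : |∫ x, V x ∂(boxMeasure (m + 2) L)| ≤ P := abs_integral_le_integral_abs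
    have htot : ∫ x, totalErrorDensity m L R (V x) (U x) ∂(boxMeasure (m + 2) L) =
        W + (1 + R) ^ (m + 1) * (L ^ (m + 2))⁻¹ * P + (1 + R) ^ (m + 2) * (L ^ (m + 2))⁻¹ * Q := by
      have i1 := integrable_errorDensity R hU
      have i2 := hVi.abs.const_mul ((1 + R) ^ (m + 1) * (L ^ (m + 2))⁻¹)
      have i3 : Integrable (fun x => (1 + R) ^ (m + 2) * (L ^ (m + 2))⁻¹ * (V x - U x))
        (boxMeasure (m + 2) L) := (hVi.sub hUi).const_mul _
      have i12 : Integrable (fun x => errorDensity m L R (U x) +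
        (1 + R) ^ (m + 1) * (L ^ (m + 2))⁻¹ * |V x|) (boxMeasure (m + 2) L) := i1.add i2
      simp only [totalErrorDensity]
      rw [integral_add i12 i3, integral_add i1 i2, integral_const_mul]
      congr 1
      exact integral_const_mul _ _
    rw [htot, relativeEnergy, h0]
    set v := ∫ x, V x ∂(boxMeasure (m + 2) L)
    set B := (1 + R) ^ (m + 1) * (L ^ (m + 2))⁻¹
    set D := (1 + R) ^ (m + 2) * (L ^ (m + 2))⁻¹
    have hB0 : 0 ≤ B := by positivity
    have hD0 : 0 ≤ D := by positivity
    have e1 : (ρ - q * (N * (L ^ (m + 2))⁻¹)) * v ≤ q * C₂ * B * P :=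
      (le_abs_self _).trans (by rw [abs_mul]; gcongr)
    -- Lowering V to U costs the density times ∫(V - U); the density is bounded crudely by the count
    -- of modes in the ball.
    have e2 : q * (N * (L ^ (m + 2))⁻¹) * Q ≤ q * C₃ * D * Q := by
      have : N * (L ^ (m + 2))⁻¹ ≤ C₃ * D := by
        simp only [D, ← mul_assoc]
        gcongr
      calc _ ≤ q * (C₃ * D) * Q := by gcongr
        _ = _ := by ring
    have hq : (0 : ℝ) ≤ q := by positivity
    have f1 : 0 ≤ q * C₁ * (B * P + D * Q) := by positivity
    have f2 : 0 ≤ q * C₂ * (W + D * Q) := by positivity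
    have f3 : 0 ≤ q * C₃ * (W + B * P) := by positivity
    rw [hQ] at e2
    have e3 : q * (C₁ + C₂ + C₃) * (W + B * P + D * Q) = q * C₁ * W + q * C₂ * B * P +
        q * C₃ * D * Q + q * C₁ * (B * P + D * Q) + q * C₂ * (W + D * Q) +
        q * C₃ * (W + B * P) := by ring
    rw [e3]
    rw [← hQ] at e2
    have e4 : q * (N * (L ^ (m + 2))⁻¹) * Q = q * (N * (L ^ (m + 2))⁻¹) * v -
        q * (N * (L ^ (m + 2))⁻¹) * ∫ x, U x ∂(boxMeasure (m + 2) L) := by rw [hQ]; ring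
    linarith

end RelativeEnergy

/-! ### Elementary inequalities for the error densities -/

section Scalar

/-- Bernoulli with exponent α/2 ≥ 1 applied to (1 + y)² = 1 + (2y + y²) gains the quadratic term. -/
lemma one_add_mul_add_sq_le_rpow {α y : ℝ} (hα : 2 ≤ α) (hy : -1 ≤ y) :
    1 + α * y + y ^ 2 ≤ (1 + y) ^ α := by
  have h1 : (1 + y) ^ α = (1 + (2 * y + y ^ 2)) ^ (α / 2) := by
    rw [show 1 + (2 * y + y ^ 2) = (1 + y) ^ (2 : ℝ) by rw [Real.rpow_two]; ring,
      ← Real.rpow_mul (by linarith)]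
    congr 1
    ring
  have h2 := one_add_mul_self_le_rpow_one_add (s := 2 * y + y ^ 2) (p := α / 2)
    (by nlinarith [sq_nonneg (1 + y)]) (by linarith)
  rw [h1]
  nlinarith [sq_nonneg y]

/-- Split (1 + y)² as (1 + 2y) + y²; superadditivity of the power α/2 separates y^α, and Bernoulli
treats the rest. -/
lemma one_add_mul_add_rpow_le_rpow {α y : ℝ} (hα : 2 ≤ α) (hy : 0 ≤ y) :
    1 + α * y + y ^ α ≤ (1 + y) ^ α := by
  have h1 : (1 + y) ^ α = ((1 + 2 * y) + y ^ 2) ^ (α / 2) := by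
    rw [show (1 + 2 * y) + y ^ 2 = (1 + y) ^ (2 : ℝ) by rw [Real.rpow_two]; ring,
      ← Real.rpow_mul (by linarith)]
    congr 1
    ring
  have h2 := one_add_mul_self_le_rpow_one_add (s := 2 * y) (p := α / 2)
    (by linarith) (by linarith)
  have h3 := Real.add_rpow_le_rpow_add (a := 1 + 2 * y) (b := y ^ 2) (p := α / 2) (by linarith)
    (sq_nonneg y) (by linarith)
  have h4 : (y ^ 2) ^ (α / 2) = y ^ α := by
    rw [← Real.rpow_two, ← Real.rpow_mul hy]
    congr 1
    ring
  rw [h4] at h3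
  rw [h1]
  linarith

lemma sq_add_abs_rpow_le {α y : ℝ} (hα : 2 ≤ α) (hy : -1 ≤ y) :
    y ^ 2 + |y| ^ α ≤ 2 * ((1 + y) ^ α - 1 - α * y) := by
  have h1 := one_add_mul_add_sq_le_rpow hα hy
  rcases le_total 0 y with h | h
  · have h2 := one_add_mul_add_rpow_le_rpow hα h
    rw [abs_of_nonneg h]
    linarith
  · have h2 : |y| ^ α ≤ y ^ 2 := by
      rcases h.eq_or_lt with rfl | h0
      · rw [abs_zero, Real.zero_rpow (by linarith)]
        positivity
      · calc |y| ^ α ≤ |y| ^ (2 : ℝ) := Real.rpow_le_rpow_of_exponent_ge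
              (abs_pos.mpr h0.ne) (by rw [abs_of_neg h0]; linarith) hα
          _ = y ^ 2 := by rw [Real.rpow_two, sq_abs]
    linarith

lemma two_le_critExp_real (m : ℕ) : 2 ≤ critExp m := by
  have : (0 : ℝ) ≤ m := by positivity
  rw [critExp]
  push_cast
  linarith

lemma sqrt_pow_eq_rpow {x : ℝ} (hx : 0 ≤ x) (n : ℕ) : √x ^ n = x ^ ((n : ℝ) / 2) := by
  rw [Real.rpow_div_two_eq_sqrt _ hx, Real.rpow_natCast]

/-- For v ≤ μ put y = -v/μ ≥ -1: both sides scale to the previous inequality. For v > μ the replaced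
potential is 0, and the right side still dominates μ^{d/2}v. -/
lemma le_two_mul_semiclassicalDensity {m : ℕ} {μ : ℝ} (hμ : 0 < μ) (v : ℝ) :
    √μ ^ m * (if v ≤ μ then v else 0) ^ 2 + |if v ≤ μ then v else 0| ^ critExp m +
      √μ ^ (m + 2) * (v - if v ≤ μ then v else 0) ≤
    2 * ((v - μ)⁻ ^ critExp m - μ ^ critExp m + critExp m * √μ ^ (m + 2) * v) := by
  have hα := two_le_critExp_real m
  have hμα : μ * √μ ^ (m + 2) = μ ^ critExp m := sqrt_pow_mul_self hμ.le
  have hs : √μ ^ 2 = μ := Real.sq_sqrt hμ.le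
  set s := √μ
  have hs0 : 0 ≤ s := Real.sqrt_nonneg _
  have hα0 : 0 < critExp m := by linarith
  split_ifs with h
  · set y := -v / μ
    have hv : v = -(μ * y) := by
      simp only [y]
      field_simp
    have hy : -1 ≤ y := by
      rw [le_div_iff₀ hμ]
      linarith
    have h1 := sq_add_abs_rpow_le hα hy
    have h2 : (v - μ)⁻ = μ * (1 + y) := by
      rw [negPart_of_nonpos (by linarith), hv]
      ring
    rw [h2, Real.mul_rpow hμ.le (by linarith), hv, abs_neg, abs_mul, abs_of_pos hμ,
      Real.mul_rpow hμ.le (abs_nonneg _), ← hμα]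
    have h3 : s ^ m * (-(μ * y)) ^ 2 = μ * s ^ (m + 2) * y ^ 2 := by
      rw [pow_add, hs]
      ring
    rw [h3]
    have h4 : 0 ≤ μ * s ^ (m + 2) := by positivity
    nlinarith [mul_le_mul_of_nonneg_left h1 h4]
  · have h' := not_le.mp h
    rw [negPart_of_nonneg (by linarith), Real.zero_rpow hα0.ne', abs_zero,
      Real.zero_rpow hα0.ne', ← hμα]
    have h4 : 0 ≤ s ^ (m + 2) := by positivity
    nlinarith [mul_le_mul_of_nonneg_left h'.le h4, mul_nonneg (sub_nonneg.mpr hα)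
      (mul_nonneg h4 (hμ.le.trans h'.le))]

lemma totalErrorDensity_nonneg {m : ℕ} {L R v u : ℝ} (hL : 0 < L) (hR : 0 ≤ R) (h : u ≤ v) :
    0 ≤ totalErrorDensity m L R v u := by
  have := sub_nonneg.mpr h
  rw [totalErrorDensity, errorDensity]
  positivity

/-- Since √μ L ≥ 1, one has 1 + R ≤ 2√μ L: the shell error becomes μ^{(d-1)/2}/L and the density is
of order μ^{d/2}. -/
lemma totalErrorDensity_le_of_large {m : ℕ} {L μ : ℝ} (hL : 0 < L) (hμ : 1 / L ^ 2 < μ) (v : ℝ) :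
    totalErrorDensity m L (L / (2 * Real.pi) * √μ) v (if v ≤ μ then v else 0) ≤
      2 ^ (m + 3) * ((v - μ)⁻ ^ critExp m - μ ^ critExp m + critExp m * √μ ^ (m + 2) * v +
        √μ ^ (m + 1) / L * |v|) := by
  have hμ0 : 0 < μ := lt_trans (by positivity) hμ
  have h := le_two_mul_semiclassicalDensity (m := m) hμ0 v
  have hu : |if v ≤ μ then v else 0| ≤ |v| := by
    split_ifs
    · exact le_rfl
    · rw [abs_zero]; exact abs_nonneg v
  have hvu : 0 ≤ v - if v ≤ μ then v else 0 := by
    split_ifs with h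
    · rw [sub_self]
    · linarith [not_le.mp h]
  set u := if v ≤ μ then v else 0
  set s := √μ
  have hs0 : 0 ≤ s := Real.sqrt_nonneg _
  have hsL : 1 ≤ s * L := by
    have h1 : 1 / L < s := by
      refine (Real.lt_sqrt (by positivity)).mpr ?_
      rwa [div_pow, one_pow]
    rw [div_lt_iff₀ hL] at h1
    exact h1.le
  set R := L / (2 * Real.pi) * s
  have hR0 : 0 ≤ R := by positivity
  have hcR : 2 * Real.pi / L * R = s := by
    simp only [R]
    field_simp
  have hR : 1 + R ≤ 2 * (s * L) := by
    have h1 : R ≤ s * L := by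
      simp only [R]
      rw [div_mul_eq_mul_div, div_le_iff₀ (by positivity), mul_comm L s]
      refine le_mul_of_one_le_right (by positivity) ?_
      linarith [Real.pi_gt_three]
    linarith
  have b1 : (1 + R) ^ (m + 1) * (L ^ (m + 2))⁻¹ ≤ 2 ^ (m + 1) * (s ^ (m + 1) / L) := by
    calc _ ≤ (2 * (s * L)) ^ (m + 1) * (L ^ (m + 2))⁻¹ := by gcongr
      _ = _ := by rw [mul_pow, mul_pow]; field_simp; ring
  have b2 : (1 + R) ^ (m + 2) * (L ^ (m + 2))⁻¹ ≤ 2 ^ (m + 2) * s ^ (m + 2) := by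
    calc _ ≤ (2 * (s * L)) ^ (m + 2) * (L ^ (m + 2))⁻¹ := by gcongr
      _ = _ := by rw [mul_pow, mul_pow]; field_simp
  rw [totalErrorDensity, errorDensity, hcR]
  have p1 : 0 ≤ s ^ m * u ^ 2 + |u| ^ critExp m := by positivity
  have p2 : (1 : ℝ) ≤ 2 ^ (m + 2) := one_le_pow₀ (by norm_num)
  have e1 : (1 + R) ^ (m + 1) * (L ^ (m + 2))⁻¹ * |u| ≤ 2 ^ (m + 1) * (s ^ (m + 1) / L) * |v| := by
    gcongr
  have e2 : (1 + R) ^ (m + 1) * (L ^ (m + 2))⁻¹ * |v| ≤ 2 ^ (m + 1) * (s ^ (m + 1) / L) * |v| := by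
    gcongr
  have e3 : (1 + R) ^ (m + 2) * (L ^ (m + 2))⁻¹ * (v - u) ≤ 2 ^ (m + 2) * s ^ (m + 2) * (v - u) := by
    gcongr
  have e4 := le_mul_of_one_le_left p1 p2
  have e5 : 0 ≤ 2 ^ (m + 2) * (s ^ (m + 1) / L * |v|) := by positivity
  have e6 := mul_le_mul_of_nonneg_left h (by positivity : (0 : ℝ) ≤ 2 ^ (m + 2))
  have e7 : (2 : ℝ) ^ (m + 3) = 2 * 2 ^ (m + 2) := by ring
  have e8 : (2 : ℝ) ^ (m + 2) = 2 * 2 ^ (m + 1) := by ring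
  have e9 : 2 ^ (m + 1) * (s ^ (m + 1) / L) * |v| = 2 ^ (m + 2) * (s ^ (m + 1) / L * |v|) / 2 := by
    rw [e8]; ring
  rw [e9] at e1 e2
  rw [e7]
  linarith

/-- Since R ≤ 1, every density is of order L^{-d}, so the whole positive part of v can be discarded
and paid for by |v|/L^d. -/
lemma totalErrorDensity_le_of_small {m : ℕ} {L μ : ℝ} (hL : 0 < L) (hμ : μ ≤ 1 / L ^ 2) (v : ℝ) :
    totalErrorDensity m L (L / (2 * Real.pi) * √μ) v (-v⁻) ≤
      2 ^ (m + 4) * (v⁻ ^ critExp m + 1 / L ^ (m + 2) * |v|) := by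
  set u := v⁻
  have hu0 : 0 ≤ u := negPart_nonneg v
  have hu : u ≤ |v| := by
    rw [← posPart_add_negPart v]
    linarith [posPart_nonneg v]
  have hvu : v - -u ≤ |v| := by
    have := posPart_sub_negPart v
    rw [← posPart_add_negPart v]
    linarith
  have hvu0 : 0 ≤ v - -u := by
    have := posPart_sub_negPart v
    linarith [posPart_nonneg v]
  set s := √μ
  have hs0 : 0 ≤ s := Real.sqrt_nonneg _
  have hsL : s ≤ 1 / L := by
    refine Real.sqrt_le_iff.mpr ⟨by positivity, ?_⟩
    rwa [div_pow, one_pow]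
  set R := L / (2 * Real.pi) * s
  have hR0 : 0 ≤ R := by positivity
  have hcR : 2 * Real.pi / L * R = s := by
    simp only [R]
    field_simp
  have hR : 1 + R ≤ 2 := by
    have h1 : R ≤ L / (2 * Real.pi) * (1 / L) :=
      mul_le_mul_of_nonneg_left hsL (by positivity)
    have h2 : L / (2 * Real.pi) * (1 / L) ≤ 1 := by
      rw [div_mul_div_comm, mul_one, div_le_one (by positivity)]
      refine le_mul_of_one_le_left hL.le ?_
      linarith [Real.pi_gt_three]
    linarith
  set b := (L ^ (m + 2))⁻¹
  have hb0 : 0 ≤ b := by positivity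
  have h1 : s ^ m * u ^ 2 ≤ u ^ critExp m + b * u := by
    rw [← sqrt_pow_mul_self hu0]
    have hsu : √u ^ 2 = u := Real.sq_sqrt hu0
    have hsu0 : 0 ≤ √u := Real.sqrt_nonneg u
    -- Compare √u with 1/L: a small u is absorbed by L^{-d}, a large one by u^{d/2}.
    have h2 : s ^ m * u ≤ √u ^ (m + 2) + b := by
      rcases le_total (√u) (1 / L) with h | h
      · have : s ^ m * √u ^ 2 ≤ (1 / L) ^ m * (1 / L) ^ 2 := by gcongr
        rw [hsu, ← pow_add, one_div, inv_pow] at this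
        have h3 : 0 ≤ √u ^ (m + 2) := by positivity
        linarith
      · have : s ^ m * √u ^ 2 ≤ √u ^ m * √u ^ 2 := by
          gcongr
          exact hsL.trans h
        rw [hsu] at this
        rw [pow_add, hsu]
        linarith
    nlinarith [mul_le_mul_of_nonneg_right h2 hu0]
  rw [totalErrorDensity, errorDensity, hcR, neg_sq, abs_neg, abs_of_nonneg hu0]
  have e1 : (1 + R) ^ (m + 1) * b * u ≤ 2 ^ (m + 1) * b * |v| := by gcongr
  have e2 : (1 + R) ^ (m + 1) * b * |v| ≤ 2 ^ (m + 1) * b * |v| := by gcongr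
  have e3 : (1 + R) ^ (m + 2) * b * (v - -u) ≤ 2 ^ (m + 2) * b * |v| := by gcongr
  have e4 : b * u ≤ b * |v| := by gcongr
  have p2 : (1 : ℝ) ≤ 2 ^ (m + 1) := one_le_pow₀ (by norm_num)
  have e5 : (2 : ℝ) ^ (m + 4) = 8 * 2 ^ (m + 1) := by ring
  have e6 : (2 : ℝ) ^ (m + 2) = 2 * 2 ^ (m + 1) := by ring
  have p3 : 0 ≤ u ^ critExp m := by positivity
  have p4 : 0 ≤ b * |v| := by positivity
  rw [e6] at e3
  rw [e5, one_div]
  nlinarith [mul_le_mul_of_nonneg_right p2 p3, mul_le_mul_of_nonneg_right p2 p4]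

end Scalar

/-! ### Choice of the lowered potential and conclusion -/

section Final

lemma lieb_thirring_box (m : ℕ) : ∃ Lt : ℝ, 0 < Lt ∧ ∀ (q : ℕ) (L μ : ℝ), 0 < L → 0 ≤ μ →
    ∀ V : EuclideanSpace ℝ (Fin (m + 2)) → ℝ,
      MemLp V (1 + ((m + 2 : ℕ) : ℝ≥0∞) / 2) (boxMeasure (m + 2) L) →
      traceNeg (m + 2) q L V μ ≠ ⊤ ∧
      relativeEnergy (m + 2) q L V μ (boxDensity (m + 2) q L μ) ≤ 0 ∧
      ∀ ρ, ρ = boxDensity (m + 2) q L μ ∨ ρ = freeDensity (m + 2) q μ →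
        (1 / L ^ 2 < μ →
          -((q * Lt) * largeMuBound (m + 2) L V μ) ≤ relativeEnergy (m + 2) q L V μ ρ) ∧
        (μ ≤ 1 / L ^ 2 →
          -((q * Lt) * smallMuBound (m + 2) L V) ≤ relativeEnergy (m + 2) q L V μ ρ) := by
  obtain ⟨C, hC, hmain⟩ := exists_relativeEnergy_bounds m
  refine ⟨C * 2 ^ (m + 4), by positivity, fun q L μ hL hμ V hV => ?_⟩
  set R := L / (2 * Real.pi) * √μ
  have hR : 0 ≤ R := by positivity
  have hμR : (2 * Real.pi / L) ^ 2 * R ^ 2 = μ := by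
    rw [← mul_pow, show 2 * Real.pi / L * R = √μ by simp only [R]; field_simp, Real.sq_sqrt hμ]
  obtain ⟨h1, h2, h3⟩ := hmain q L R hL hR V hV
  rw [hμR] at h1 h2 h3
  refine ⟨h1, h2, fun ρ hρ => ⟨fun hl => ?_, fun hs => ?_⟩⟩
  -- For large μ the potential is set to 0 where it exceeds μ.
  · have hU : MemLp (fun x => if V x ≤ μ then V x else 0) (1 + ((m + 2 : ℕ) : ℝ≥0∞) / 2)
        (boxMeasure (m + 2) L) := by
      have hg : Measurable fun v : ℝ => if v ≤ μ then v else 0 :=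
        Measurable.ite measurableSet_Iic measurable_id measurable_const
      refine hV.of_le (hg.comp_aemeasurable hV.1.aemeasurable).aestronglyMeasurable
        (Filter.Eventually.of_forall fun x => ?_)
      split_ifs
      · exact le_rfl
      · rw [norm_zero]; exact norm_nonneg _
    refine le_trans ?_ (h3 _ hU (fun x => ?_) ρ hρ)
    · rw [neg_le_neg_iff, mul_assoc, mul_assoc, mul_assoc]
      refine mul_le_mul_of_nonneg_left (mul_le_mul_of_nonneg_left ?_ hC.le) (by positivity)
      set F : EuclideanSpace ℝ (Fin (m + 2)) → ℝ := fun x =>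
        (V x - μ)⁻ ^ critExp m - μ ^ critExp m + critExp m * √μ ^ (m + 2) * V x +
          √μ ^ (m + 1) / L * |V x|
      have hF : largeMuBound (m + 2) L V μ = ∫ x, F x ∂(boxMeasure (m + 2) L) := by
        rw [largeMuBound]
        refine integral_congr_ae (Filter.Eventually.of_forall fun x => ?_)
        simp only [F]
        rw [sqrt_pow_eq_rpow hμ, sqrt_pow_eq_rpow hμ, critExp]
        congr 2
        · ring
        · congr 2
          push_cast
          ring
      have hFi : Integrable F (boxMeasure (m + 2) L) := by
        have hVi := integrable_of_memLp hV
        refine ((Integrable.sub ?_ (integrable_const _)).add (hVi.const_mul _)).add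
          (hVi.abs.const_mul _)
        refine (integrable_abs_rpow (hV.sub (memLp_const μ))).mono' ?_
          (Filter.Eventually.of_forall fun x => ?_)
        · have := hV.1.aemeasurable
          refine AEMeasurable.aestronglyMeasurable ?_
          simp only [negPart_def]
          fun_prop
        · rw [Real.norm_of_nonneg (by positivity)]
          refine Real.rpow_le_rpow (negPart_nonneg _) ?_ (by positivity)
          change (V x - μ)⁻ ≤ |V x - μ|
          rw [← posPart_add_negPart (V x - μ)]
          exact le_add_of_nonneg_left (posPart_nonneg _)
      rw [hF, ← integral_const_mul]
      refine integral_mono (integrable_totalErrorDensity R hV hU) (hFi.const_mul _) fun x => ?_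
      have h4 := totalErrorDensity_le_of_large (m := m) hL hl (V x)
      -- Nonnegativity of the stated density is a consequence of the comparison itself; it permits
      -- enlarging the constant to the one common to both regimes.
      have h5 : 0 ≤ F x := by
        refine nonneg_of_mul_nonneg_right (le_trans ?_ h4) (by positivity : (0 : ℝ) < 2 ^ (m + 3))
        refine totalErrorDensity_nonneg hL hR ?_
        split_ifs with h
        · exact le_rfl
        · exact hμ.trans (not_le.mp h).le
      refine h4.trans (mul_le_mul_of_nonneg_right ?_ h5)
      exact pow_le_pow_right₀ (by norm_num) (by omega)
    · split_ifs with h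
      · exact le_rfl
      · exact hμ.trans (not_le.mp h).le
  -- For small μ only the negative part of the potential is kept.
  · have hU : MemLp (fun x => -(V x)⁻) (1 + ((m + 2 : ℕ) : ℝ≥0∞) / 2)
        (boxMeasure (m + 2) L) := by
      refine hV.of_le ?_ (Filter.Eventually.of_forall fun x => ?_)
      · have := hV.1.aemeasurable
        refine AEMeasurable.aestronglyMeasurable ?_
        simp only [negPart_def]
        fun_prop
      · rw [norm_neg, Real.norm_of_nonneg (negPart_nonneg _), Real.norm_eq_abs,
          ← posPart_add_negPart (V x)]
        exact le_add_of_nonneg_left (posPart_nonneg _)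
    refine le_trans ?_ (h3 _ hU (fun x => ?_) ρ hρ)
    · rw [neg_le_neg_iff, mul_assoc, mul_assoc, mul_assoc]
      refine mul_le_mul_of_nonneg_left (mul_le_mul_of_nonneg_left ?_ hC.le) (by positivity)
      rw [smallMuBound, ← integral_const_mul]
      refine integral_mono (integrable_totalErrorDensity R hV hU) (Integrable.const_mul ?_ _)
        fun x => totalErrorDensity_le_of_small hL hs (V x)
      refine Integrable.add ?_ ((integrable_of_memLp hV).abs.const_mul _)
      refine (integrable_abs_rpow hU).congr (Filter.Eventually.of_forall fun x => ?_)
      simp only [abs_neg, abs_of_nonneg (negPart_nonneg (V x))]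
    · have := posPart_sub_negPart (V x)
      linarith [posPart_nonneg (V x)]

end Final

end LTBox

end

theorem mainTheorem9 (d : ℕ) (hd : 2 ≤ d) :
    ∃ Lt : ℝ, 0 < Lt ∧ ∀ (q : ℕ) (L μ : ℝ), 0 < L → 0 ≤ μ →
      ∀ V : EuclideanSpace ℝ (Fin d) → ℝ,
        MemLp V (1 + (d : ℝ≥0∞) / 2) (volume.restrict (LTBox.box d L)) →
        LTBox.traceNeg d q L V μ ≠ ⊤ ∧ LTBox.traceNeg d q L 0 μ ≠ ⊤ ∧
        LTBox.relativeEnergy d q L V μ (LTBox.boxDensity d q L μ) ≤ 0 ∧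
        (1 / L ^ 2 < μ →
          -((q * Lt) * LTBox.largeMuBound d L V μ) ≤
              LTBox.relativeEnergy d q L V μ (LTBox.boxDensity d q L μ) ∧
          -((q * Lt) * LTBox.largeMuBound d L V μ) ≤
              LTBox.relativeEnergy d q L V μ (LTBox.freeDensity d q μ)) ∧
        (μ ≤ 1 / L ^ 2 →
          -((q * Lt) * LTBox.smallMuBound d L V) ≤
              LTBox.relativeEnergy d q L V μ (LTBox.boxDensity d q L μ) ∧
          -((q * Lt) * LTBox.smallMuBound d L V) ≤
              LTBox.relativeEnergy d q L V μ (LTBox.freeDensity d q μ)) := by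
  obtain ⟨m, rfl⟩ : ∃ m, d = m + 2 := ⟨d - 2, by omega⟩
  obtain ⟨Lt, hLt, h⟩ := LTBox.lieb_thirring_box m
  refine ⟨Lt, hLt, fun q L μ hL hμ V hV => ?_⟩
  obtain ⟨h1, h2, h3⟩ := h q L μ hL hμ V hV
  have hbox := h3 _ (Or.inl rfl)
  have hfree := h3 _ (Or.inr rfl)
  exact ⟨h1, (h q L μ hL hμ 0 MemLp.zero).1, h2, fun hl => ⟨hbox.1 hl, hfree.1 hl⟩,
    fun hs => ⟨hbox.2 hs, hfree.2 hs⟩⟩
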